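/- Let $\mathbb F$ be a field of characteristic $p>3$, let $m>1$ and $n>3$ be integers, and let $\underline t=(t_1,\dots,t_{2m})$ be a tuple of positive integers. Put $Y_0=\{1,\dots,2m\}$, $Y_1=\{2m+1,\dots,2m+n\}$, $Y=Y_0\cup Y_1$, and $\pi=(\pi_1,\dots,\pi_{2m})$ with $\pi_i=p^{t_i}-1$. Let $\mathcal O(2m,n)=\mathcal O(2m)\otimes\Lambda(n)$ be the tensor product of the divided power algebra in $x_1,\dots,x_{2m}$ and the exterior algebra in $x_{2m+1},\dots,x_{2m+n}$ over $\mathbb F$, with basis $x^{(\alpha)}x^u$, where $\alpha\in\mathbb N_0^{2m}$ and $x^u=x_{i_1}\cdots x_{i_k}$ for $u=\{i_1<\dots<i_k\}\subseteq Y_1$. Write $\mathrm p$ for the parity, $\partial_i$ ($i\in Y$) for the usual partial (super)derivations, $\mu(i)=\bar 0$ for $i\in Y_0$, $\mu(i)=\bar 1$ for $i\in Y_1$, and $x^\omega=x_{2m+1}\cdots x_{2m+n}$, $\omega=Y_1$. Let $W=W(2m,n;\underline t)$ be the span of all $x^{(\alpha)}x^u\partial_i$ with $\alpha\le\pi$ (componentwise),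 $u\subseteq Y_1$, $i\in Y$, a Lie superalgebra of superderivations of $\mathcal O(2m,n)$, $\mathbb Z$-graded by giving $x^{(\alpha)}x^u\partial_i$ the degree $|\alpha|+|u|-1$, and let $\mathcal W=W_{\bar 0}$ be its even part. For $1\le i\le m$ put $i'=i+m$, $\tau(i)=1$; for $m<i\le 2m$ put $i'=i-m$, $\tau(i)=-1$; for $i\in Y_1$ put $i'=i$, $\tau(i)=1$. Let $\mathrm{D_H}(a)=\sum_{i\in Y}\tau(i)(-1)^{\mu(i)\mathrm p(a)}\partial_i(a)\partial_{i'}$, and let $$\mathfrak N=\mathrm{span}_{\mathbb F}\{\mathrm{D_H}(x^{(\alpha)}x^u)\mid \alpha\le\pi,\ |u|\text{ even},\ (\alpha,u)\ne(\pi,\omega),\ (\alpha,u)\neq(\pi,\emptyset)\},$$ a $\mathbb Z$-graded Lie subalgebra of $\mathcal W$. Put $\Gamma'=\sum_{r\in Y_1}x_r\partial_r\in\mathcal W$. If $n$ is even, define for $r\in Y_0$ and $s\ge 1$ the linear maps $\Phi_r^{(s)},\Theta_r^{(s)}:\mathfrak N\to\mathcal W$ by $$\Phi_r^{(s)}(\mathrm{D_H}(f))=\partial_r^{p^s}(f)\,\mathrm{D_H}(x^\omega),\qquad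 \Theta_r^{(s)}(\mathrm{D_H}(f))=x^\omega\,(\mathrm{ad}\,\partial_r)^{p^s}(\mathrm{D_H}(f)).$$ Let $\phi:\mathfrak N\to\mathcal W$ be a derivation, i.e. a linear map with $\phi([x,y])=[x,\phi(y)]-[y,\phi(x)]$, which is $\mathbb Z$-homogeneous (for some $d\in\mathbb Z$, $\phi(\mathfrak N_{[k]})\subseteq\mathcal W_{[k+d]}$ for all $k$) and satisfies $\phi(\mathfrak N_{[-1]}\oplus\mathfrak N_{[0]})=0$. If $n$ is even, then there are $\lambda,\lambda_r^{(s)},\mu_r^{(s)},\eta_r^{(s)}\in\mathbb F$ ($r\in Y_0$, $1\le s<t_r$) such that $\mu_r^{(s)}\eta_r^{(s)}=0$ for all $r,s$ and $$\phi=\lambda\,\mathrm{ad}\,\Gamma'+\sum_{r=1}^{2m}\sum_{s=1}^{t_r-1}\bigl(\lambda_r^{(s)}\Phi_r^{(s)}+\mu_r^{(s)}\Theta_r^{(s)}+\eta_r^{(s)}(\mathrm{ad}\,\partial_r)^{p^s}\bigr)\quad\text{on }\mathfrak N.$$ If $n$ is odd, then there are $\lambda,\eta_r^{(s)}\in\mathbb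 F$ ($r\in Y_0$, $1\le s<t_r$) such that $$\phi=\lambda\,\mathrm{ad}\,\Gamma'+\sum_{r=1}^{2m}\sum_{s=1}^{t_r-1}\eta_r^{(s)}(\mathrm{ad}\,\partial_r)^{p^s}\quad\text{on }\mathfrak N.$$ -/

import Mathlib

namespace HamSuper

attribute [local instance] LieRing.ofAssociativeRing

/-- The index set `Y₀ = {1, …, 2m}` of the even variables: `Sum.inl k` stands for `k` and `Sum.inr k`
for `k + m` (`1 ≤ k ≤ m`). -/
abbrev Y0 (m : ℕ) : Type := Fin m ⊕ Fin m
/-- The index set `Y = Y₀ ∪ Y₁` of all variables; `Y₁` is `Fin n`, ordered as usual. -/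
abbrev Y (m n : ℕ) : Type := Y0 m ⊕ Fin n
/-- Exponents of the standard monomials `x^(α) x^u`, where the strictly increasing tuple `u` is
recorded as a finite set. -/
abbrev Mon (m n : ℕ) : Type := (Y0 m → ℕ) × Finset (Fin n)
/-- The superalgebra `𝒪(2m, n) = 𝒪(2m) ⊗ Λ(n)`, as the vector space with basis `x^(α) x^u`. -/
def O (F : Type*) [Field F] (m n : ℕ) : Type _ := Mon m n →₀ F

noncomputable instance (F : Type*) [Field F] (m n : ℕ) : AddCommGroup (O F m n) :=
  inferInstanceAs (AddCommGroup (Mon m n →₀ F))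

noncomputable instance (F : Type*) [Field F] (m n : ℕ) : Module F (O F m n) :=
  inferInstanceAs (Module F (Mon m n →₀ F))

/-- The basis `x^(α) x^u`. -/
noncomputable def monoBasis (F : Type*) [Field F] (m n : ℕ) : Module.Basis (Mon m n) F (O F m n) :=
  ⟨LinearEquiv.refl F (Mon m n →₀ F)⟩

/-- The number of pairs `(i, j) ∈ u × v` with `j < i`. -/
def inversions {n : ℕ} (u v : Finset (Fin n)) : ℕ := ((u ×ˢ v).filter (fun q => q.2 < q.1)).card
/-- The number of elements of `u` that are smaller than `r`. -/
def below {n : ℕ} (u : Finset (Fin n)) (r : Fin n) : ℕ := (u.filter (fun j => j < r)).card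
/-- `x^u x^v = wedgeCoeff u v • x^(u ∪ v)` in the exterior algebra. -/
def wedgeCoeff {n : ℕ} (u v : Finset (Fin n)) : ℤ := if Disjoint u v then (-1) ^ inversions u v else 0
/-- The multi-binomial coefficient: `x^(α) x^(β) = dpCoeff α β • x^(α + β)`. -/
def dpCoeff {m : ℕ} (α β : Y0 m → ℕ) : ℕ := ∏ i, (α i + β i).choose (α i)

section
variable (F : Type*) [Field F] {m n : ℕ}
/-- The monomial `x^(α) x^u`. -/
noncomputable def mono (α : Y0 m → ℕ) (u : Finset (Fin n)) : O F m n := monoBasis F m n (α, u)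

/-- The product of `𝒪(2m, n)`. -/
noncomputable def mul : O F m n →ₗ[F] O F m n →ₗ[F] O F m n :=
  (monoBasis F m n).constr F fun a => (monoBasis F m n).constr F fun b =>
    ((dpCoeff a.1 b.1 : F) * (wedgeCoeff a.2 b.2 : F)) • mono F (a.1 + b.1) (a.2 ∪ b.2)

/-- The superderivations `∂_i`; for odd `r`, `∂_r (x^u)` is `± x^(u - r)` with the sign that moves `x_r`
to the front, and `0` if `r ∉ u`. -/
noncomputable def pd : Y m n → Module.End F (O F m n)
  | Sum.inl i => (monoBasis F m n).constr F fun a =>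
      if a.1 i = 0 then 0 else mono F (a.1 - Pi.single i 1) a.2
  | Sum.inr r => (monoBasis F m n).constr F fun a =>
      if r ∈ a.2 then (-1 : F) ^ below a.2 r • mono F a.1 (a.2.erase r) else 0

/-- The parity `μ(i)` of `∂_i`. -/
def mu {m n : ℕ} : Y m n → ZMod 2
  | Sum.inl _ => 0
  | Sum.inr _ => 1

/-- The linear map with `sgn i a = (-1)^(μ(i) p(a)) a` for homogeneous `a`. -/
noncomputable def sgn : Y m n → Module.End F (O F m n)
  | Sum.inl _ => LinearMap.id
  | Sum.inr _ => (monoBasis F m n).constr F fun a => (-1 : F) ^ a.2.card • mono F a.1 a.2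
end

section
variable {F : Type*} [Field F] {m n : ℕ}

lemma mono_ext {M : Type*} [AddCommMonoid M] [Module F M] {f g : O F m n →ₗ[F] M}
    (h : ∀ α u, f (mono F α u) = g (mono F α u)) : f = g := by
  exact (monoBasis F m n).ext fun a => h a.1 a.2

lemma mul_mono (α β : Y0 m → ℕ) (u v : Finset (Fin n)) :
    mul F (mono F α u) (mono F β v)
      = ((dpCoeff α β : F) * (wedgeCoeff u v : F)) • mono F (α + β) (u ∪ v) := by
  simp [mul, mono, Module.Basis.constr_basis]

lemma pd_inl_mono (i : Y0 m) (α : Y0 m → ℕ) (u : Finset (Fin n)) :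
    pd F (Sum.inl i) (mono F α u) = if α i = 0 then 0 else mono F (α - Pi.single i 1) u := by
  simp [pd, mono, Module.Basis.constr_basis]

lemma pd_inr_mono (r : Fin n) (α : Y0 m → ℕ) (u : Finset (Fin n)) :
    pd F (Sum.inr r) (mono F α u)
      = if r ∈ u then (-1 : F) ^ below u r • mono F α (u.erase r) else 0 := by
  simp [pd, mono, Module.Basis.constr_basis]

lemma sgn_inr_mono (r : Fin n) (α : Y0 m → ℕ) (u : Finset (Fin n)) :
    sgn F (Sum.inr r) (mono F α u) = (-1 : F) ^ u.card • mono F α u := by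
  simp [sgn, mono, Module.Basis.constr_basis]

lemma inv_union_left {u v w : Finset (Fin n)} (h : Disjoint u v) :
    inversions (u ∪ v) w = inversions u w + inversions v w := by
  unfold inversions
  rw [Finset.union_product, Finset.filter_union, Finset.card_union_of_disjoint]
  rw [Finset.disjoint_left] at *
  rintro ⟨a, b⟩ h1 h2
  simp at h1 h2
  exact h h1.1.1 h2.1.1

lemma inv_union_right {u v w : Finset (Fin n)} (h : Disjoint v w) :
    inversions u (v ∪ w) = inversions u v + inversions u w := by
  unfold inversions
  rw [Finset.product_union, Finset.filter_union, Finset.card_union_of_disjoint]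
  rw [Finset.disjoint_left] at *
  rintro ⟨a, b⟩ h1 h2
  simp at h1 h2
  exact h h1.1.2 h2.1.2

lemma inv_swap {u v : Finset (Fin n)} (h : Disjoint u v) :
    inversions u v + inversions v u = u.card * v.card := by
  have : inversions v u = ((u ×ˢ v).filter (fun q => ¬ q.2 < q.1)).card := by
    unfold inversions
    refine Finset.card_bij (fun q _ => (q.2, q.1)) ?_ ?_ ?_
    · rintro ⟨a, b⟩ hq
      simp at hq ⊢
      exact ⟨⟨hq.1.2, hq.1.1⟩, hq.2.le⟩
    · rintro ⟨a, b⟩ _ ⟨c, d⟩ _ h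
      simp at h ⊢
      tauto
    · rintro ⟨a, b⟩ hq
      simp at hq
      refine ⟨(b, a), ?_, rfl⟩
      simp
      refine ⟨⟨hq.1.2, hq.1.1⟩, lt_of_le_of_ne hq.2 ?_⟩
      rintro rfl
      exact Finset.disjoint_left.1 h hq.1.1 hq.1.2
  rw [this]
  unfold inversions
  rw [Finset.card_filter_add_card_filter_not, Finset.card_product]

lemma inv_singleton_left (r : Fin n) (v : Finset (Fin n)) : inversions {r} v = below v r := by
  unfold inversions below
  refine Finset.card_bij (fun q _ => q.2) ?_ ?_ ?_
  · rintro ⟨a, b⟩ hq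
    simp only [Finset.mem_filter, Finset.mem_product, Finset.mem_singleton] at hq ⊢
    obtain ⟨⟨rfl, h1⟩, h2⟩ := hq
    exact ⟨h1, h2⟩
  · rintro ⟨a, b⟩ h1 ⟨c, d⟩ h2 h
    simp only [Finset.mem_filter, Finset.mem_product, Finset.mem_singleton] at h1 h2
    exact Prod.ext (h1.1.1.trans h2.1.1.symm) h
  · intro b hb
    simp at hb
    exact ⟨(r, b), by simpa using hb, rfl⟩

lemma wedgeCoeff_assoc (u v w : Finset (Fin n)) :
    wedgeCoeff u v * wedgeCoeff (u ∪ v) w = wedgeCoeff v w * wedgeCoeff u (v ∪ w) := by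
  unfold wedgeCoeff
  by_cases h1 : Disjoint u v <;> by_cases h2 : Disjoint u w <;> by_cases h3 : Disjoint v w <;>
    simp [h1, h2, h3, Finset.disjoint_union_left, Finset.disjoint_union_right]
  rw [inv_union_left h1, inv_union_right h3]
  ring

lemma dpCoeff_assoc (α β γ : Y0 m → ℕ) :
    dpCoeff α β * dpCoeff (α + β) γ = dpCoeff β γ * dpCoeff α (β + γ) := by
  unfold dpCoeff
  rw [← Finset.prod_mul_distrib, ← Finset.prod_mul_distrib]
  refine Finset.prod_congr rfl fun i _ => ?_
  simp only [Pi.add_apply]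
  have := Nat.choose_mul (n := α i + β i + γ i) (k := α i + β i) (s := α i) (by omega)
  rw [show α i + β i + γ i - α i = β i + γ i by omega,
    show α i + β i - α i = β i by omega] at this
  rw [mul_comm, this, mul_comm, ← add_assoc]

lemma mul_assoc' (a b c : O F m n) : mul F (mul F a b) c = mul F a (mul F b c) := by
  have : (LinearMap.compr₂ (mul F) (mul F) : O F m n →ₗ[F] O F m n →ₗ[F] O F m n →ₗ[F] O F m n)
      = ((LinearMap.lcomp F (O F m n →ₗ[F] O F m n) (mul F)).comp
          ((LinearMap.llcomp F (O F m n) (O F m n) (O F m n)).comp (mul F))) := by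
    refine mono_ext fun α u => mono_ext fun β v => mono_ext fun γ w => ?_
    simp only [LinearMap.compr₂_apply, LinearMap.comp_apply, LinearMap.lcomp_apply,
      LinearMap.llcomp_apply, mul_mono, map_smul, LinearMap.smul_apply, smul_smul]
    rw [add_assoc, Finset.union_assoc]
    congr 1
    have h1 := congrArg (Int.cast : ℤ → F) (wedgeCoeff_assoc u v w)
    have h2 := congrArg (Nat.cast : ℕ → F) (dpCoeff_assoc α β γ)
    push_cast at h1 h2
    linear_combination (dpCoeff α β * dpCoeff (α + β) γ : F) * h1 +
      (wedgeCoeff v w * wedgeCoeff u (v ∪ w) : F) * h2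
  exact congrArg (fun f => f a b c) this

lemma inv_erase_left {u v : Finset (Fin n)} {r : Fin n} (h : r ∈ u) :
    inversions u v = below v r + inversions (u.erase r) v := by
  conv_lhs => rw [← Finset.insert_erase h, Finset.insert_eq]
  rw [inv_union_left (by simp), inv_singleton_left]

lemma inv_erase_right {u v : Finset (Fin n)} {r : Fin n} (h : r ∈ v) (hu : r ∉ u) :
    inversions u v + below u r = u.card + inversions u (v.erase r) := by
  conv_lhs => rw [← Finset.insert_erase h, Finset.insert_eq]
  rw [inv_union_right (by simp), ← inv_singleton_left]
  have := inv_swap (u := u) (v := {r}) (by simpa using hu)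
  simp at this
  omega

lemma below_union {u v : Finset (Fin n)} (h : Disjoint u v) (r : Fin n) :
    below (u ∪ v) r = below u r + below v r := by
  rw [← inv_singleton_left, inv_union_right h, inv_singleton_left, inv_singleton_left]

lemma below_erase_self (u : Finset (Fin n)) (r : Fin n) : below (u.erase r) r = below u r := by
  unfold below
  congr 1
  ext j
  simp only [Finset.mem_filter, Finset.mem_erase]
  constructor
  · rintro ⟨⟨_, h⟩, h'⟩
    exact ⟨h, h'⟩
  · rintro ⟨h, h'⟩
    exact ⟨⟨h'.ne, h⟩, h'⟩

lemma below_erase_of_le (u : Finset (Fin n)) {r s : Fin n} (h : r ≤ s) :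
    below (u.erase s) r = below u r := by
  unfold below
  congr 1
  ext j
  simp only [Finset.mem_filter, Finset.mem_erase]
  constructor
  · rintro ⟨⟨_, h⟩, h'⟩
    exact ⟨h, h'⟩
  · rintro ⟨h1, h'⟩
    exact ⟨⟨(h'.trans_le h).ne, h1⟩, h'⟩

lemma below_erase_of_lt {u : Finset (Fin n)} {r s : Fin n} (h : r < s) (hr : r ∈ u) :
    below (u.erase r) s + 1 = below u s := by
  unfold below
  rw [Finset.filter_erase, Finset.card_erase_add_one]
  simp [hr, h]

lemma neg_one_pow_congr {a b : ℕ} (h : a % 2 = b % 2) : (-1 : F) ^ a = (-1) ^ b := by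
  rw [neg_one_pow_eq_pow_mod_two, h, ← neg_one_pow_eq_pow_mod_two]

lemma neg_one_pow_add_eq_zero {a b : ℕ} (h : a % 2 = (b + 1) % 2) :
    (-1 : F) ^ a + (-1) ^ b = 0 := by
  rw [neg_one_pow_congr (F := F) h, pow_succ]
  ring

lemma pd_mul_mono_inr (r : Fin n) (α β : Y0 m → ℕ) (u v : Finset (Fin n)) :
    pd F (Sum.inr r) (mul F (mono F α u) (mono F β v))
      = mul F (pd F (Sum.inr r) (mono F α u)) (mono F β v)
        + mul F (sgn F (Sum.inr r) (mono F α u)) (pd F (Sum.inr r) (mono F β v)) := by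
  simp only [mul_mono, pd_inr_mono, sgn_inr_mono, map_smul, LinearMap.smul_apply]
  by_cases hu : r ∈ u <;> by_cases hv : r ∈ v
  · have e1 : u.erase r ∪ v = u ∪ v := by
      ext j
      by_cases h : j = r <;> simp_all
    have e2 : u ∪ v.erase r = u ∪ v := by
      ext j
      by_cases h : j = r <;> simp_all
    have hd : ¬ Disjoint u v := fun h => Finset.disjoint_left.1 h hu hv
    have hdd : Disjoint (u.erase r) v ↔ Disjoint u (v.erase r) :=
      Finset.disjoint_erase_comm
    simp only [hu, hv, if_true, map_smul, LinearMap.smul_apply, mul_mono, e1, e2, wedgeCoeff, hd,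
      if_false, hdd, Finset.mem_union, true_or]
    split_ifs with h
    · have h1 := inv_erase_left (v := v.erase r) hu
      rw [below_erase_self] at h1
      have h2 := inv_erase_right (u := u.erase r) hv (by simp)
      rw [below_erase_self] at h2
      have h3 := Finset.card_erase_add_one hu
      have := neg_one_pow_add_eq_zero (F := F) (a := below u r + inversions (u.erase r) v)
        (b := u.card + below v r + inversions u (v.erase r)) (by omega)
      simp only [smul_smul, ← add_smul]
      push_cast
      rw [mul_zero, zero_mul, zero_smul]
      symm
      convert zero_smul F _ using 2
      rw [pow_add, pow_add, pow_add] at this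
      linear_combination (dpCoeff α β : F) * this
    · simp
  · have e1 : (u ∪ v).erase r = u.erase r ∪ v := by
      ext j
      by_cases h : j = r <;> simp_all
    have hdd : Disjoint (u.erase r) v ↔ Disjoint u v := by
      rw [Finset.disjoint_erase_comm, Finset.erase_eq_of_notMem hv]
    simp only [hu, hv, Finset.mem_union, true_or, if_true, if_false, map_zero, smul_zero, add_zero,
      map_smul, LinearMap.smul_apply, mul_mono, e1, wedgeCoeff, hdd, smul_smul]
    split_ifs with h
    · have h1 := inv_erase_left (v := v) hu
      have h2 := below_union h r
      have := neg_one_pow_congr (F := F) (a := inversions u v + below (u ∪ v) r)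
        (b := below u r + inversions (u.erase r) v) (by omega)
      rw [pow_add, pow_add] at this
      congr 1
      push_cast
      linear_combination (dpCoeff α β : F) * this
    · simp
  · have e1 : (u ∪ v).erase r = u ∪ v.erase r := by
      ext j
      by_cases h : j = r <;> simp_all
    have hdd : Disjoint u (v.erase r) ↔ Disjoint u v := by
      rw [← Finset.disjoint_erase_comm, Finset.erase_eq_of_notMem hu]
    simp only [hu, hv, Finset.mem_union, or_true, if_true, if_false, map_zero, zero_add,
      LinearMap.zero_apply,
      map_smul, mul_mono, e1, wedgeCoeff, hdd, smul_smul]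
    split_ifs with h
    · have h1 := inv_erase_right hv hu
      have h2 := below_union h r
      have := neg_one_pow_congr (F := F) (a := inversions u v + below (u ∪ v) r)
        (b := u.card + below v r + inversions u (v.erase r)) (by omega)
      rw [pow_add, pow_add, pow_add] at this
      congr 1
      push_cast
      linear_combination (dpCoeff α β : F) * this
    · simp
  · simp [hu, hv]

lemma dpCoeff_pascal (i : Y0 m) (α β : Y0 m → ℕ) (h : α i + β i ≠ 0) :
    dpCoeff α β = (if α i = 0 then 0 else dpCoeff (α - Pi.single i 1) β)
      + (if β i = 0 then 0 else dpCoeff α (β - Pi.single i 1)) := by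
  unfold dpCoeff
  simp only [Fintype.prod_eq_mul_prod_compl i]
  have e1 : ∏ j ∈ {i}ᶜ, ((α - Pi.single i 1 : Y0 m → ℕ) j + β j).choose ((α - Pi.single i 1 : Y0 m → ℕ) j)
      = ∏ j ∈ {i}ᶜ, (α j + β j).choose (α j) := by
    refine Finset.prod_congr rfl fun j hj => ?_
    have : j ≠ i := by simpa using hj
    simp [this]
  have e2 : ∏ j ∈ {i}ᶜ, (α j + (β - Pi.single i 1 : Y0 m → ℕ) j).choose (α j)
      = ∏ j ∈ {i}ᶜ, (α j + β j).choose (α j) := by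
    refine Finset.prod_congr rfl fun j hj => ?_
    have : j ≠ i := by simpa using hj
    simp [this]
  rw [e1, e2]
  simp only [Pi.sub_apply, Pi.single_eq_same]
  rcases ha : α i with _ | a <;> rcases hb : β i with _ | b
  · omega
  · simp
  · simp
  · simp only [Nat.add_sub_cancel, Nat.succ_ne_zero, if_false, ← add_mul]
    congr 1
    rw [show a + 1 + (b + 1) = (a + (b + 1)) + 1 by ring, Nat.choose_succ_succ,
      show a + 1 + b = a + (b + 1) by ring]

lemma pd_mul_mono_inl (i : Y0 m) (α β : Y0 m → ℕ) (u v : Finset (Fin n)) :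
    pd F (Sum.inl i) (mul F (mono F α u) (mono F β v))
      = mul F (pd F (Sum.inl i) (mono F α u)) (mono F β v)
        + mul F (mono F α u) (pd F (Sum.inl i) (mono F β v)) := by
  simp only [mul_mono, pd_inl_mono, map_smul, Pi.add_apply]
  by_cases h0 : α i + β i = 0
  · have h1 : α i = 0 := by omega
    have h2 : β i = 0 := by omega
    simp [h1, h2]
  have hp := congrArg (Nat.cast : ℕ → F) (dpCoeff_pascal i α β h0)
  have e1 : α i ≠ 0 → α - Pi.single i 1 + β = α + β - Pi.single i 1 := by
    intro h
    ext j
    by_cases hj : j = i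
    · subst hj
      simp
      omega
    · simp [hj]
  have e2 : β i ≠ 0 → α + (β - Pi.single i 1) = α + β - Pi.single i 1 := by
    intro h
    ext j
    by_cases hj : j = i
    · subst hj
      simp
      omega
    · simp [hj]
  rw [if_neg h0, hp]
  by_cases ha : α i = 0 <;> by_cases hb : β i = 0
  · omega
  · simp [ha, hb, mul_mono, e2 hb]
  · simp [ha, hb, mul_mono, e1 ha]
  · simp only [ha, hb, if_false, mul_mono, e1 ha, e2 hb, ← add_smul]
    push_cast
    ring_nf

lemma pd_mul (i : Y m n) (a b : O F m n) :
    pd F i (mul F a b) = mul F (pd F i a) b + mul F (sgn F i a) (pd F i b) := by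
  have : (LinearMap.compr₂ (mul F) (pd F i) : O F m n →ₗ[F] O F m n →ₗ[F] O F m n)
      = (mul F).comp (pd F i) + ((mul F).comp (sgn F i)).compl₂ (pd F i) := by
    refine mono_ext fun α u => mono_ext fun β v => ?_
    rcases i with i | r
    · exact pd_mul_mono_inl i α β u v
    · exact pd_mul_mono_inr r α β u v
  exact congrArg (fun f => f a b) this

/-- The sign `(-1)^(ab)`. -/
noncomputable def ksign (F : Type*) [Field F] (a b : ZMod 2) : F :=
  if a = 1 ∧ b = 1 then -1 else 1

lemma pd_comm (i j : Y m n) (f : O F m n) :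
    pd F i (pd F j f) = ksign F (mu i) (mu j) • pd F j (pd F i f) := by
  have : (pd F i).comp (pd F j) = ksign F (mu i) (mu j) • (pd F j).comp (pd F i) := by
    refine mono_ext fun α u => ?_
    rcases i with i | r <;> rcases j with j | s <;>
      simp only [LinearMap.comp_apply, LinearMap.smul_apply, mu, ksign, pd_inl_mono, pd_inr_mono]
    · by_cases hij : i = j
      · subst hij
        simp
      · have hji : j ≠ i := fun h => hij h.symm
        by_cases h1 : α i = 0 <;> by_cases h2 : α j = 0 <;>
          simp [h1, h2, pd_inl_mono, hij, hji]
        rw [tsub_right_comm]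
    · by_cases h1 : α i = 0 <;> by_cases h2 : s ∈ u <;>
          simp [h1, h2, pd_inl_mono, pd_inr_mono]
    · by_cases h1 : α j = 0 <;> by_cases h2 : r ∈ u <;>
          simp [h1, h2, pd_inl_mono, pd_inr_mono]
    · by_cases h1 : r ∈ u <;> by_cases h2 : s ∈ u <;>
          simp only [h1, h2, if_true, if_false, map_zero, smul_zero, map_smul, pd_inr_mono,
            Finset.mem_erase, and_true, and_false, and_self]
      · by_cases hrs : r = s
        · subst hrs
          simp
        · have hsr : s ≠ r := fun h => hrs h.symm
          simp only [ne_eq, hrs, hsr, not_false_eq_true, if_true, smul_smul,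
            Finset.erase_right_comm (a := r)]
          congr 1
          rcases lt_or_gt_of_ne hrs with h | h
          · rw [below_erase_of_le u h.le, ← below_erase_of_lt h h1]
            ring
          · rw [below_erase_of_le u h.le, ← below_erase_of_lt h h2]
            ring
  exact congrArg (fun g => g f) this

lemma dvd_choose_of_overflow {p : ℕ} [Fact p.Prime] (t x y : ℕ) (hx : x < p ^ t) (hy : y < p ^ t)
    (h : p ^ t ≤ x + y) : p ∣ (x + y).choose x := by
  have hp : 0 < p := (Fact.out : p.Prime).pos
  induction t generalizing x y with
  | zero => simp at *; omega
  | succ t ih =>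
    have key := Choose.choose_modEq_choose_mod_mul_choose_div_nat (n := x + y) (k := x) (p := p)
    rw [← Nat.modEq_zero_iff_dvd]
    refine key.trans ?_
    rw [Nat.modEq_zero_iff_dvd]
    have hx' : x / p < p ^ t := Nat.div_lt_of_lt_mul (by rwa [pow_succ'] at hx)
    have hy' : y / p < p ^ t := Nat.div_lt_of_lt_mul (by rwa [pow_succ'] at hy)
    have ex := Nat.div_add_mod x p
    have ey := Nat.div_add_mod y p
    have lx := Nat.mod_lt x hp
    have ly := Nat.mod_lt y hp
    by_cases hc : x % p + y % p < p
    · have e : (x + y) / p = x / p + y / p := Nat.add_div_eq_of_add_mod_lt hc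
      rw [e]
      refine Dvd.dvd.mul_left (ih _ _ hx' hy' ?_) _
      rw [← e, Nat.le_div_iff_mul_le hp, ← pow_succ]
      exact h
    · have e : (x + y) % p = x % p + y % p - p := by
        rw [Nat.add_mod, Nat.mod_eq_sub_mod (by omega), Nat.mod_eq_of_lt (by omega)]
      rw [e, Nat.choose_eq_zero_of_lt (by omega), zero_mul]
      exact dvd_zero _

/-- The tuple `π`, `π_i = p^(t_i) - 1`. -/
def piMax (p : ℕ) (t : Y0 m → ℕ) : Y0 m → ℕ := fun i => p ^ t i - 1

/-- The part of parity `ε` of the truncated algebra `𝒪(2m, n; t)`. -/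
noncomputable def truncPar (F : Type*) [Field F] {m : ℕ} (n p : ℕ) (t : Y0 m → ℕ) (ε : ZMod 2) :
    Submodule F (O F m n) :=
  Submodule.span F {f | ∃ (α : Y0 m → ℕ) (u : Finset (Fin n)),
    α ≤ piMax p t ∧ (u.card : ZMod 2) = ε ∧ f = mono F α u}

lemma mono_mem_truncPar {p : ℕ} {t : Y0 m → ℕ} {α : Y0 m → ℕ} {u : Finset (Fin n)}
    (h : α ≤ piMax p t) : mono F α u ∈ truncPar F n p t (u.card : ZMod 2) :=
  Submodule.subset_span ⟨α, u, h, rfl, rfl⟩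

lemma truncPar_induction {p : ℕ} {t : Y0 m → ℕ} {ε : ZMod 2} {q : O F m n → Prop}
    (h0 : q 0) (hadd : ∀ a b, q a → q b → q (a + b)) (hsmul : ∀ (c : F) a, q a → q (c • a))
    (hmono : ∀ α u, α ≤ piMax p t → (u.card : ZMod 2) = ε → q (mono F α u))
    {a : O F m n} (ha : a ∈ truncPar F n p t ε) : q a := by
  induction ha using Submodule.span_induction with
  | mem x hx =>
    obtain ⟨α, u, h1, h2, rfl⟩ := hx
    exact hmono α u h1 h2
  | zero => exact h0
  | add x y _ _ hx hy => exact hadd x y hx hy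
  | smul c x _ hx => exact hsmul c x hx

lemma card_cast_union {u v : Finset (Fin n)} (h : Disjoint u v) :
    ((u ∪ v).card : ZMod 2) = u.card + v.card := by
  rw [Finset.card_union_of_disjoint h]
  push_cast
  rfl

lemma mul_mem_truncPar {p : ℕ} [Fact p.Prime] [CharP F p] {t : Y0 m → ℕ} {ε δ : ZMod 2}
    {a b : O F m n} (ha : a ∈ truncPar F n p t ε) (hb : b ∈ truncPar F n p t δ) :
    mul F a b ∈ truncPar F n p t (ε + δ) := by
  have hp : 0 < p := (Fact.out : p.Prime).pos
  refine truncPar_induction (q := fun a => mul F a b ∈ truncPar F n p t (ε + δ)) ?_ ?_ ?_ ?_ ha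
  · simp
  · intro x y hx hy
    simpa using add_mem hx hy
  · intro c x hx
    simpa using Submodule.smul_mem _ c hx
  intro α u hα hu
  refine truncPar_induction
    (q := fun b => mul F (mono F α u) b ∈ truncPar F n p t (ε + δ)) ?_ ?_ ?_ ?_ hb
  · simp
  · intro x y hx hy
    simpa using add_mem hx hy
  · intro c x hx
    simpa using Submodule.smul_mem _ c hx
  intro β v hβ hv
  rw [mul_mono]
  by_cases hd : Disjoint u v
  · by_cases hαβ : α + β ≤ piMax p t
    · refine Submodule.smul_mem _ _ ?_
      have := mono_mem_truncPar (F := F) (u := u ∪ v) hαβ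
      rwa [card_cast_union hd, hu, hv] at this
    · have : (dpCoeff α β : F) = 0 := by
        rw [CharP.cast_eq_zero_iff F p]
        rw [Pi.le_def] at hαβ
        push Not at hαβ
        obtain ⟨i, hi⟩ := hαβ
        refine Dvd.dvd.trans ?_ (Finset.dvd_prod_of_mem _ (Finset.mem_univ i))
        have h1 := hα i
        have h2 := hβ i
        have h3 : 0 < p ^ t i := pow_pos hp _
        simp only [piMax, Pi.add_apply] at h1 h2 hi
        exact dvd_choose_of_overflow (t i) _ _ (by omega) (by omega) (by omega)
      simp [this]
  · simp [wedgeCoeff, hd]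

lemma pd_mem_truncPar {p : ℕ} {t : Y0 m → ℕ} {ε : ZMod 2} (i : Y m n)
    {a : O F m n} (ha : a ∈ truncPar F n p t ε) :
    pd F i a ∈ truncPar F n p t (ε + mu i) := by
  refine truncPar_induction (q := fun a => pd F i a ∈ truncPar F n p t (ε + mu i)) ?_ ?_ ?_ ?_ ha
  · simp
  · intro x y hx hy
    simpa using add_mem hx hy
  · intro c x hx
    simpa using Submodule.smul_mem _ c hx
  intro α u hα hu
  rcases i with i | r
  · rw [pd_inl_mono]
    split_ifs
    · simp
    · have := mono_mem_truncPar (F := F) (u := u) (α := α - Pi.single i 1) (p := p) (t := t)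
        (tsub_le_self.trans hα)
      simpa [mu, hu] using this
  · rw [pd_inr_mono]
    split_ifs with h
    · refine Submodule.smul_mem _ _ ?_
      have h2 := mono_mem_truncPar (F := F) (u := u.erase r) hα
      have h3 := Finset.card_erase_add_one h
      have h4 : ((u.erase r).card : ZMod 2) = ε + 1 := by
        rw [← hu, ← h3]
        push_cast
        rw [add_assoc, show (1 + 1 : ZMod 2) = 0 from rfl, add_zero]
      rwa [h4] at h2
    · simp

lemma ksign_natCast (a b : ℕ) : ksign F (a : ZMod 2) (b : ZMod 2) = (-1) ^ (a * b) := by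
  unfold ksign
  rcases Nat.even_or_odd a with ha | ha <;> rcases Nat.even_or_odd b with hb | hb
  · have := (ZMod.natCast_eq_zero_iff_even).2 ha
    rw [(ha.mul_right b).neg_one_pow]
    simp [this]
  · have := (ZMod.natCast_eq_zero_iff_even).2 ha
    rw [(ha.mul_right b).neg_one_pow]
    simp [this]
  · have := (ZMod.natCast_eq_zero_iff_even).2 hb
    rw [(hb.mul_left a).neg_one_pow]
    simp [this]
  · have h1 := (ZMod.natCast_eq_one_iff_odd).2 ha
    have h2 := (ZMod.natCast_eq_one_iff_odd).2 hb
    rw [(ha.mul hb).neg_one_pow]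
    simp [h1, h2]

lemma dpCoeff_comm (α β : Y0 m → ℕ) : dpCoeff α β = dpCoeff β α := by
  unfold dpCoeff
  refine Finset.prod_congr rfl fun i _ => ?_
  rw [add_comm, Nat.choose_symm_add]

lemma mul_comm' {p : ℕ} {t : Y0 m → ℕ} {ε δ : ZMod 2}
    {a b : O F m n} (ha : a ∈ truncPar F n p t ε) (hb : b ∈ truncPar F n p t δ) :
    mul F a b = ksign F ε δ • mul F b a := by
  refine truncPar_induction (q := fun a => mul F a b = ksign F ε δ • mul F b a) ?_ ?_ ?_ ?_ ha
  · simp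
  · intro x y hx hy
    simp [hx, hy]
  · intro c x hx
    simp [hx, smul_comm c]
  intro α u hα hu
  refine truncPar_induction
    (q := fun b => mul F (mono F α u) b = ksign F ε δ • mul F b (mono F α u)) ?_ ?_ ?_ ?_ hb
  · simp
  · intro x y hx hy
    simp [hx, hy]
  · intro c x hx
    simp [hx, smul_comm c]
  intro β v hβ hv
  rw [mul_mono, mul_mono, ← hu, ← hv, ksign_natCast, smul_smul, add_comm β, Finset.union_comm v,
    dpCoeff_comm β]
  congr 1
  unfold wedgeCoeff
  by_cases h : Disjoint u v
  · rw [if_pos h, if_pos h.symm]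
    have h1 := inv_swap h
    have := neg_one_pow_congr (F := F) (a := inversions u v) (b := u.card * v.card + inversions v u) (by omega)
    rw [pow_add] at this
    push_cast
    rw [this]
    ring
  · rw [if_neg h, if_neg fun h' => h h'.symm]
    simp

lemma sgn_of_mem {p : ℕ} {t : Y0 m → ℕ} {ε : ZMod 2} (i : Y m n)
    {a : O F m n} (ha : a ∈ truncPar F n p t ε) : sgn F i a = ksign F (mu i) ε • a := by
  refine truncPar_induction (q := fun a => sgn F i a = ksign F (mu i) ε • a) ?_ ?_ ?_ ?_ ha
  · simp
  · intro x y hx hy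
    simp [hx, hy]
  · intro c x hx
    simp [hx, smul_comm c]
  intro α u hα hu
  rcases i with i | r
  · simp [sgn, mu, ksign]
  · rw [sgn_inr_mono, ← hu]
    have := ksign_natCast (F := F) 1 u.card
    rw [one_mul, Nat.cast_one] at this
    simp only [mu]
    rw [this]

variable (F) in
/-- The vector field `a ∂_i`, as an operator on `𝒪(2m, n)`. -/
noncomputable def vf (i : Y m n) : O F m n →ₗ[F] Module.End F (O F m n) :=
  (LinearMap.mulRight F (pd F i)) ∘ₗ (mul F)

lemma vf_apply (i : Y m n) (a f : O F m n) : vf F i a f = mul F a (pd F i f) := rfl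

lemma ksign_mul_self (a b : ZMod 2) : ksign F a b * ksign F a b = 1 := by
  unfold ksign
  split_ifs <;> simp

lemma ksign_comm (a b : ZMod 2) : ksign F a b = ksign F b a := by
  unfold ksign
  by_cases ha : a = 1 <;> by_cases hb : b = 1 <;> simp [ha, hb]

lemma vf_lie {p : ℕ} {t : Y0 m → ℕ} {i j : Y m n} {a b : O F m n}
    (ha : a ∈ truncPar F n p t (mu i)) (hb : b ∈ truncPar F n p t (mu j)) :
    ⁅vf F i a, vf F j b⁆ = vf F j (mul F a (pd F i b)) - vf F i (mul F b (pd F j a)) := by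
  refine LinearMap.ext fun f => ?_
  rw [Ring.lie_def]
  simp only [LinearMap.sub_apply, Module.End.mul_apply, vf_apply, pd_mul, sgn_of_mem i hb,
    sgn_of_mem j ha, map_add, map_smul, LinearMap.smul_apply, mul_assoc']
  rw [pd_comm i j f, ← mul_assoc' a b, mul_comm' ha hb, ← mul_assoc' b a, ksign_comm (mu j)]
  simp only [map_smul, LinearMap.smul_apply, smul_smul, ksign_mul_self, mul_one]
  abel

variable (F n) in
/-- The span of the even fields `x^(α) x^u ∂_i` with `α ≤ π`. -/
noncomputable def evenWittSpan (p : ℕ) (t : Y0 m → ℕ) : Submodule F (Module.End F (O F m n)) :=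
  Submodule.span F {D | ∃ (α : Y0 m → ℕ) (u : Finset (Fin n)) (i : Y m n),
    α ≤ piMax p t ∧ (u.card : ZMod 2) + mu i = 0 ∧ D = vf F i (mono F α u)}

lemma add_eq_zero_zmod2 {a b : ZMod 2} : a + b = 0 ↔ a = b := by
  revert a b
  decide

lemma vf_mem {p : ℕ} {t : Y0 m → ℕ} {i : Y m n} {a : O F m n}
    (ha : a ∈ truncPar F n p t (mu i)) : vf F i a ∈ evenWittSpan F n p t := by
  refine truncPar_induction (q := fun a => vf F i a ∈ evenWittSpan F n p t) ?_ ?_ ?_ ?_ ha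
  · simp
  · intro x y hx hy
    simpa using add_mem hx hy
  · intro c x hx
    simpa using Submodule.smul_mem _ c hx
  intro α u hα hu
  exact Submodule.subset_span ⟨α, u, i, hα, add_eq_zero_zmod2.2 hu, rfl⟩

lemma evenWitt_lie_mem {p : ℕ} [Fact p.Prime] [CharP F p] {t : Y0 m → ℕ}
    {x y : Module.End F (O F m n)} (hx : x ∈ evenWittSpan F n p t)
    (hy : y ∈ evenWittSpan F n p t) : ⁅x, y⁆ ∈ evenWittSpan F n p t := by
  induction hx, hy using Submodule.span_induction₂ with
  | mem_mem x y hx hy =>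
    obtain ⟨α, u, i, hα, hu, rfl⟩ := hx
    obtain ⟨β, v, j, hβ, hv, rfl⟩ := hy
    have ha := mono_mem_truncPar (F := F) (u := u) hα
    have hb := mono_mem_truncPar (F := F) (u := v) hβ
    rw [add_eq_zero_zmod2] at hu hv
    rw [hu] at ha
    rw [hv] at hb
    rw [vf_lie ha hb]
    have h1 := mul_mem_truncPar ha (pd_mem_truncPar i hb)
    have h2 := mul_mem_truncPar hb (pd_mem_truncPar j ha)
    have key : ∀ a b : ZMod 2, a + (b + a) = b := by decide
    rw [key] at h1 h2
    exact sub_mem (vf_mem h1) (vf_mem h2)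
  | zero_left y hy => simp
  | zero_right x hx => simp
  | add_left x y z _ _ _ h1 h2 =>
    rw [add_lie]
    exact add_mem h1 h2
  | add_right x y z _ _ _ h1 h2 =>
    rw [lie_add]
    exact add_mem h1 h2
  | smul_left r x y _ _ h =>
    rw [smul_lie]
    exact Submodule.smul_mem _ r h
  | smul_right r x y _ _ h =>
    rw [lie_smul]
    exact Submodule.smul_mem _ r h

variable (F n) in
/-- The even part `𝒲` of `W(2m, n; t)`. On even elements the superbracket is the commutator of
operators. -/
noncomputable def evenWitt (p : ℕ) [Fact p.Prime] [CharP F p] (t : Y0 m → ℕ) :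
    LieSubalgebra F (Module.End F (O F m n)) :=
  { evenWittSpan F n p t with lie_mem' := fun hx hy => evenWitt_lie_mem hx hy }

/-- The involution `i ↦ i'`. -/
def dual : Y m n → Y m n
  | Sum.inl i => Sum.inl i.swap
  | Sum.inr r => Sum.inr r

variable (F) in
/-- The signs `τ(i)`. -/
def tau : Y m n → F
  | Sum.inl (Sum.inl _) => 1
  | Sum.inl (Sum.inr _) => -1
  | Sum.inr _ => 1

variable (F) in
/-- The map `D_H(a) = ∑_i τ(i) (-1)^(μ(i) p(a)) ∂_i(a) ∂_{i'}`. -/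
noncomputable def ham : O F m n →ₗ[F] Module.End F (O F m n) :=
  ∑ i : Y m n, tau F i • (vf F (dual i) ∘ₗ pd F i ∘ₗ sgn F i)

lemma dual_dual (i : Y m n) : dual (dual i) = i := by
  rcases i with (i | i) | r <;> rfl

lemma dual_involutive : Function.Involutive (dual : Y m n → Y m n) := dual_dual

lemma mu_dual (i : Y m n) : mu (dual i) = mu i := by
  rcases i with (i | i) | r <;> rfl

lemma tau_dual (i : Y m n) : tau F (dual i) = - ksign F (mu i) (mu i) * tau F i := by
  rcases i with (i | i) | r <;> simp [tau, dual, mu, ksign]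

lemma ksign_zero_right (a : ZMod 2) : ksign F a 0 = 1 := by simp [ksign]

lemma ham_eq {p : ℕ} {t : Y0 m → ℕ} {a : O F m n} (ha : a ∈ truncPar F n p t 0) :
    ham F a = ∑ i, tau F i • vf F (dual i) (pd F i a) := by
  simp [ham, LinearMap.sum_apply, sgn_of_mem _ ha, ksign_zero_right]

lemma ham_apply {p : ℕ} {t : Y0 m → ℕ} {a : O F m n} (ha : a ∈ truncPar F n p t 0)
    (f : O F m n) : ham F a f = ∑ i, tau F i • mul F (pd F i a) (pd F (dual i) f) := by
  simp [ham_eq ha, LinearMap.sum_apply, vf_apply]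

lemma pd_mem_of_even {p : ℕ} {t : Y0 m → ℕ} (i : Y m n)
    {a : O F m n} (ha : a ∈ truncPar F n p t 0) : pd F i a ∈ truncPar F n p t (mu i) := by
  simpa using pd_mem_truncPar i ha

lemma ham_mem {p : ℕ} {t : Y0 m → ℕ} {a : O F m n}
    (ha : a ∈ truncPar F n p t 0) : ham F a ∈ evenWittSpan F n p t := by
  rw [ham_eq ha]
  refine sum_mem fun i _ => Submodule.smul_mem _ _ (vf_mem ?_)
  rw [mu_dual]
  exact pd_mem_of_even i ha

lemma ham_apply_mem {p : ℕ} [Fact p.Prime] [CharP F p] {t : Y0 m → ℕ} {a b : O F m n}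
    (ha : a ∈ truncPar F n p t 0) (hb : b ∈ truncPar F n p t 0) :
    ham F a b ∈ truncPar F n p t 0 := by
  rw [ham_apply ha]
  refine sum_mem fun i _ => Submodule.smul_mem _ _ ?_
  have := mul_mem_truncPar (pd_mem_of_even i ha) (pd_mem_of_even (dual i) hb)
  rwa [mu_dual, add_eq_zero_zmod2.2 rfl] at this

lemma ksign_identity (a b : ZMod 2) :
    ksign F (b + a) a * ksign F a b * ksign F a a = 1 := by
  have h : ∀ a : ZMod 2, a = 0 ∨ a = 1 := by decide
  have h2 : (1 + 1 : ZMod 2) = 0 := rfl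
  rcases h a with rfl | rfl <;> rcases h b with rfl | rfl <;> simp [ksign, h2]

lemma pd_ham_apply {p : ℕ} {t : Y0 m → ℕ} {a b : O F m n}
    (ha : a ∈ truncPar F n p t 0) (hb : b ∈ truncPar F n p t 0) (j : Y m n) :
    pd F j (ham F a b) = ham F a (pd F j b) - ham F b (pd F j a) := by
  rw [ham_apply ha, ham_apply ha, ham_apply hb]
  simp only [map_sum, map_smul, pd_mul, smul_add, Finset.sum_add_distrib]
  have h2 : ∑ i, tau F i • mul F (sgn F j (pd F i a)) (pd F j (pd F (dual i) b))
      = ∑ i, tau F i • mul F (pd F i a) (pd F (dual i) (pd F j b)) := by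
    refine Finset.sum_congr rfl fun i _ => ?_
    rw [sgn_of_mem j (pd_mem_of_even i ha), pd_comm j (dual i) b, mu_dual]
    simp only [map_smul, LinearMap.smul_apply, smul_smul]
    rw [ksign_mul_self, mul_one]
  have h1 : ∑ i, tau F i • mul F (pd F j (pd F i a)) (pd F (dual i) b)
      = - ∑ i, tau F i • mul F (pd F i b) (pd F (dual i) (pd F j a)) := by
    rw [← Finset.sum_neg_distrib]
    refine Fintype.sum_equiv (Function.Involutive.toPerm dual dual_involutive) _ _ fun i => ?_
    simp only [Function.Involutive.coe_toPerm, dual_dual]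
    have e1 := pd_mem_truncPar j (pd_mem_of_even i ha)
    have e2 := pd_mem_of_even (dual i) hb
    rw [mu_dual] at e2
    rw [add_comm] at e1
    rw [mul_comm' e1 e2, pd_comm j i a, tau_dual]
    simp only [map_smul, smul_smul, neg_mul, neg_smul, neg_neg]
    congr 1
    have k1 := ksign_identity (F := F) (mu i) (mu j)
    have k2 := ksign_mul_self (F := F) (mu i) (mu i)
    rw [ksign_comm (mu j) (mu i)]
    linear_combination (tau F i * ksign F (mu i) (mu i)) * k1
      - (tau F i * ksign F (mu j + mu i) (mu i) * ksign F (mu i) (mu j)) * k2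
  rw [h1, h2]
  abel

lemma ham_lie {p : ℕ} [Fact p.Prime] [CharP F p] {t : Y0 m → ℕ} {a b : O F m n}
    (ha : a ∈ truncPar F n p t 0) (hb : b ∈ truncPar F n p t 0) :
    ⁅ham F a, ham F b⁆ = ham F (ham F a b) := by
  rw [ham_eq (ham_apply_mem ha hb)]
  simp only [pd_ham_apply ha hb]
  simp only [map_sub, smul_sub, Finset.sum_sub_distrib]
  conv_lhs => rw [ham_eq ha, ham_eq hb]
  simp only [LieRing.of_associative_ring_bracket, Finset.sum_mul_sum]
  rw [Finset.sum_comm (f := fun i j => (tau F i • vf F (dual i) (pd F i b)) *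
    (tau F j • vf F (dual j) (pd F j a)))]
  rw [← Finset.sum_sub_distrib]
  simp only [← Finset.sum_sub_distrib]
  have key : ∀ i j : Y m n, (tau F i • vf F (dual i) (pd F i a)) *
      (tau F j • vf F (dual j) (pd F j b)) - (tau F j • vf F (dual j) (pd F j b)) *
      (tau F i • vf F (dual i) (pd F i a))
      = tau F j • vf F (dual j) (tau F i • mul F (pd F i a) (pd F (dual i) (pd F j b)))
        - tau F i • vf F (dual i) (tau F j • mul F (pd F j b) (pd F (dual j) (pd F i a))) := by
    intro i j
    have h := vf_lie (p := p) (t := t) (i := dual i) (j := dual j)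
      (by rw [mu_dual]; exact pd_mem_of_even i ha) (by rw [mu_dual]; exact pd_mem_of_even j hb)
    rw [LieRing.of_associative_ring_bracket] at h
    simp only [smul_mul_smul_comm, map_smul, smul_smul]
    rw [mul_comm (tau F j) (tau F i), ← smul_sub, h, smul_sub]
  simp only [key, Finset.sum_sub_distrib]
  congr 1
  · rw [Finset.sum_comm]
    refine Finset.sum_congr rfl fun j _ => ?_
    rw [ham_apply ha, map_sum, Finset.smul_sum]
  · refine Finset.sum_congr rfl fun j _ => ?_
    rw [ham_apply hb, map_sum, Finset.smul_sum]

variable (F n) in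
/-- The span of the `x^(α) x^u` with `α ≤ π`, `|u|` even and `(α, u) ≠ (π, ω), (π, ∅)`. -/
noncomputable def nPot (p : ℕ) (t : Y0 m → ℕ) : Submodule F (O F m n) :=
  Submodule.span F {f | ∃ (α : Y0 m → ℕ) (u : Finset (Fin n)), α ≤ piMax p t ∧ Even u.card ∧
    (α, u) ≠ (piMax p t, Finset.univ) ∧ (α, u) ≠ (piMax p t, ∅) ∧ f = mono F α u}

lemma nPot_le {p : ℕ} {t : Y0 m → ℕ} : nPot F n p t ≤ truncPar F n p t 0 := by
  refine Submodule.span_mono ?_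
  rintro f ⟨α, u, h1, h2, _, _, rfl⟩
  exact ⟨α, u, h1, ZMod.natCast_eq_zero_iff_even.2 h2, rfl⟩

variable (F) in
/-- The coefficient of `x^(α) x^u`. -/
noncomputable def coef (α : Y0 m → ℕ) (u : Finset (Fin n)) : O F m n →ₗ[F] F :=
  (monoBasis F m n).coord (α, u)

lemma coef_mono (α β : Y0 m → ℕ) (u v : Finset (Fin n)) :
    coef F α u (mono F β v) = if (β, v) = (α, u) then 1 else 0 := by
  simp [coef, mono, Finsupp.single_apply]

lemma mem_nPot {p : ℕ} {t : Y0 m → ℕ} {f : O F m n} (hf : f ∈ truncPar F n p t 0)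
    (h1 : coef F (piMax p t) Finset.univ f = 0) (h2 : coef F (piMax p t) ∅ f = 0) :
    f ∈ nPot F n p t := by
  have e1 : {f : O F m n | ∃ (α : Y0 m → ℕ) (u : Finset (Fin n)),
      α ≤ piMax p t ∧ (u.card : ZMod 2) = 0 ∧ f = mono F α u}
      = monoBasis F m n '' {a | a.1 ≤ piMax p t ∧ (a.2.card : ZMod 2) = 0} := by
    ext g
    constructor
    · rintro ⟨α, u, h, h', rfl⟩
      exact ⟨(α, u), ⟨h, h'⟩, rfl⟩
    · rintro ⟨⟨α, u⟩, ⟨h, h'⟩, rfl⟩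
      exact ⟨α, u, h, h', rfl⟩
  have e2 : {f : O F m n | ∃ (α : Y0 m → ℕ) (u : Finset (Fin n)), α ≤ piMax p t ∧ Even u.card ∧
      (α, u) ≠ (piMax p t, Finset.univ) ∧ (α, u) ≠ (piMax p t, ∅) ∧ f = mono F α u}
      = monoBasis F m n '' {a | a.1 ≤ piMax p t ∧ Even a.2.card ∧
        a ≠ (piMax p t, Finset.univ) ∧ a ≠ (piMax p t, ∅)} := by
    ext g
    constructor
    · rintro ⟨α, u, h, h', h'', h''', rfl⟩
      exact ⟨(α, u), ⟨h, h', h'', h'''⟩, rfl⟩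
    · rintro ⟨⟨α, u⟩, ⟨h, h', h'', h'''⟩, rfl⟩
      exact ⟨α, u, h, h', h'', h''', rfl⟩
  rw [truncPar, e1, Module.Basis.mem_span_image] at hf
  rw [nPot, e2, Module.Basis.mem_span_image]
  intro a ha
  obtain ⟨h3, h4⟩ := hf ha
  refine ⟨h3, ZMod.natCast_eq_zero_iff_even.1 h4, ?_, ?_⟩
  · rintro rfl
    exact (Finsupp.mem_support_iff.1 ha) h1
  · rintro rfl
    exact (Finsupp.mem_support_iff.1 ha) h2

lemma coef_pd_inl {p : ℕ} [Fact p.Prime] {t : Y0 m → ℕ} {ε : ZMod 2} (i : Y0 m)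
    (w : Finset (Fin n)) {g : O F m n} (hg : g ∈ truncPar F n p t ε) :
    coef F (piMax p t) w (pd F (Sum.inl i) g) = 0 := by
  refine truncPar_induction (q := fun g => coef F (piMax p t) w (pd F (Sum.inl i) g) = 0)
    ?_ ?_ ?_ ?_ hg
  · simp
  · intro x y hx hy
    simp [hx, hy]
  · intro c x hx
    simp [hx]
  intro α u hα _
  rw [pd_inl_mono]
  split_ifs with h
  · simp
  · rw [coef_mono, if_neg]
    intro he
    have h1 : α i - 1 = piMax p t i := by simpa using congrFun (congrArg Prod.fst he) i
    have h2 : α i ≤ piMax p t i := hα i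
    omega

lemma coef_univ_pd_inr (r : Fin n) (β : Y0 m → ℕ) (g : O F m n) :
    coef F β Finset.univ (pd F (Sum.inr r) g) = 0 := by
  have : (coef F β Finset.univ).comp (pd F (Sum.inr r)) = 0 := by
    refine mono_ext fun α u => ?_
    rw [LinearMap.comp_apply, pd_inr_mono]
    split_ifs with h
    · rw [map_smul, coef_mono, if_neg]
      · simp
      · intro he
        have := congrArg Prod.snd he
        simp only at this
        exact (Finset.notMem_erase r u) (this ▸ Finset.mem_univ r)
    · simp
  exact congrArg (fun f => f g) this

lemma coef_empty_mul {p : ℕ} {t : Y0 m → ℕ} (β : Y0 m → ℕ)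
    {a : O F m n} (ha : a ∈ truncPar F n p t 1) (b : O F m n) :
    coef F β ∅ (mul F a b) = 0 := by
  refine truncPar_induction (q := fun a => coef F β ∅ (mul F a b) = 0) ?_ ?_ ?_ ?_ ha
  · simp
  · intro x y hx hy
    simp [hx, hy]
  · intro c x hx
    simp [hx]
  intro α u _ hu
  have : (coef F β ∅).comp (mul F (mono F α u)) = 0 := by
    refine mono_ext fun γ v => ?_
    rw [LinearMap.comp_apply, mul_mono, map_smul, coef_mono, if_neg]
    · simp
    · intro he
      have h1 := congrArg Prod.snd he
      simp only [Finset.union_eq_empty] at h1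
      rw [h1.1] at hu
      simp at hu
  exact congrArg (fun f => f b) this

lemma ham_apply_mem_nPot {p : ℕ} [Fact p.Prime] [CharP F p] {t : Y0 m → ℕ} {a b : O F m n}
    (ha : a ∈ truncPar F n p t 0) (hb : b ∈ truncPar F n p t 0) :
    ham F a b ∈ nPot F n p t := by
  have hdiv : ∀ i : Y m n, mul F (pd F i a) (pd F (dual i) b)
      = pd F i (mul F a (pd F (dual i) b)) - mul F a (pd F i (pd F (dual i) b)) := by
    intro i
    rw [pd_mul, sgn_of_mem i ha, ksign_zero_right, one_smul]
    abel
  have hrr : ∀ r : Fin n, pd F (Sum.inr r) (pd F (dual (Sum.inr r)) b) = 0 := by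
    intro r
    have : (pd F (Sum.inr r : Y m n)).comp (pd F (Sum.inr r)) = 0 := by
      refine mono_ext fun α u => ?_
      rw [LinearMap.comp_apply, pd_inr_mono]
      split_ifs with h
      · simp [pd_inr_mono]
      · simp
    exact congrArg (fun f => f b) this
  have h0 : ∑ i : Y0 m, tau F (Sum.inl i : Y m n) •
      mul F a (pd F (Sum.inl i) (pd F (dual (Sum.inl i)) b)) = 0 := by
    rw [Fintype.sum_sum_type, ← Finset.sum_add_distrib]
    refine Finset.sum_eq_zero fun k _ => ?_
    simp only [tau, dual, Sum.swap_inl, Sum.swap_inr]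
    rw [pd_comm (Sum.inl (Sum.inr k)) (Sum.inl (Sum.inl k))]
    simp [mu, ksign]
  have hY0 : ∀ w : Finset (Fin n), coef F (piMax p t) w (∑ i : Y0 m, tau F (Sum.inl i : Y m n) •
      mul F (pd F (Sum.inl i) a) (pd F (dual (Sum.inl i)) b)) = 0 := by
    intro w
    simp only [hdiv, smul_sub, Finset.sum_sub_distrib]
    rw [h0, sub_zero, map_sum]
    refine Finset.sum_eq_zero fun i _ => ?_
    rw [map_smul, coef_pd_inl i w (mul_mem_truncPar ha (pd_mem_of_even _ hb)), smul_zero]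
  refine mem_nPot (ham_apply_mem ha hb) ?_ ?_
  · rw [ham_apply ha, Fintype.sum_sum_type, map_add, hY0, zero_add, map_sum]
    refine Finset.sum_eq_zero fun r _ => ?_
    rw [map_smul, hdiv, hrr, map_zero, sub_zero, coef_univ_pd_inr, smul_zero]
  · rw [ham_apply ha, Fintype.sum_sum_type, map_add, hY0, zero_add, map_sum]
    refine Finset.sum_eq_zero fun r _ => ?_
    rw [map_smul, coef_empty_mul _ (pd_mem_of_even (Sum.inr r) ha), smul_zero]

variable (F n) in
/-- The span of the `D_H(x^(α) x^u)` with `α ≤ π`, `|u|` even, `(α, u) ≠ (π, ω), (π, ∅)`: the image of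
`nPot` under `D_H`, closed under commutators. -/
noncomputable def nEnd (p : ℕ) [Fact p.Prime] [CharP F p] (t : Y0 m → ℕ) :
    LieSubalgebra F (Module.End F (O F m n)) :=
  { Submodule.map (ham F) (nPot F n p t) with
    lie_mem' := by
      rintro _ _ ⟨a, ha, rfl⟩ ⟨b, hb, rfl⟩
      exact ⟨ham F a b, ham_apply_mem_nPot (nPot_le ha) (nPot_le hb),
        (ham_lie (nPot_le ha) (nPot_le hb)).symm⟩ }

variable (F n) in
/-- The Lie algebra `𝔑`, as a subalgebra of `𝒲` (which contains all `D_H(f)`, `f ∈ nPot`). -/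
noncomputable def nAlg (p : ℕ) [Fact p.Prime] [CharP F p] (t : Y0 m → ℕ) :
    LieSubalgebra F (evenWitt F n p t) :=
  (nEnd F n p t).comap (evenWitt F n p t).incl

variable (F n) in
/-- The surjection `f ↦ D_H(f)` onto `𝔑`. -/
noncomputable def hamN (p : ℕ) [Fact p.Prime] [CharP F p] (t : Y0 m → ℕ) :
    nPot F n p t →ₗ[F] nAlg F n p t where
  toFun f := ⟨⟨ham F f.1, ham_mem (nPot_le f.2)⟩, ⟨f.1, f.2, rfl⟩⟩
  map_add' f g := by ext1; ext1; simp
  map_smul' c f := by ext1; ext1; simp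

lemma hamN_surjective (p : ℕ) [Fact p.Prime] [CharP F p] (t : Y0 m → ℕ) :
    Function.Surjective (hamN F n p t) := by
  rintro ⟨⟨x, hx⟩, ⟨f, hf, hfx⟩⟩
  refine ⟨⟨f, hf⟩, ?_⟩
  ext1
  ext1
  exact hfx

variable (F m n) in
/-- The top monomial `x^ω` of the exterior algebra. -/
noncomputable def xOmega : O F m n := mono F 0 Finset.univ

lemma mul_mul_mem {p : ℕ} [Fact p.Prime] [CharP F p] {t : Y0 m → ℕ} {g : O F m n}
    (hg : g ∈ truncPar F n p t 0) {D : Module.End F (O F m n)} (hD : D ∈ evenWittSpan F n p t) :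
    mul F g ∘ₗ D ∈ evenWittSpan F n p t := by
  induction hD using Submodule.span_induction with
  | mem x hx =>
    obtain ⟨α, u, i, hα, hu, rfl⟩ := hx
    have : mul F g ∘ₗ vf F i (mono F α u) = vf F i (mul F g (mono F α u)) := by
      refine LinearMap.ext fun f => ?_
      simp [vf_apply, mul_assoc']
    rw [this]
    have h := mul_mem_truncPar hg (mono_mem_truncPar (F := F) (u := u) hα)
    rw [zero_add, add_eq_zero_zmod2.1 hu] at h
    exact vf_mem h
  | zero => simp
  | add x y _ _ hx hy =>
    rw [LinearMap.comp_add]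
    exact add_mem hx hy
  | smul c x _ hx =>
    rw [LinearMap.comp_smul]
    exact Submodule.smul_mem _ c hx

lemma xOmega_mem {p : ℕ} (t : Y0 m → ℕ) (hn : Even n) : xOmega F m n ∈ truncPar F n p t 0 := by
  have h := mono_mem_truncPar (F := F) (p := p) (t := t) (α := 0) (u := (Finset.univ : Finset (Fin n)))
    (fun i => Nat.zero_le _)
  rwa [Finset.card_fin, ZMod.natCast_eq_zero_iff_even.2 hn] at h

lemma pd_pow_mem {p : ℕ} {t : Y0 m → ℕ} (i : Y0 m) (k : ℕ) {f : O F m n}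
    (hf : f ∈ truncPar F n p t 0) : (pd F (Sum.inl i) ^ k) f ∈ truncPar F n p t 0 := by
  induction k with
  | zero => simpa using hf
  | succ k ih =>
    rw [pow_succ', Module.End.mul_apply]
    have h := pd_mem_of_even (p := p) (t := t) (Sum.inl i : Y m n) ih
    simpa only [mu] using h

lemma pd_eq_zero_of_ham_eq_zero {p : ℕ} {t : Y0 m → ℕ} {f : O F m n}
    (hf : f ∈ truncPar F n p t 0) (h : ham F f = 0) (i : Y0 m) : pd F (Sum.inl i) f = 0 := by
  have h1 := congrArg (fun D => D (mono F (Pi.single i.swap 1) ∅)) h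
  simp only [ham_apply hf, LinearMap.zero_apply] at h1
  have one : ∀ a : O F m n, mul F a (mono F 0 ∅) = a := by
    intro a
    have : (mul F).flip (mono F 0 ∅) = (LinearMap.id : O F m n →ₗ[F] O F m n) := by
      refine mono_ext fun α u => ?_
      simp [mul_mono, dpCoeff, wedgeCoeff, inversions]
    exact congrArg (fun f => f a) this
  rw [Finset.sum_eq_single (Sum.inl i)] at h1
  · simp only [dual, pd_inl_mono] at h1
    simp only [Pi.single_eq_same, one_ne_zero, if_false, tsub_self, one] at h1
    have ht : tau F (Sum.inl i : Y m n) ≠ 0 := by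
      rcases i with i | i <;> simp [tau]
    exact (smul_eq_zero.1 h1).resolve_left ht
  · rintro (j | r) _ hj
    · have : j.swap ≠ i.swap := by
        intro h'
        exact hj (congrArg Sum.inl (Sum.swap_leftInverse.injective h'))
      simp [dual, pd_inl_mono, this]
    · simp [dual, pd_inr_mono]
  · simp

variable (F) in
/-- The map `f ↦ ∂_i^(p^q)(f) D_H(x^ω)`, for even `n`. -/
noncomputable def phiPot (p : ℕ) [Fact p.Prime] [CharP F p] (t : Y0 m → ℕ) (hn : Even n)
    (i : Y0 m) (q : ℕ) : nPot F n p t →ₗ[F] evenWitt F n p t where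
  toFun f := ⟨mul F ((pd F (Sum.inl i) ^ (p ^ q)) f.1) ∘ₗ ham F (xOmega F m n),
    mul_mul_mem (pd_pow_mem i _ (nPot_le f.2)) (ham_mem (xOmega_mem t hn))⟩
  map_add' f g := by ext1; simp [LinearMap.add_comp]
  map_smul' c f := by ext1; simp [LinearMap.smul_comp]

lemma ker_hamN_le (p : ℕ) [Fact p.Prime] [CharP F p] (t : Y0 m → ℕ) (hn : Even n)
    (i : Y0 m) (q : ℕ) :
    LinearMap.ker (hamN F n p t) ≤ LinearMap.ker (phiPot F p t hn i q) := by
  rintro ⟨f, hf⟩ h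
  have h0 : hamN F n p t ⟨f, hf⟩ = 0 := LinearMap.mem_ker.1 h
  have h1 : ham F f = 0 := congrArg (fun x : nAlg F n p t => x.1.1) h0
  have h2 := pd_eq_zero_of_ham_eq_zero (nPot_le hf) h1 i
  have hp : p ^ q ≠ 0 := pow_ne_zero _ (Fact.out : p.Prime).ne_zero
  obtain ⟨k, hk⟩ := Nat.exists_eq_succ_of_ne_zero hp
  rw [LinearMap.mem_ker]
  ext1
  simp [phiPot, hk, pow_succ, h2]

variable (F) in
/-- The map `Φ_i^(q) : D_H(f) ↦ ∂_i^(p^q)(f) D_H(x^ω)` on `𝔑`, for even `n`. It is well defined because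
the kernel of `D_H` is annihilated by `∂_i`. -/
noncomputable def Phi (p : ℕ) [Fact p.Prime] [CharP F p] (t : Y0 m → ℕ) (hn : Even n)
    (i : Y0 m) (q : ℕ) : nAlg F n p t →ₗ[F] evenWitt F n p t :=
  (LinearMap.ker (hamN F n p t)).liftQ (phiPot F p t hn i q) (ker_hamN_le p t hn i q) ∘ₗ
    ((hamN F n p t).quotKerEquivOfSurjective (hamN_surjective p t)).symm.toLinearMap

lemma Phi_hamN (p : ℕ) [Fact p.Prime] [CharP F p] (t : Y0 m → ℕ) (hn : Even n)
    (i : Y0 m) (q : ℕ) (f : nPot F n p t) :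
    (Phi F p t hn i q (hamN F n p t f) : Module.End F (O F m n))
      = mul F ((pd F (Sum.inl i) ^ (p ^ q)) f.1) ∘ₗ ham F (xOmega F m n) := by
  simp [Phi, phiPot]

lemma one_mul' (a : O F m n) : mul F (mono F 0 ∅) a = a := by
  have : mul F (mono F 0 ∅) = (LinearMap.id : O F m n →ₗ[F] O F m n) := by
    refine mono_ext fun α u => ?_
    simp [mul_mono, dpCoeff, wedgeCoeff, inversions]
  exact congrArg (fun f => f a) this

variable (F n) in
/-- The element `∂_i` of `𝒲`, for `i ∈ Y₀`. -/
noncomputable def dW (p : ℕ) [Fact p.Prime] [CharP F p] (t : Y0 m → ℕ) (i : Y0 m) :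
    evenWitt F n p t :=
  ⟨pd F (Sum.inl i), by
    have h : vf F (Sum.inl i) (mono F 0 ∅) ∈ evenWittSpan F n p t := vf_mem (by
      simpa [mu] using mono_mem_truncPar (F := F) (p := p) (t := t) (α := 0)
        (u := (∅ : Finset (Fin n))) (fun i => Nat.zero_le _))
    have e : vf F (Sum.inl i) (mono F 0 ∅) = pd F (Sum.inl i : Y m n) :=
      LinearMap.ext fun f => one_mul' _
    exact e ▸ h⟩

variable (F n) in
/-- The element `Γ' = ∑_{r ∈ Y₁} x_r ∂_r` of `𝒲`. -/
noncomputable def gammaPrime (p : ℕ) [Fact p.Prime] [CharP F p] (t : Y0 m → ℕ) :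
    evenWitt F n p t :=
  ⟨∑ r : Fin n, vf F (Sum.inr r) (mono F 0 {r}), sum_mem fun r _ => vf_mem (by
    simpa [mu] using mono_mem_truncPar (F := F) (p := p) (t := t) (α := 0)
      (u := ({r} : Finset (Fin n))) (fun i => Nat.zero_le _))⟩

variable (F) in
/-- The map `D ↦ x^ω D` on `𝒲`, for even `n`. -/
noncomputable def omegaMul (p : ℕ) [Fact p.Prime] [CharP F p] (t : Y0 m → ℕ) (hn : Even n) :
    Module.End F (evenWitt F n p t) where
  toFun D := ⟨mul F (xOmega F m n) ∘ₗ D.1, mul_mul_mem (xOmega_mem t hn) D.2⟩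
  map_add' f g := by ext1; simp [LinearMap.comp_add]
  map_smul' c f := by ext1; simp [LinearMap.comp_smul]

/-- The map `(ad D)^k`, `(ad D)(x) = [D, x]`, restricted to `𝔑`. -/
noncomputable def adPowN {p : ℕ} [Fact p.Prime] [CharP F p] {t : Y0 m → ℕ}
    (D : evenWitt F n p t) (k : ℕ) : nAlg F n p t →ₗ[F] evenWitt F n p t :=
  (LieAlgebra.ad F (evenWitt F n p t) D ^ k) ∘ₗ (nAlg F n p t).toSubmodule.subtype

/-- The inner derivation `ad D` from `𝔑` into `𝒲`. -/
noncomputable def adN {p : ℕ} [Fact p.Prime] [CharP F p] {t : Y0 m → ℕ}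
    (D : evenWitt F n p t) : nAlg F n p t →ₗ[F] evenWitt F n p t :=
  adPowN D 1

variable (F) in
/-- The map `Θ_i^(q) : D_H(f) ↦ x^ω (ad ∂_i)^(p^q)(D_H(f))` on `𝔑`, for even `n`. -/
noncomputable def Theta (p : ℕ) [Fact p.Prime] [CharP F p] (t : Y0 m → ℕ) (hn : Even n)
    (i : Y0 m) (q : ℕ) : nAlg F n p t →ₗ[F] evenWitt F n p t :=
  omegaMul F p t hn ∘ₗ adPowN (dW F n p t i) (p ^ q)

variable (F n) in
/-- The component `W(2m, n; t)_[k]` of the `ℤ`-gradation. -/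
noncomputable def wittGrade (p : ℕ) (t : Y0 m → ℕ) (k : ℤ) :
    Submodule F (Module.End F (O F m n)) :=
  Submodule.span F {D | ∃ (α : Y0 m → ℕ) (u : Finset (Fin n)) (i : Y m n),
    α ≤ piMax p t ∧ ((∑ j, α j + u.card : ℕ) : ℤ) = k + 1 ∧ D = vf F i (mono F α u)}

variable (F n) in
/-- The component `𝒲_[k]`. -/
noncomputable def evenWittGrade (p : ℕ) [Fact p.Prime] [CharP F p] (t : Y0 m → ℕ) (k : ℤ) :
    Submodule F (evenWitt F n p t) :=
  (wittGrade F n p t k).comap (evenWitt F n p t).toSubmodule.subtype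

variable (F n) in
/-- The component `𝔑_[k]`. -/
noncomputable def nGrade (p : ℕ) [Fact p.Prime] [CharP F p] (t : Y0 m → ℕ) (k : ℤ) :
    Submodule F (nAlg F n p t) :=
  (evenWittGrade F n p t k).comap (nAlg F n p t).toSubmodule.subtype

/-- A derivation from `𝔑` into `𝒲` is `ℤ`-homogeneous if it shifts all degrees by some `d`. -/
def IsZHomogeneous {p : ℕ} [Fact p.Prime] [CharP F p] {t : Y0 m → ℕ}
    (φ : LieDerivation F (nAlg F n p t) (evenWitt F n p t)) : Prop :=
  ∃ d : ℤ, ∀ k : ℤ, ∀ x ∈ nGrade F n p t k, φ x ∈ evenWittGrade F n p t (k + d)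

end

end HamSuper

namespace HamSuper

attribute [local instance] LieRing.ofAssociativeRing

/-! ### Poisson brackets with monomials of low degree. -/

section
variable {F : Type*} [Field F] {m n : ℕ}

/-! For even f, `ham F f g` is the Poisson bracket {f, g}, and [D_H(f), D_H(g)] = D_H({f, g}). If δ
is a derivation from 𝔑 into 𝒲, the potentials f with δ(D_H(f)) = 0 form a subspace `killed δ` that
is closed under {·,·} (`killed_bracket`). It therefore suffices to subtract known derivations from φ
until this subspace contains elements that generate all admissible monomials. Two kinds of work
remain: computing a few values of δ, and showing that certain monomials generate.

Values. Let w = δ(D_H(f)), where all ∂_l f with l even are already killed. Commuting with ∂_l shows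
that the components w(x_j) contain odd variables only (`Val.pd_apply_gen`). The torus elements
D_H(x_i x_{i'}) compare weights and annihilate most components (`Val.weight_inl`, `Val.weight_inr`).
The rotations D_H(x_k x_l) of the odd variables determine the remaining ones up to scalars
(`exists_coeff_of_rotation`, `exists_coeff_of_rotation_even`). This gives 0 at x_i^(3), because p >
3, and c x_a x_b ∂_{i'} at x_i x_a x_b (`val_single_pairMono`); a multiple of ad Γ' accounts for the
latter.

Generation. The monomials of degree at most 2 with the cubes x_i^(3) and the x_i x_a x_b generate
everything of height one, that is, with even exponents below p (`mono_mem_of_low_degree`). To pass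
from heights t' to t' + e_r one only has to add the elements x_r^(q) x_j, q = p^(t'_r), with j
outside the pair {r, r'} (`mono_mem_add_single`).

Induction on heights. If δ vanishes on heights t', its value at x_r^(q) is B D_H(x^ω), which is
removed by Φ_r. After that the value at x_r^(q) x_j is A ∂_{j'} + B x^ω ∂_{j'} with new scalars,
which is removed by (ad ∂_r)^q and Θ_r (`exists_sub_add_single`). For odd n both scalars B vanish by
parity. Once t' = t nothing is left of δ (`exists_eq_sum_of_killed`).

Homogeneity gives μη = 0: at x_r^(p^s) x_j the maps Θ and (ad ∂_r)^(p^s) contribute terms whose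
degrees differ by n. -/

lemma swap_ne (i : Y0 m) : i.swap ≠ i := by
  rcases i with i | i <;> simp

lemma ne_swap (i : Y0 m) : i ≠ i.swap := (swap_ne i).symm

lemma swap_eq_iff {i j : Y0 m} : i.swap = j ↔ i = j.swap := by
  constructor
  · rintro rfl
    simp
  · rintro rfl
    simp

lemma tau_ne_zero (i : Y0 m) : tau F (Sum.inl i : Y m n) ≠ 0 := by
  rcases i with i | i <;> simp [tau]

lemma tau_swap (i : Y0 m) : tau F (Sum.inl i.swap : Y m n) = - tau F (Sum.inl i : Y m n) := by
  rcases i with i | i <;> simp [tau]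

lemma dpCoeff_single (i : Y0 m) (k : ℕ) (β : Y0 m → ℕ) :
    dpCoeff (Pi.single i k) β = (β i + k).choose k := by
  unfold dpCoeff
  rw [Finset.prod_eq_single i]
  · simp [add_comm]
  · intro j _ hj
    simp [hj]
  · simp

lemma wedgeCoeff_empty_left (u : Finset (Fin n)) : wedgeCoeff ∅ u = 1 := by
  simp [wedgeCoeff, inversions]

lemma mul_single_mono (i : Y0 m) (k : ℕ) (β : Y0 m → ℕ) (u : Finset (Fin n)) :
    mul F (mono F (Pi.single i k) ∅) (mono F β u)
      = ((β i + k).choose k : F) • mono F (β + Pi.single i k) u := by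
  rw [mul_mono, dpCoeff_single, wedgeCoeff_empty_left, add_comm β]
  simp

lemma single_add_single_mono {i j : Y0 m} (hij : i ≠ j) (k l : ℕ) :
    mono F (Pi.single i k + Pi.single j l) (∅ : Finset (Fin n))
      = mul F (mono F (Pi.single i k) ∅) (mono F (Pi.single j l) ∅) := by
  rw [mul_single_mono, Pi.single_eq_of_ne hij, add_comm (Pi.single j l : Y0 m → ℕ)]
  simp

lemma dpCoeff_zero (β : Y0 m → ℕ) : dpCoeff 0 β = 1 := by simp [dpCoeff]

lemma mul_odd_mono (a : Fin n) (β : Y0 m → ℕ) (u : Finset (Fin n)) :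
    mul F (mono F 0 {a}) (mono F β u)
      = if a ∈ u then 0 else (-1 : F) ^ below u a • mono F β (insert a u) := by
  rw [mul_mono, dpCoeff_zero, zero_add, wedgeCoeff, inv_singleton_left, ← Finset.insert_eq]
  by_cases h : a ∈ u <;> simp [h]

lemma pd_inl_add_single (i : Y0 m) (β : Y0 m → ℕ) (u : Finset (Fin n)) :
    pd F (Sum.inl i) (mono F (β + Pi.single i 1) u) = mono F β u := by
  rw [pd_inl_mono]
  simp

lemma pd_inl_of_zero {i : Y0 m} {β : Y0 m → ℕ} (h : β i = 0) (u : Finset (Fin n)) :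
    pd F (Sum.inl i) (mono F β u) = 0 := by
  rw [pd_inl_mono, if_pos h]

lemma pd_inr_of_notMem {r : Fin n} {u : Finset (Fin n)} (h : r ∉ u) (β : Y0 m → ℕ) :
    pd F (Sum.inr r) (mono F β u) = 0 := by
  rw [pd_inr_mono, if_neg h]

lemma ham_mono_apply (α : Y0 m → ℕ) {u : Finset (Fin n)} (hu : Even u.card) (g : O F m n) :
    ham F (mono F α u) g
      = ∑ i : Y0 m, tau F (Sum.inl i : Y m n) •
          mul F (pd F (Sum.inl i) (mono F α u)) (pd F (Sum.inl i.swap) g)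
        + ∑ r : Fin n, mul F (pd F (Sum.inr r) (mono F α u)) (pd F (Sum.inr r) g) := by
  have h : ∀ i : Y m n, sgn F i (mono F α u) = mono F α u := by
    rintro (i | r)
    · rfl
    · rw [sgn_inr_mono, hu.neg_one_pow, one_smul]
  simp only [ham, LinearMap.sum_apply, LinearMap.smul_apply, LinearMap.comp_apply, h, vf_apply]
  rw [Fintype.sum_sum_type]
  simp [tau, dual]

lemma ham_mono_empty (α : Y0 m → ℕ) (g : O F m n) :
    ham F (mono F α ∅) g
      = ∑ i : Y0 m, tau F (Sum.inl i : Y m n) •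
          mul F (pd F (Sum.inl i) (mono F α ∅)) (pd F (Sum.inl i.swap) g) := by
  rw [ham_mono_apply α (by simp)]
  simp [pd_inr_of_notMem]

lemma ham_single (i : Y0 m) (k : ℕ) (g : O F m n) :
    ham F (mono F (Pi.single i (k + 1)) ∅) g
      = tau F (Sum.inl i : Y m n) • mul F (mono F (Pi.single i k) ∅) (pd F (Sum.inl i.swap) g) := by
  rw [ham_mono_empty, Finset.sum_eq_single i]
  · rw [Pi.single_add, pd_inl_add_single]
  · intro j _ hj
    rw [pd_inl_of_zero (by simp [hj])]
    simp
  · simp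

lemma ham_single_one (i : Y0 m) (g : O F m n) :
    ham F (mono F (Pi.single i 1) ∅) g = tau F (Sum.inl i : Y m n) • pd F (Sum.inl i.swap) g := by
  have := ham_single i 0 g
  simpa [one_mul'] using this

lemma ham_single_add_single {i j : Y0 m} (hij : i ≠ j) (k : ℕ) (g : O F m n) :
    ham F (mono F (Pi.single i (k + 1) + Pi.single j 1) ∅) g
      = tau F (Sum.inl j : Y m n) •
          mul F (mono F (Pi.single i (k + 1)) ∅) (pd F (Sum.inl j.swap) g)
        + tau F (Sum.inl i : Y m n) • mul F (mono F (Pi.single i k) ∅)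
            (mul F (mono F (Pi.single j 1) ∅) (pd F (Sum.inl i.swap) g)) := by
  rw [ham_mono_empty, Fintype.sum_eq_add i j hij]
  · rw [pd_inl_add_single]
    have : (Pi.single i (k + 1) + Pi.single j 1 : Y0 m → ℕ)
        = (Pi.single i k + Pi.single j 1) + Pi.single i 1 := by
      rw [Pi.single_add]
      abel
    rw [this, pd_inl_add_single, single_add_single_mono hij, mul_assoc', add_comm]
  · rintro l ⟨h1, h2⟩
    rw [pd_inl_of_zero (by simp [h1, h2])]
    simp

/-- The element `x^(α) x_a x_b`. -/
noncomputable def pairMono (F : Type*) [Field F] {m n : ℕ} (α : Y0 m → ℕ) (a b : Fin n) :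
    O F m n := mul F (mono F α {a}) (mono F 0 {b})

lemma pairMono_eq {a b : Fin n} (hab : a ≠ b) (α : Y0 m → ℕ) :
    pairMono F α a b = (if a < b then (1 : F) else -1) • mono F α {a, b} := by
  rw [pairMono, mul_mono, dpCoeff_comm, dpCoeff_zero, wedgeCoeff, if_pos (by simpa using hab),
    inv_singleton_left, add_zero, ← Finset.insert_eq]
  simp only [below, Finset.filter_singleton]
  rcases lt_or_gt_of_ne hab with h | h
  · simp [h, not_lt.2 h.le]
  · simp [h, not_lt.2 h.le]

lemma pairMono_mem {S : Submodule F (O F m n)} {a b : Fin n} (hab : a ≠ b) {α : Y0 m → ℕ} :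
    pairMono F α a b ∈ S ↔ mono F α {a, b} ∈ S := by
  rw [pairMono_eq hab]
  apply Submodule.smul_mem_iff
  split_ifs <;> simp

lemma below_pair {a b : Fin n} (hab : a ≠ b) :
    below {a, b} a = (if a < b then 0 else 1) ∧ below {a, b} b = (if a < b then 1 else 0) := by
  have e : ({a, b} : Finset (Fin n)) = {a} ∪ {b} := rfl
  have hd : Disjoint ({a} : Finset (Fin n)) {b} := by simpa using hab
  rw [e, below_union hd, below_union hd]
  simp only [below, Finset.filter_singleton, lt_irrefl, if_false, Finset.card_empty, zero_add,
    add_zero]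
  rcases lt_or_gt_of_ne hab with h | h
  · simp [h, not_lt.2 h.le]
  · simp [h, not_lt.2 h.le]

lemma pd_inr_pairMono_left {a b : Fin n} (hab : a ≠ b) (α : Y0 m → ℕ) :
    pd F (Sum.inr a) (pairMono F α a b) = mono F α {b} := by
  rw [pairMono_eq hab, map_smul, pd_inr_mono, if_pos (Finset.mem_insert_self a {b})]
  have : ({a, b} : Finset (Fin n)).erase a = {b} := by
    ext x
    by_cases h : x = a
    · simp [h, hab]
    · simp [h]
  rw [this, (below_pair hab).1]
  split_ifs <;> simp

lemma pd_inr_pairMono_right {a b : Fin n} (hab : a ≠ b) (α : Y0 m → ℕ) :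
    pd F (Sum.inr b) (pairMono F α a b) = - mono F α {a} := by
  rw [pairMono_eq hab, map_smul, pd_inr_mono,
    if_pos (Finset.mem_insert_of_mem (Finset.mem_singleton_self b))]
  have : ({a, b} : Finset (Fin n)).erase b = {a} := by
    ext x
    by_cases h : x = b
    · simp [h, hab.symm]
    · simp [h]
  rw [this, (below_pair hab).2]
  split_ifs <;> simp

lemma pd_inr_pairMono_of_ne {a b c : Fin n} (hab : a ≠ b) (ha : c ≠ a) (hb : c ≠ b)
    (α : Y0 m → ℕ) : pd F (Sum.inr c) (pairMono F α a b) = 0 := by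
  rw [pairMono_eq hab, map_smul, pd_inr_of_notMem (by simp [ha, hb]), smul_zero]

lemma ham_pairMono {a b : Fin n} (hab : a ≠ b) (α : Y0 m → ℕ) (g : O F m n) :
    ham F (pairMono F α a b) g
      = ∑ i : Y0 m, tau F (Sum.inl i : Y m n) •
          mul F (pd F (Sum.inl i) (pairMono F α a b)) (pd F (Sum.inl i.swap) g)
        + (mul F (mono F α {b}) (pd F (Sum.inr a) g)
          - mul F (mono F α {a}) (pd F (Sum.inr b) g)) := by
  have key : ham F (pairMono F α a b) g = ∑ i : Y0 m, tau F (Sum.inl i : Y m n) •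
          mul F (pd F (Sum.inl i) (pairMono F α a b)) (pd F (Sum.inl i.swap) g)
        + ∑ r : Fin n, mul F (pd F (Sum.inr r) (pairMono F α a b)) (pd F (Sum.inr r) g) := by
    rw [pairMono_eq hab]
    simp only [map_smul, LinearMap.smul_apply]
    rw [ham_mono_apply α (u := {a, b}) (by rw [Finset.card_pair hab]; exact even_two) g, smul_add,
      Finset.smul_sum, Finset.smul_sum]
    congr 1
    exact Finset.sum_congr rfl fun i _ => smul_comm _ _ _
  rw [key, Fintype.sum_eq_add a b hab]
  · rw [pd_inr_pairMono_left hab, pd_inr_pairMono_right hab]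
    simp [sub_eq_add_neg]
  · rintro l ⟨h1, h2⟩
    rw [pd_inr_pairMono_of_ne hab h1 h2]
    simp

lemma pd_inl_pairMono_of_zero {a b : Fin n} (hab : a ≠ b) {i : Y0 m} {α : Y0 m → ℕ}
    (h : α i = 0) : pd F (Sum.inl i) (pairMono F α a b) = 0 := by
  rw [pairMono_eq hab, map_smul, pd_inl_of_zero h, smul_zero]

lemma pd_inl_pairMono_add {a b : Fin n} (hab : a ≠ b) (i : Y0 m) (α : Y0 m → ℕ) :
    pd F (Sum.inl i) (pairMono F (α + Pi.single i 1) a b) = pairMono F α a b := by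
  rw [pairMono_eq hab, map_smul, pd_inl_add_single, ← pairMono_eq hab]

lemma mono_eq_mul (α : Y0 m → ℕ) (u : Finset (Fin n)) :
    mono F α u = mul F (mono F α ∅) (mono F 0 u) := by
  rw [mul_mono, dpCoeff_comm, dpCoeff_zero, wedgeCoeff_empty_left]
  simp

lemma pairMono_eq_mul (α : Y0 m → ℕ) (a b : Fin n) :
    pairMono F α a b = mul F (mono F α ∅) (pairMono F 0 a b) := by
  rw [pairMono, mono_eq_mul, mul_assoc']
  rfl

lemma ham_pairMono_zero {a b : Fin n} (hab : a ≠ b) (g : O F m n) :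
    ham F (pairMono F 0 a b) g
      = mul F (mono F 0 {b}) (pd F (Sum.inr a) g) - mul F (mono F 0 {a}) (pd F (Sum.inr b) g) := by
  rw [ham_pairMono hab, Finset.sum_eq_zero, zero_add]
  intro i _
  rw [pd_inl_pairMono_of_zero hab (by simp)]
  simp

lemma ham_single_pairMono {a b : Fin n} (hab : a ≠ b) (i : Y0 m) (k : ℕ) (g : O F m n) :
    ham F (pairMono F (Pi.single i (k + 1)) a b) g
      = tau F (Sum.inl i : Y m n) • mul F (mono F (Pi.single i k) ∅)
          (mul F (pairMono F 0 a b) (pd F (Sum.inl i.swap) g))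
        + mul F (mono F (Pi.single i (k + 1)) ∅) (ham F (pairMono F 0 a b) g) := by
  rw [ham_pairMono hab, ham_pairMono_zero hab, Finset.sum_eq_single i]
  · rw [mono_eq_mul _ {a}, mono_eq_mul _ {b}, Pi.single_add, pd_inl_pairMono_add hab,
      pairMono_eq_mul, mul_assoc', map_sub, mul_assoc', mul_assoc']
  · intro j _ hj
    rw [pd_inl_pairMono_of_zero hab (by simp [hj])]
    simp
  · simp

end

/-! ### Obtaining monomials by bracketing inside a bracket-closed subspace. -/

section
variable {F : Type*} [Field F] {m n : ℕ}

lemma sub_single_add {β : Y0 m → ℕ} {i : Y0 m} {k : ℕ} (h : k ≤ β i) :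
    β - Pi.single i k + Pi.single i k = β := by
  refine tsub_add_cancel_of_le fun l => ?_
  by_cases hl : l = i
  · subst hl
    simpa using h
  · simp [hl]

lemma sum_add_single (β : Y0 m → ℕ) (i : Y0 m) (k : ℕ) :
    ∑ l, (β + Pi.single i k : Y0 m → ℕ) l = ∑ l, β l + k := by
  simp [Finset.sum_add_distrib]

lemma sum_sub_single {β : Y0 m → ℕ} {i : Y0 m} {k : ℕ} (h : k ≤ β i) :
    ∑ l, (β - Pi.single i k : Y0 m → ℕ) l + k = ∑ l, β l := by
  rw [← sum_add_single, sub_single_add h]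

lemma cast_ne_zero_of_lt {p : ℕ} [CharP F p] {a : ℕ} (h0 : a ≠ 0) (h : a < p) : (a : F) ≠ 0 := by
  rw [Ne, CharP.cast_eq_zero_iff F p]
  exact fun h' => absurd (Nat.le_of_dvd (Nat.pos_of_ne_zero h0) h') (not_le.2 h)

lemma cast_choose_ne_zero {p : ℕ} [Fact p.Prime] [CharP F p] {a k : ℕ} (hk : k ≤ a) (h : a < p) :
    (a.choose k : F) ≠ 0 := by
  rw [Ne, CharP.cast_eq_zero_iff F p]
  intro h'
  have h1 : p ∣ a.factorial := by
    rw [← Nat.choose_mul_factorial_mul_factorial hk, mul_assoc]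
    exact h'.mul_right _
  exact absurd (((Fact.out : p.Prime).dvd_factorial).1 h1) (not_le.2 h)

variable {S : Submodule F (O F m n)}

/-- Bracketing with `x_i^(k+1)`. -/
lemma mem_of_ham_single (hS : ∀ f ∈ S, ∀ g ∈ S, ham F f g ∈ S) {i : Y0 m} {k : ℕ}
    {β : Y0 m → ℕ} {u : Finset (Fin n)} (hk : k ≤ β i)
    (h1 : mono F (Pi.single i (k + 1)) ∅ ∈ S)
    (h2 : mono F (β - Pi.single i k + Pi.single i.swap 1) u ∈ S)
    (hc : ((β i).choose k : F) ≠ 0) : mono F β u ∈ S := by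
  have h := hS _ h1 _ h2
  rw [ham_single, pd_inl_add_single, mul_single_mono, sub_single_add hk, Pi.sub_apply,
    Pi.single_eq_same, Nat.sub_add_cancel hk, smul_smul,
    Submodule.smul_mem_iff _ (mul_ne_zero (tau_ne_zero i) hc)] at h
  exact h

/-- Bracketing with `x_i^(k+1) x_j`. -/
lemma mem_of_ham_single_add_single (hS : ∀ f ∈ S, ∀ g ∈ S, ham F f g ∈ S) {i j : Y0 m}
    (hij : i ≠ j) (hij' : j ≠ i.swap) {k : ℕ} {β : Y0 m → ℕ} {u : Finset (Fin n)}
    (hk : k + 1 ≤ β i) (h1 : mono F (Pi.single i (k + 1) + Pi.single j 1) ∅ ∈ S)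
    (h2 : mono F (β - Pi.single i (k + 1) + Pi.single j.swap 1) u ∈ S)
    (hc : ((β i).choose (k + 1) : F) ≠ 0)
    (h3 : β i.swap ≠ 0 → ((β i - 1).choose k : F) ≠ 0 → ((β j + 1 : ℕ) : F) ≠ 0 →
      mono F (β - Pi.single i 1 - Pi.single i.swap 1 + Pi.single j 1 + Pi.single j.swap 1) u ∈ S) :
    mono F β u ∈ S := by
  have hii := swap_ne i
  have hjj := swap_ne j
  have e1 : j.swap ≠ i := fun h => hij' (swap_eq_iff.1 h)
  have e2 : i.swap ≠ j.swap := fun h => hij (Sum.swap_leftInverse.injective h)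
  have h := hS _ h1 _ h2
  rw [ham_single_add_single hij, pd_inl_add_single, mul_single_mono, sub_single_add hk,
    Pi.sub_apply, Pi.single_eq_same, Nat.sub_add_cancel hk] at h
  -- The second term of the bracket is C(β_i - 1, k)(β_j + 1) times the monomial in `h3`, or zero if
  -- x_{i'} does not occur; `h3` is needed only when all of these factors survive in F.
  have hsnd : mul F (mono F (Pi.single i k) ∅) (mul F (mono F (Pi.single j 1) ∅)
      (pd F (Sum.inl i.swap)
        (mono F (β - Pi.single i (k + 1) + Pi.single j.swap 1) u))) ∈ S := by
    have hv : (β - Pi.single i (k + 1) + Pi.single j.swap 1 : Y0 m → ℕ) i.swap = β i.swap := by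
      simp [hii, e2]
    rw [pd_inl_mono, hv]
    by_cases hz : β i.swap = 0
    · simp [hz]
    rw [if_neg hz, mul_single_mono, map_smul, mul_single_mono, smul_smul]
    have hv2 : (β - Pi.single i (k + 1) + Pi.single j.swap 1 - Pi.single i.swap 1 : Y0 m → ℕ) j
        = β j := by
      simp [hij.symm, hjj.symm, hij']
    have hv3 : (β - Pi.single i (k + 1) + Pi.single j.swap 1 - Pi.single i.swap 1
        + Pi.single j 1 : Y0 m → ℕ) i + k = β i - 1 := by
      simp [hij, e1.symm, hii.symm]
      omega
    have hv4 : (β - Pi.single i (k + 1) + Pi.single j.swap 1 - Pi.single i.swap 1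
        + Pi.single j 1 + Pi.single i k : Y0 m → ℕ)
        = β - Pi.single i 1 - Pi.single i.swap 1 + Pi.single j 1 + Pi.single j.swap 1 := by
      funext l
      by_cases l1 : l = i
      · subst l1
        simp [hij, e1.symm, hii.symm]
        omega
      by_cases l2 : l = i.swap
      · subst l2
        simp [hij'.symm, e2, hii]
      simp [l1, l2]
      omega
    rw [hv2, hv3, hv4, Nat.choose_one_right]
    by_cases hc1 : ((β i - 1).choose k : F) = 0
    · simp [hc1]
    by_cases hc2 : ((β j + 1 : ℕ) : F) = 0
    · simp [hc2]
    exact Submodule.smul_mem _ _ (h3 hz hc1 hc2)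
  have h' := (Submodule.add_mem_iff_left S (Submodule.smul_mem S _ hsnd)).1 h
  rw [smul_smul, Submodule.smul_mem_iff _ (mul_ne_zero (tau_ne_zero j) hc)] at h'
  exact h'

lemma mul_pairMono_mono (a b : Fin n) (β : Y0 m → ℕ) (v : Finset (Fin n)) :
    mul F (pairMono F 0 a b) (mono F β v)
      = mul F (mono F 0 {a}) (mul F (mono F 0 {b}) (mono F β v)) := by
  rw [pairMono, mul_assoc']

/-- Bracketing with `x_i^(k+1) x_a x_b`. -/
lemma mem_of_ham_pairMono (hS : ∀ f ∈ S, ∀ g ∈ S, ham F f g ∈ S) {i : Y0 m} {k : ℕ}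
    {β : Y0 m → ℕ} {v : Finset (Fin n)} {a b : Fin n} (hab : a ≠ b) (ha : a ∉ v) (hb : b ∉ v)
    (hk : k ≤ β i) (h1 : mono F (Pi.single i (k + 1)) {a, b} ∈ S)
    (h2 : mono F (β - Pi.single i k + Pi.single i.swap 1) v ∈ S)
    (hc : ((β i).choose k : F) ≠ 0) : mono F β (insert a (insert b v)) ∈ S := by
  rw [← pairMono_mem hab] at h1
  have h := hS _ h1 _ h2
  rw [ham_single_pairMono hab, ham_pairMono_zero hab, pd_inr_of_notMem ha, pd_inr_of_notMem hb,
    pd_inl_add_single, mul_pairMono_mono, mul_odd_mono, if_neg hb, map_smul, mul_odd_mono,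
    if_neg (by simp [hab, ha]), map_smul, map_smul, mul_single_mono, sub_single_add hk,
    Pi.sub_apply, Pi.single_eq_same, Nat.sub_add_cancel hk] at h
  simp only [map_zero, sub_zero, add_zero, smul_smul] at h
  rwa [Submodule.smul_mem_iff] at h
  simp [tau_ne_zero, hc]

/-- Bracketing with `x_i x_a x_b` to replace `x_a` by `x_b`. -/
lemma mem_of_ham_pairMono_exchange (hS : ∀ f ∈ S, ∀ g ∈ S, ham F f g ∈ S) {i : Y0 m}
    {β : Y0 m → ℕ} {u : Finset (Fin n)} {a b : Fin n} (ha : a ∉ u) (hb : b ∈ u)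
    (hk : 1 ≤ β i) (h1 : mono F (Pi.single i 1) {a, b} ∈ S)
    (h2 : mono F (β - Pi.single i 1) (insert a (u.erase b)) ∈ S)
    (hc : (β i : F) ≠ 0) : mono F β u ∈ S := by
  have hab : a ≠ b := fun h => ha (h ▸ hb)
  rw [← pairMono_mem hab] at h1
  have h := hS _ h1 _ h2
  -- x_a already occurs in the second monomial, so the part of the bracket that keeps x_a x_b
  -- vanishes.
  have hz : mul F (pairMono F 0 a b) (pd F (Sum.inl i.swap)
      (mono F (β - Pi.single i 1) (insert a (u.erase b)))) = 0 := by
    rw [pd_inl_mono]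
    split_ifs
    · simp
    · rw [mul_pairMono_mono, mul_odd_mono, if_neg (by simp [hab.symm]), map_smul, mul_odd_mono,
        if_pos (by simp), smul_zero]
  have e : (insert a (u.erase b)).erase a = u.erase b := by
    rw [Finset.erase_insert]
    simp [ha]
  rw [ham_single_pairMono hab i 0, hz, ham_pairMono_zero hab,
    pd_inr_of_notMem (r := b) (by simp [hab.symm]), pd_inr_mono, if_pos (by simp), e, map_smul,
    mul_odd_mono, if_neg (by simp), Finset.insert_erase hb] at h
  simp only [zero_add, map_zero, sub_zero, smul_zero, map_smul, mul_single_mono,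
    sub_single_add hk, smul_smul] at h
  rw [Pi.sub_apply, Pi.single_eq_same, Nat.sub_add_cancel hk, Nat.choose_one_right,
    Submodule.smul_mem_iff] at h
  · exact h
  · simp [hc]

end

/-! ### Generation of all monomials of height one. -/

section
variable {F : Type*} [Field F] {m n : ℕ}

/-- The exponents of the monomials that span `nPot`. -/
def Adm (p : ℕ) (t : Y0 m → ℕ) (β : Y0 m → ℕ) (u : Finset (Fin n)) : Prop :=
  β ≤ piMax p t ∧ Even u.card ∧ (β = piMax p t → u ≠ Finset.univ ∧ u ≠ ∅)

lemma Adm.of_lt {p : ℕ} {t β : Y0 m → ℕ} {u : Finset (Fin n)} (h : β ≤ piMax p t)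
    (hu : Even u.card) (l : Y0 m) (hl : β l < piMax p t l) : Adm p t β u :=
  ⟨h, hu, fun h' => absurd (congrFun h' l) hl.ne⟩

lemma add_single_le {β γ : Y0 m → ℕ} {i : Y0 m} (h : β ≤ γ) (hi : β i < γ i) :
    β + Pi.single i 1 ≤ γ := by
  intro l
  by_cases hl : l = i
  · subst hl
    simpa using hi
  · simpa [hl] using h l

lemma exists_two_of_card {u : Finset (Fin n)} (h : 2 ≤ u.card) :
    ∃ a b v, a ≠ b ∧ a ∉ v ∧ b ∉ v ∧ u = insert a (insert b v) ∧ v.card + 2 = u.card := by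
  obtain ⟨a, ha, b, hb, hab⟩ := Finset.one_lt_card.1 h
  have hb' : b ∈ u.erase a := Finset.mem_erase.2 ⟨hab.symm, hb⟩
  refine ⟨a, b, (u.erase a).erase b, hab, by simp, by simp, ?_, ?_⟩
  · rw [Finset.insert_erase hb', Finset.insert_erase ha]
  · have h1 := Finset.card_erase_add_one ha
    have h2 := Finset.card_erase_add_one hb'
    omega

variable {S : Submodule F (O F m n)}

/-- Bracketing with `x_i^(2) x_j`, when `x_i` and `x_j` occur linearly. -/
lemma mem_of_ham_sq_mul (hS : ∀ f ∈ S, ∀ g ∈ S, ham F f g ∈ S) {i j : Y0 m}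
    (hij : i ≠ j) {β : Y0 m → ℕ} {u : Finset (Fin n)}
    (hi : β i = 1) (hj : β j = 1) (hj' : β j.swap = 0)
    (h1 : mono F (Pi.single i 2 + Pi.single j 1) ∅ ∈ S)
    (h2 : mono F (β - Pi.single i 1 - Pi.single j 1 + Pi.single i.swap 1) u ∈ S) :
    mono F β u ∈ S := by
  have e2 : j.swap ≠ i.swap := fun h => hij (Sum.swap_leftInverse.injective h).symm
  have h := hS _ h1 _ h2
  rw [ham_single_add_single hij 1, pd_inl_of_zero (i := j.swap) (by simp [e2, hj']),
    pd_inl_add_single, mul_single_mono, sub_single_add (by simp [hij.symm, hj]), map_smul,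
    mul_single_mono, sub_single_add (by simp [hi])] at h
  simpa [hi, hj, hij, hij.symm, Submodule.smul_mem_iff, tau_ne_zero] using h

/-- Induction on the total degree. Exponents stay below p, so the binomial coefficients that occur
are invertible. Bracketing with x_i^(3) reduces the degree whenever β_i ≥ 2 and x_{i'} is not
saturated. Monomials that escape this are first moved within their degree into that range by x_i^(2)
or x_i x_j. What then remains is the top exponent π, handled by exchanging an odd variable, and
exponents with at most one linear factor in each pair, handled by x_i^(2) x_j and by splitting off
two odd variables. -/
theorem mono_mem_of_low_degree {p : ℕ} [Fact p.Prime] [CharP F p] (hp : 3 < p)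
    (hm : 0 < m) (hS : ∀ f ∈ S, ∀ g ∈ S, ham F f g ∈ S)
    (h0 : mono F 0 ∅ ∈ S) (hs1 : ∀ i, mono F (Pi.single i 1) ∅ ∈ S)
    (hs2 : ∀ i, mono F (Pi.single i 2) ∅ ∈ S)
    (hs11 : ∀ i j, i ≠ j → mono F (Pi.single i 1 + Pi.single j 1) ∅ ∈ S)
    (ho : ∀ a b : Fin n, a ≠ b → mono F 0 {a, b} ∈ S)
    (hs3 : ∀ i, mono F (Pi.single i 3) ∅ ∈ S)
    (hso : ∀ i, ∀ a b : Fin n, a ≠ b → mono F (Pi.single i 1) {a, b} ∈ S)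
    (β : Y0 m → ℕ) (u : Finset (Fin n)) (hβ : Adm p 1 β u) : mono F β u ∈ S := by
  have hpi : ∀ i, piMax p (1 : Y0 m → ℕ) i = p - 1 := fun i => by simp [piMax]
  -- Up to a nonzero scalar this is the bracket of x_j x_{i'} with x_i^(3).
  have hs21 : ∀ i j, i ≠ j → j ≠ i.swap → mono F (Pi.single i 2 + Pi.single j 1) ∅ ∈ S := by
    intro i j hij hij'
    have e : (Pi.single i 2 + Pi.single j 1 - Pi.single j (0 + 1) + Pi.single i.swap.swap 1
        : Y0 m → ℕ) = Pi.single i 3 := by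
      rw [zero_add, add_tsub_cancel_right, Sum.swap_swap, ← Pi.single_add]
    refine mem_of_ham_single_add_single hS (i := j) (j := i.swap) (k := 0) hij'
      (fun h => hij (Sum.swap_leftInverse.injective h)) (by simp) (hs11 _ _ hij') ?_ ?_ ?_
    · rw [e]
      exact hs3 i
    · simp [hij.symm]
    · intro h
      exfalso
      have h1 : j.swap ≠ i := fun h => hij' (swap_eq_iff.1 h)
      simp [h1, swap_ne] at h
  induction hN : ∑ l, β l + u.card using Nat.strong_induction_on generalizing β u with
  | _ N ih =>
  -- monomials of the same degree in which `x_i` occurs at least quadratically and `x_{i'}` is not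
  -- saturated
  have hA : ∀ γ v, Adm p 1 γ v → ∑ l, γ l + v.card = N →
      (∃ i, 2 ≤ γ i ∧ γ i.swap < p - 1) → mono F γ v ∈ S := by
    rintro γ v hγ hγN ⟨i, hi, hi'⟩
    have hle := hγ.1
    have hle' : γ - Pi.single i 2 ≤ piMax p 1 := tsub_le_self.trans hle
    have hii : γ i ≤ p - 1 := hpi i ▸ hle i
    refine mem_of_ham_single hS hi (hs3 i) ?_ (cast_choose_ne_zero (p := p) hi (by omega))
    have hsum := sum_add_single (γ - Pi.single i 2) i.swap 1
    have hsum' := sum_sub_single hi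
    refine ih (N - 1) (by omega) _ _ ?_ (by omega)
    refine Adm.of_lt (add_single_le hle' ?_) hγ.2.1 i ?_
    · rw [hpi]
      simpa [swap_ne] using hi'
    · rw [hpi]
      simp [ne_swap]
      omega
  by_cases hcA : ∃ i, 2 ≤ β i ∧ β i.swap < p - 1
  · exact hA β u hβ hN hcA
  have hle := hβ.1
  have hle1 : ∀ i, β i ≤ p - 1 := fun i => hpi i ▸ hle i
  -- The factor x_i x_{i'} arises from x_{i'}^(2) by bracketing with x_i^(2), in the same degree,
  -- where `hA` applies.
  by_cases hcB : ∃ i, β i = 1 ∧ β i.swap = 1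
  · obtain ⟨i, hi, hi'⟩ := hcB
    refine mem_of_ham_single hS (i := i) (k := 1) (by omega) (hs2 i) ?_ (by simp [hi])
    have hsum := sum_add_single (β - Pi.single i 1) i.swap 1
    have hsum' := sum_sub_single (β := β) (i := i) (k := 1) (by omega)
    refine hA _ _ ?_ (by omega) ⟨i.swap, ?_, ?_⟩
    · refine Adm.of_lt (add_single_le (tsub_le_self.trans hle) ?_) hβ.2.1 i ?_
      · rw [hpi]
        simp [swap_ne, hi']
        omega
      · rw [hpi]
        simp [ne_swap, hi]
        omega
    · simp [swap_ne, hi']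
    · simp [ne_swap, hi]
      omega
  have htri : ∀ i, (β i = p - 1 ∧ β i.swap = p - 1) ∨
      (β i ≤ 1 ∧ β i.swap ≤ 1 ∧ ¬ (β i = 1 ∧ β i.swap = 1)) := by
    intro i
    have h1 : ¬ (2 ≤ β i ∧ β i.swap < p - 1) := fun h => hcA ⟨i, h⟩
    have h2 : ¬ (2 ≤ β i.swap ∧ β i < p - 1) := fun h => hcA ⟨i.swap, by simpa using h⟩
    have h3 : ¬ (β i = 1 ∧ β i.swap = 1) := fun h => hcB ⟨i, h⟩
    have h4 := hle1 i
    have h5 := hle1 i.swap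
    by_cases h : 2 ≤ β i
    · left
      omega
    · by_cases h' : 2 ≤ β i.swap
      · left
        omega
      · right
        exact ⟨by omega, by omega, h3⟩
  -- A saturated pair next to an unsaturated variable is broken up by x_i x_j within the same
  -- degree, and p - 2 ≥ 2 brings both resulting monomials under `hA`. If every variable is
  -- saturated, admissibility makes u proper and nonempty, and x_i x_a x_b exchanges an odd
  -- variable.
  by_cases hf : ∃ i, β i = p - 1
  · obtain ⟨i, hi⟩ := hf
    have hi' : β i.swap = p - 1 := by
      rcases htri i with h | h
      · exact h.2
      · omega
    by_cases hj : ∃ j, β j ≠ p - 1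
    · obtain ⟨j, hj⟩ := hj
      have hij : i ≠ j := fun h => hj (h ▸ hi)
      have hij' : j ≠ i.swap := fun h => hj (h ▸ hi')
      have e1 : j.swap ≠ i := fun h => hij' (swap_eq_iff.1 h)
      have e2 : i.swap ≠ j.swap := fun h => hij (Sum.swap_leftInverse.injective h)
      have hj1 : β j ≤ 1 ∧ β j.swap ≤ 1 := by
        rcases htri j with h | h
        · exact absurd h.1 hj
        · exact ⟨h.1, h.2.1⟩
      have hsub : β - Pi.single i 1 ≤ piMax p 1 := tsub_le_self.trans hle
      have s1 := sum_sub_single (β := β) (i := i) (k := 1) (by omega)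
      have s2 := sum_add_single (β - Pi.single i 1) j.swap 1
      have s3 := sum_sub_single (β := β - Pi.single i 1) (i := i.swap) (k := 1)
        (by simp [swap_ne, hi']; omega)
      have s4 := sum_add_single (β - Pi.single i 1 - Pi.single i.swap 1) j 1
      have s5 := sum_add_single (β - Pi.single i 1 - Pi.single i.swap 1 + Pi.single j 1) j.swap 1
      refine mem_of_ham_single_add_single hS hij hij' (k := 0) (by omega) (hs11 i j hij) ?_ ?_ ?_
      · refine hA _ _ ?_ (by rw [zero_add]; omega) ⟨i.swap, ?_, ?_⟩
        · refine Adm.of_lt (add_single_le hsub ?_) hβ.2.1 i ?_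
          · rw [hpi]
            simp [e1]
            omega
          · rw [hpi]
            simp [e1.symm]
            omega
        · simp [e2, swap_ne, hi']
          omega
        · simp [e1.symm]
          omega
      · rw [zero_add, Nat.choose_one_right]
        exact cast_ne_zero_of_lt (p := p) (by omega) (by omega)
      · intro _ _ _
        refine hA _ _ ?_ (by omega) ⟨i, ?_, ?_⟩
        · refine Adm.of_lt (add_single_le (add_single_le (tsub_le_self.trans hsub) ?_) ?_)
            hβ.2.1 i ?_
          · rw [hpi]
            simp [hij.symm, hij']
            omega
          · rw [hpi]
            simp [e1, e2.symm, swap_ne]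
            omega
          · rw [hpi]
            simp [e1.symm, hij, ne_swap]
            omega
        · simp [e1.symm, hij, ne_swap]
          omega
        · simp [e2, hij'.symm, swap_ne]
          omega
    · push Not at hj
      have hpi' : β = piMax p 1 := funext fun l => (hj l).trans (hpi l).symm
      obtain ⟨hu1, hu2⟩ := hβ.2.2 hpi'
      obtain ⟨b, hb⟩ := Finset.nonempty_iff_ne_empty.2 hu2
      obtain ⟨a, ha⟩ : ∃ a, a ∉ u := by
        by_contra hcon
        push Not at hcon
        exact hu1 (Finset.eq_univ_iff_forall.2 hcon)
      have hab : a ≠ b := fun h => ha (h ▸ hb)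
      have s1 := sum_sub_single (β := β) (i := i) (k := 1) (by omega)
      have c1 : (insert a (u.erase b)).card = u.card := by
        rw [Finset.card_insert_of_notMem (by simp [ha]), Finset.card_erase_add_one hb]
      refine mem_of_ham_pairMono_exchange hS ha hb (i := i) (by omega) (hso i a b hab) ?_
        (cast_ne_zero_of_lt (p := p) (by omega) (by omega))
      refine ih (N - 1) (by omega) _ _ ?_ (by omega)
      refine Adm.of_lt (tsub_le_self.trans hle) (c1 ▸ hβ.2.1) i ?_
      rw [hpi]
      simp
      omega
  have hle2 : ∀ i, β i ≤ 1 := by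
    intro i
    rcases htri i with h | h
    · exact absurd ⟨i, h.1⟩ hf
    · exact h.1
  by_cases h1 : ∃ i, β i = 1
  · obtain ⟨i, hi⟩ := h1
    have hi' : β i.swap = 0 := by
      have := htri i
      have := hle2 i.swap
      omega
    by_cases h2 : ∃ j, j ≠ i ∧ β j = 1
    · obtain ⟨j, hij, hj⟩ := h2
      have hij' : j ≠ i.swap := by
        rintro rfl
        omega
      have hj' : β j.swap = 0 := by
        have := htri j
        have := hle2 j.swap
        omega
      refine mem_of_ham_sq_mul hS hij.symm hi hj hj' (hs21 i j hij.symm hij') ?_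
      have s1 := sum_sub_single (β := β) (i := i) (k := 1) (by omega)
      have s2 := sum_sub_single (β := β - Pi.single i 1) (i := j) (k := 1) (by simp [hij, hj])
      have s3 := sum_add_single (β - Pi.single i 1 - Pi.single j 1) i.swap 1
      refine ih (N - 1) (by omega) _ _ ?_ (by omega)
      refine Adm.of_lt (add_single_le (tsub_le_self.trans (tsub_le_self.trans hle)) ?_) hβ.2.1 i ?_
      · rw [hpi]
        simp [hi']
        omega
      · rw [hpi]
        simp [hij.symm, ne_swap, hi]
        omega
    · push Not at h2
      have hβi : β = Pi.single i 1 := by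
        funext l
        by_cases hl : l = i
        · subst hl
          simp [hi]
        · have := h2 l hl
          have := hle2 l
          simp [hl]
          omega
      have hsum : ∑ l, β l = 1 := by
        rw [hβi]
        simp
      rcases Nat.lt_or_ge u.card 2 with hc | hc
      · have : u = ∅ := by
          have := hβ.2.1
          rw [Nat.even_iff] at this
          exact Finset.card_eq_zero.1 (by omega)
        rw [this, hβi]
        exact hs1 i
      · obtain ⟨a, b, v, hab, hav, hbv, rfl, hv⟩ := exists_two_of_card hc
        have hev := hβ.2.1
        rw [Nat.even_iff] at hev
        rcases Nat.eq_zero_or_pos v.card with hv0 | hv0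
        · rw [Finset.card_eq_zero.1 hv0, hβi]
          exact hso i a b hab
        have hab2 : ({a, b} : Finset (Fin n)).card = 2 := Finset.card_pair hab
        refine mem_of_ham_pairMono hS hab hav hbv (i := i) (k := 1) (by omega) ?_ ?_ (by simp [hi])
        -- The element x_i^(2) x_a x_b has degree 4, whereas v is nonempty of even size, so the
        -- degree here is at least 5.
        · refine ih 4 (by omega) _ _ ?_ (by rw [hab2]; simp)
          refine Adm.of_lt (fun l => ?_) (by simp [hab2]) i ?_
          · rw [hpi]
            by_cases hl : l = i
            · subst hl
              simp
              omega
            · simp [hl]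
          · rw [hpi]
            simp
            omega
        · have s1 := sum_sub_single (β := β) (i := i) (k := 1) (by omega)
          have s2 := sum_add_single (β - Pi.single i 1) i.swap 1
          refine ih (N - 2) (by omega) _ _ ?_ (by omega)
          refine Adm.of_lt (add_single_le (tsub_le_self.trans hle) ?_)
            (Nat.even_iff.2 (by omega)) i ?_
          · rw [hpi]
            simp [hi']
            omega
          · rw [hpi]
            simp [ne_swap, hi]
            omega
  · push Not at h1
    have hβ0 : β = 0 := by
      funext l
      have := h1 l
      have := hle2 l
      simp
      omega
    have hsum : ∑ l, β l = 0 := by simp [hβ0]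
    rcases Nat.lt_or_ge u.card 2 with hc | hc
    · have : u = ∅ := by
        have := hβ.2.1
        rw [Nat.even_iff] at this
        exact Finset.card_eq_zero.1 (by omega)
      rw [this, hβ0]
      exact h0
    · obtain ⟨a, b, v, hab, hav, hbv, rfl, hv⟩ := exists_two_of_card hc
      have hev := hβ.2.1
      rw [Nat.even_iff] at hev
      rcases Nat.eq_zero_or_pos v.card with hv0 | hv0
      · rw [Finset.card_eq_zero.1 hv0, hβ0]
        exact ho a b hab
      -- Any even variable will do: x_i x_a x_b and x_{i'} x^v have the bracket ± x_a x_b x^v.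
      let i : Y0 m := Sum.inl ⟨0, hm⟩
      refine mem_of_ham_pairMono hS hab hav hbv (i := i) (k := 0) (by omega)
        (hso i a b hab) ?_ (by simp)
      have s2 := sum_add_single (β - Pi.single i 0) i.swap 1
      have s3 := sum_sub_single (β := β) (i := i) (k := 0) (by omega)
      refine ih (N - 1) (by omega) _ _ ?_ (by omega)
      refine Adm.of_lt (add_single_le (tsub_le_self.trans hle) ?_)
        (Nat.even_iff.2 (by omega)) i ?_
      · rw [hpi]
        simp [hβ0]
        omega
      · rw [hpi]
        simp [ne_swap, hβ0]
        omega

end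

/-! ### Raising one height by one power of p. -/

section
variable {F : Type*} [Field F] {m n : ℕ}

/-- Lucas's theorem, one base-p digit at a time. -/
lemma choose_pow_modEq {p : ℕ} [Fact p.Prime] (s b : ℕ) :
    b.choose (p ^ s) ≡ b / p ^ s [MOD p] := by
  have hp : 0 < p := (Fact.out : p.Prime).pos
  induction s generalizing b with
  | zero => simp [Nat.ModEq]
  | succ s ih =>
    refine Choose.choose_modEq_choose_mod_mul_choose_div_nat.trans ?_
    rw [pow_succ', Nat.mul_mod_right, Nat.choose_zero_right, one_mul,
      Nat.mul_div_cancel_left _ hp, ← Nat.div_div_eq_div_mul]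
    exact ih _

lemma cast_choose_pow_ne_zero {p : ℕ} [Fact p.Prime] [CharP F p] {s b : ℕ}
    (h1 : p ^ s ≤ b) (h2 : b < p * p ^ s) : (b.choose (p ^ s) : F) ≠ 0 := by
  have hp : 0 < p := (Fact.out : p.Prime).pos
  have hq : 0 < p ^ s := pow_pos hp s
  rw [(CharP.natCast_eq_natCast F p).2 (choose_pow_modEq s b)]
  refine cast_ne_zero_of_lt (p := p) ?_ ?_
  · exact (Nat.div_pos h1 hq).ne'
  · exact Nat.div_lt_of_lt_mul (by rwa [mul_comm] at h2)

/-- From p^s C(b, p^s) = b C(b - 1, p^s - 1): if p does not divide the last binomial, then p^s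
divides b. Hence the second term of a bracket with x_r^(q) x_j appears only when q divides the
exponent of x_r. -/
lemma cast_choose_pred_eq_zero {p : ℕ} [Fact p.Prime] [CharP F p] {s b : ℕ}
    (h0 : b ≠ 0) (h : ¬ p ^ s ∣ b) : ((b - 1).choose (p ^ s - 1) : F) = 0 := by
  have hp : p.Prime := Fact.out
  rw [CharP.cast_eq_zero_iff F p]
  by_contra hc
  have hq : 0 < p ^ s := pow_pos hp.pos s
  have key := Nat.add_one_mul_choose_eq (b - 1) (p ^ s - 1)
  rw [Nat.sub_add_cancel (Nat.pos_of_ne_zero h0), Nat.sub_add_cancel hq] at key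
  have hcop : Nat.Coprime (p ^ s) ((b - 1).choose (p ^ s - 1)) :=
    Nat.Coprime.pow_left s ((Nat.Prime.coprime_iff_not_dvd hp).2 hc)
  exact h (hcop.dvd_of_dvd_mul_right (key ▸ Dvd.intro_left _ rfl))

lemma piMax_add_one {p : ℕ} (hp : 0 < p) (t : Y0 m → ℕ) (i : Y0 m) :
    piMax p t i + 1 = p ^ t i :=
  Nat.sub_add_cancel (pow_pos hp _)

/-- Multiplying a saturated power of x_i by x_i produces the factor p^(t_i); this is how unwanted
terms that would leave the truncated algebra disappear. -/
lemma cast_piMax_add_one {p : ℕ} [Fact p.Prime] [CharP F p] {t : Y0 m → ℕ} {i : Y0 m}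
    (h : 1 ≤ t i) : ((piMax p t i + 1 : ℕ) : F) = 0 := by
  rw [piMax_add_one (Fact.out : p.Prime).pos, CharP.cast_eq_zero_iff F p]
  exact dvd_pow_self p (by omega)

lemma cast_piMax_ne_zero {p : ℕ} [Fact p.Prime] [CharP F p] {t : Y0 m → ℕ} {i : Y0 m}
    (h : 1 ≤ t i) : ((piMax p t i : ℕ) : F) ≠ 0 := by
  intro h0
  have := cast_piMax_add_one (F := F) (p := p) h
  push_cast at this
  rw [h0, zero_add] at this
  exact one_ne_zero this

lemma one_le_piMax {p : ℕ} [Fact p.Prime] {t : Y0 m → ℕ} {i : Y0 m}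
    (h : 1 ≤ t i) : 1 ≤ piMax p t i := by
  have h1 := piMax_add_one (Fact.out : p.Prime).pos t i
  have h2 : p ^ 1 ≤ p ^ t i := Nat.pow_le_pow_right (Fact.out : p.Prime).pos h
  have h3 := (Fact.out : p.Prime).two_le
  rw [pow_one] at h2
  omega

/-- The assumption m > 1 provides a second canonical pair, which all arguments about a fixed x_r
work with. -/
lemma exists_off_pair (hm : 1 < m) (r : Y0 m) : ∃ j : Y0 m, j ≠ r ∧ j ≠ r.swap := by
  have : ∃ k : Fin m, Sum.inl k ≠ r ∧ Sum.inl k ≠ r.swap := by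
    obtain ⟨k, hk⟩ := Fintype.exists_ne_of_one_lt_card (by simpa using hm)
      (r.elim id id)
    refine ⟨k, ?_, ?_⟩ <;> rcases r with r | r <;> simp at hk ⊢ <;> exact hk
  obtain ⟨k, hk⟩ := this
  exact ⟨_, hk⟩

variable {S : Submodule F (O F m n)}

/-- One more power of `p` in the variable `x_r`. -/
theorem mono_mem_add_single {p : ℕ} [Fact p.Prime] [CharP F p] (hm : 1 < m)
    (hS : ∀ f ∈ S, ∀ g ∈ S, ham F f g ∈ S) {t : Y0 m → ℕ} (ht : ∀ i, 1 ≤ t i) (r : Y0 m)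
    (hN : ∀ β u, Adm p t β u → mono F β u ∈ S)
    (hr : ∀ j, j ≠ r → j ≠ r.swap → mono F (Pi.single r (p ^ t r) + Pi.single j 1) ∅ ∈ S)
    (β : Y0 m → ℕ) (u : Finset (Fin n)) (hβ : Adm p (t + Pi.single r 1) β u) :
    mono F β u ∈ S := by
  have hp2 := (Fact.out : p.Prime).two_le
  have hp0 := (Fact.out : p.Prime).pos
  set q := p ^ t r with hq
  have hpq : p ∣ q := dvd_pow_self p (by have := ht r; omega)
  have hq0 : 0 < q := pow_pos hp0 _
  have hq2 : 2 ≤ q := hp2.trans (Nat.le_of_dvd hq0 hpq)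
  have hpi : ∀ l, l ≠ r → piMax p (t + Pi.single r 1) l = piMax p t l := by
    intro l hl
    simp [piMax, hl]
  have hpr : piMax p (t + Pi.single r 1) r + 1 = p * q := by
    rw [piMax_add_one hp0]
    simp [pow_succ', hq]
  have hpr' : piMax p t r + 1 = q := piMax_add_one hp0 t r
  have hqle : q ≤ p * q := Nat.le_mul_of_pos_left q hp0
  have hle2 : ∀ γ : Y0 m → ℕ, γ ≤ piMax p (t + Pi.single r 1) → γ r < p * q := by
    intro γ hγ
    have : γ r ≤ piMax p (t + Pi.single r 1) r := hγ r
    omega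
  have hqq : 2 * q ≤ p * q := Nat.mul_le_mul_right q hp2
  have hrr := swap_ne r
  -- bracketing with `x_r^(q) x_j`
  have hI : ∀ γ v, Adm p (t + Pi.single r 1) γ v → q ≤ γ r → ∀ j, j ≠ r → j ≠ r.swap →
      γ j.swap < piMax p t j.swap →
      (∀ δ w, Adm p (t + Pi.single r 1) δ w → δ r = γ r - q → mono F δ w ∈ S) →
      (γ r.swap ≠ 0 → q ∣ γ r → ((γ j + 1 : ℕ) : F) ≠ 0 →
        mono F (γ - Pi.single r 1 - Pi.single r.swap 1 + Pi.single j 1 + Pi.single j.swap 1) v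
          ∈ S) → mono F γ v ∈ S := by
    intro γ v hγ hqγ j hj1 hj2 hjl hrec hsnd
    have e1 : j.swap ≠ r := fun h => hj2 (swap_eq_iff.1 h)
    have hk : q - 1 + 1 = q := Nat.sub_add_cancel hq0
    refine mem_of_ham_single_add_single hS hj1.symm hj2 (k := q - 1) (by omega) ?_ ?_ ?_ ?_
    · rw [hk]
      exact hr j hj1 hj2
    · rw [hk]
      have hval : (γ - Pi.single r q + Pi.single j.swap 1 : Y0 m → ℕ) r = γ r - q := by
        simp [e1.symm]
      have := hle2 γ hγ.1
      refine hrec _ _ (Adm.of_lt (add_single_le (tsub_le_self.trans hγ.1) ?_) hγ.2.1 r ?_) hval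
      · rw [hpi _ e1]
        simpa [e1] using hjl
      · rw [hval]
        omega
    · rw [hk]
      exact cast_choose_pow_ne_zero hqγ (hle2 γ hγ.1)
    · intro h1 h2 h3
      refine hsnd h1 ?_ h3
      by_contra hcon
      exact h2 (cast_choose_pred_eq_zero (by omega) hcon)
  induction hb : β r using Nat.strong_induction_on generalizing β u with
  | _ b ih =>
  have hbt : b < p * q := hb ▸ hle2 β hβ.1
  -- Bracketing with x_r^(q) x_{j'} uses the room left in x_j. The second term has r-exponent b - 1
  -- and carries the factor γ_{j'} + 1; that factor is zero if x_{j'} is saturated, so the term is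
  -- admissible whenever it occurs.
  have hII : ∀ γ v, Adm p (t + Pi.single r 1) γ v → γ r = b →
      (∃ j, j ≠ r ∧ j ≠ r.swap ∧ γ j < piMax p t j) → mono F γ v ∈ S := by
    rintro γ v hγ hγb ⟨j, hj1, hj2, hjl⟩
    have e1 : j.swap ≠ r := fun h => hj2 (swap_eq_iff.1 h)
    have e2 : j.swap ≠ r.swap := fun h => hj1 (Sum.swap_leftInverse.injective h)
    rcases Nat.lt_or_ge b q with hbq | hbq
    · refine hN γ v (Adm.of_lt (fun l => ?_) hγ.2.1 j hjl)
      by_cases hl : l = r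
      · have : γ r ≤ piMax p t r := by omega
        exact hl ▸ this
      · exact hpi l hl ▸ hγ.1 l
    refine hI γ v hγ (by omega) j.swap e1 e2 (by simpa using hjl) ?_ ?_
    · intro δ w hδ hδr
      exact ih _ (by omega) δ w hδ hδr
    · intro h1 _ h3
      have hjs : γ j.swap ≤ piMax p t j.swap := hpi _ e1 ▸ hγ.1 j.swap
      have hjs' : γ j.swap ≠ piMax p t j.swap := by
        intro h
        rw [h] at h3
        exact h3 (cast_piMax_add_one (ht _))
      have hval : (γ - Pi.single r 1 - Pi.single r.swap 1 + Pi.single j.swap 1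
          + Pi.single j.swap.swap 1 : Y0 m → ℕ) r = b - 1 := by
        simp [e1.symm, hj1.symm, ne_swap, hγb]
      refine ih (b - 1) (by omega) _ _ (Adm.of_lt (add_single_le (add_single_le
        (tsub_le_self.trans (tsub_le_self.trans hγ.1)) ?_) ?_) hγ.2.1 r ?_) hval
      · rw [hpi _ e1]
        simp [e1, e2]
        omega
      · rw [Sum.swap_swap, hpi _ hj1]
        simp [hj1, hj2, ne_swap]
        omega
      · rw [hval]
        omega
  by_cases hT1 : ∃ j, j ≠ r ∧ j ≠ r.swap ∧ β j < piMax p t j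
  · exact hII β u hβ hb hT1
  have hfull : ∀ j, j ≠ r → j ≠ r.swap → β j = piMax p t j := by
    intro j h1 h2
    have h3 : β j ≤ piMax p t j := hpi j h1 ▸ hβ.1 j
    by_contra h4
    exact hT1 ⟨j, h1, h2, by omega⟩
  obtain ⟨j, hj1, hj2⟩ := exists_off_pair hm r
  have e1 : j.swap ≠ r := fun h => hj2 (swap_eq_iff.1 h)
  have e2 : j.swap ≠ r.swap := fun h => hj1 (Sum.swap_leftInverse.injective h)
  have hj := hfull j hj1 hj2
  have hj' := hfull j.swap e1 e2
  have hj0 := one_le_piMax (p := p) (ht j)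
  have hj0' := one_le_piMax (p := p) (ht j.swap)
  have hcj : ((β j : ℕ) : F) ≠ 0 := hj ▸ cast_piMax_ne_zero (ht j)
  have hsub : β - Pi.single j 1 ≤ piMax p (t + Pi.single r 1) := tsub_le_self.trans hβ.1
  have hNe : ∀ i k : Y0 m, i ≠ k →
      mono F (Pi.single i (0 + 1) + Pi.single k 1) (∅ : Finset (Fin n)) ∈ S := by
    intro i k hik
    by_cases h : ∃ l, l ≠ i ∧ l ≠ k
    · obtain ⟨l, hl1, hl2⟩ := h
      refine hN _ _ (Adm.of_lt (fun x => ?_) (by simp) l ?_)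
      · have := one_le_piMax (p := p) (ht x)
        by_cases h1 : x = i
        · subst h1
          simpa [hik] using this
        · by_cases h2 : x = k
          · subst h2
            simpa [h1] using this
          · simp [h1, h2]
      · simpa [hl1, hl2] using Nat.lt_of_succ_le (one_le_piMax (p := p) (ht l))
    · exfalso
      push Not at h
      obtain ⟨l, hl1, hl2⟩ := exists_off_pair hm i
      have h1 := h l hl1
      have h2 := h i.swap (swap_ne i)
      exact hl2 (h1.trans h2.symm)
  -- All variables outside the pair {r, r'} are saturated by now. If u is proper and nonempty,
  -- exchanging an odd variable through x_j x_a x_d takes one power from x_j, so that `hII` applies.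
  by_cases hu : u ≠ Finset.univ ∧ u ≠ ∅
  · obtain ⟨hu1, hu2⟩ := hu
    obtain ⟨d, hd⟩ := Finset.nonempty_iff_ne_empty.2 hu2
    obtain ⟨a, ha⟩ : ∃ a, a ∉ u := by
      by_contra hcon
      push Not at hcon
      exact hu1 (Finset.eq_univ_iff_forall.2 hcon)
    have had : a ≠ d := fun h => ha (h ▸ hd)
    have c1 : (insert a (u.erase d)).card = u.card := by
      rw [Finset.card_insert_of_notMem (by simp [ha]), Finset.card_erase_add_one hd]
    refine mem_of_ham_pairMono_exchange hS ha hd (i := j) (by omega) ?_ ?_ hcj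
    · refine hN _ _ (Adm.of_lt (fun x => ?_) (by simp [Finset.card_pair had]) r ?_)
      · have := one_le_piMax (p := p) (ht x)
        by_cases h1 : x = j
        · subst h1
          simpa using this
        · simp [h1]
      · have := one_le_piMax (p := p) (ht r)
        simp [hj1.symm]
        omega
    · refine hII _ _ (Adm.of_lt hsub (c1 ▸ hβ.2.1) j ?_) ?_ ⟨j, hj1, hj2, ?_⟩
      · rw [hpi _ hj1]
        simp
        omega
      · simp [hj1.symm, hb]
      · simp
        omega
  have hntop : β ≠ piMax p (t + Pi.single r 1) := fun h => hu (hβ.2.2 h)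
  have hrs : β r.swap ≤ piMax p t r.swap := hpi _ hrr ▸ hβ.1 r.swap
  -- If x_{r'} is saturated, x_r is not. The bracket of x_j x_{r'} with a monomial of r-exponent b +
  -- 1 is used, and `hI` traces the latter back to r-exponent b + 1 - q < b. Both second terms carry
  -- a factor of the form p^(t_l), which is zero.
  by_cases hrf : β r.swap = piMax p t r.swap
  · have hbl : b ≠ piMax p (t + Pi.single r 1) r := by
      intro h
      apply hntop
      funext l
      by_cases h1 : l = r
      · subst h1
        omega
      · rw [hpi l h1]
        by_cases h2 : l = r.swap
        · subst h2
          exact hrf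
        · exact hfull l h1 h2
    rcases Nat.lt_or_ge b (q - 1) with hbq | hbq
    · refine hN β u (Adm.of_lt (fun l => ?_) hβ.2.1 r (by omega))
      by_cases hl : l = r
      · have : β r ≤ piMax p t r := by omega
        exact hl ▸ this
      · exact hpi l hl ▸ hβ.1 l
    have hval : (β - Pi.single j 1 + Pi.single r 1 : Y0 m → ℕ) r = b + 1 := by
      simp [hj1.symm, hb]
    refine mem_of_ham_single_add_single hS (i := j) (j := r.swap) hj2
      (fun h => e2 h.symm) (k := 0) (by omega) (hNe _ _ hj2) ?_ (by simpa using hcj) ?_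
    · rw [Sum.swap_swap, zero_add]
      have hadm : Adm p (t + Pi.single r 1) (β - Pi.single j 1 + Pi.single r 1) u := by
        refine Adm.of_lt (add_single_le hsub ?_) hβ.2.1 j ?_
        · simp [hj1.symm]
          omega
        · rw [hpi _ hj1]
          simp [hj1]
          omega
      refine hI _ _ hadm (by omega) j.swap e1 e2 ?_ ?_ ?_
      · simp [hj1]
        omega
      · intro δ w hδ hδr
        exact ih _ (by omega) δ w hδ hδr
      · intro _ _ h
        exfalso
        apply h
        have : (β - Pi.single j 1 + Pi.single r 1 : Y0 m → ℕ) j.swap = piMax p t j.swap := by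
          simp [swap_ne, e1, hj']
        rw [this]
        exact cast_piMax_add_one (ht _)
    · intro _ _ h
      exfalso
      rw [hrf] at h
      exact h (cast_piMax_add_one (ht _))
  · rcases Nat.lt_or_ge b q with hbq | hbq
    · refine hN β u (Adm.of_lt (fun l => ?_) hβ.2.1 r.swap (by omega))
      by_cases hl : l = r
      · have : β r ≤ piMax p t r := by omega
        exact hl ▸ this
      · exact hpi l hl ▸ hβ.1 l
    refine mem_of_ham_single_add_single hS (i := j) (j := r) hj1
      (fun h => hj2 (swap_eq_iff.1 h.symm)) (k := 0) (by omega) (hNe _ _ hj1) ?_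
      (by simpa using hcj) ?_
    · rw [zero_add]
      refine hII _ _ (Adm.of_lt (add_single_le hsub ?_) hβ.2.1 j ?_) ?_ ⟨j, hj1, hj2, ?_⟩
      · rw [hpi _ hrr]
        simp [hj2.symm]
        omega
      · rw [hpi _ hj1]
        simp [hj2]
        omega
      · simp [hj1.symm, hb, ne_swap]
      · simp [hj2]
        omega
    -- The second term has r-exponent b + 1 and the factor b + 1. If this factor is nonzero, p does
    -- not divide b + 1, hence neither does q, and when `hI` is applied to that term no further
    -- second term arises.
    · intro _ _ h
      rw [hb, Ne, CharP.cast_eq_zero_iff F p] at h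
      have hb1 : b + 1 ≠ p * q := fun h' => h (h' ▸ Dvd.intro _ rfl)
      have hval : (β - Pi.single j 1 - Pi.single j.swap 1 + Pi.single r 1 + Pi.single r.swap 1
          : Y0 m → ℕ) r = b + 1 := by
        simp [hj1.symm, hb, ne_swap, e1.symm]
      have hadm : Adm p (t + Pi.single r 1) (β - Pi.single j 1 - Pi.single j.swap 1
          + Pi.single r 1 + Pi.single r.swap 1) u := by
        refine Adm.of_lt (add_single_le (add_single_le (tsub_le_self.trans hsub) ?_) ?_)
          hβ.2.1 j ?_
        · simp [hj1.symm, e1.symm]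
          omega
        · rw [hpi _ hrr]
          simp [hj2.symm, e2.symm, hrr]
          omega
        · rw [hpi _ hj1]
          simp [hj1, hj2, ne_swap]
          omega
      refine hI _ _ hadm (by omega) j hj1 hj2 ?_ ?_ ?_
      · simp [e1, e2, swap_ne]
        omega
      · intro δ w hδ hδr
        exact ih _ (by omega) δ w hδ hδr
      · intro _ hd _
        exact absurd (hpq.trans (hval ▸ hd)) h

end

/-! ### Vector fields through their values on the variables, and coefficient functionals. -/

section
variable {F : Type*} [Field F] {m n : ℕ}

/-- The variables `x_i`, `i ∈ Y`. -/
noncomputable def gen (F : Type*) [Field F] {m n : ℕ} : Y m n → O F m n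
  | Sum.inl i => mono F (Pi.single i 1) ∅
  | Sum.inr a => mono F 0 {a}

lemma mul_one' (a : O F m n) : mul F a (mono F 0 ∅) = a := by
  have : (mul F).flip (mono F 0 ∅) = (LinearMap.id : O F m n →ₗ[F] O F m n) := by
    refine mono_ext fun α u => ?_
    simp [mul_mono, dpCoeff, wedgeCoeff, inversions]
  exact congrArg (fun f => f a) this

lemma pd_gen_self (i : Y m n) : pd F i (gen F i) = mono F 0 ∅ := by
  rcases i with i | a
  · simp [gen, pd_inl_mono]
  · simp [gen, pd_inr_mono, below, Finset.filter_singleton]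

lemma pd_gen_of_ne {i j : Y m n} (h : i ≠ j) : pd F i (gen F j) = 0 := by
  rcases i with i | a <;> rcases j with j | b
  · have : i ≠ j := fun h' => h (congrArg _ h')
    simp [gen, pd_inl_mono, this]
  · simp [gen, pd_inl_mono]
  · simp [gen, pd_inr_mono]
  · have : a ≠ b := fun h' => h (congrArg _ h')
    simp [gen, pd_inr_mono, this]

lemma vf_gen_self (i : Y m n) (g : O F m n) : vf F i g (gen F i) = g := by
  rw [vf_apply, pd_gen_self, mul_one']

lemma vf_gen_of_ne {i j : Y m n} (h : i ≠ j) (g : O F m n) : vf F i g (gen F j) = 0 := by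
  rw [vf_apply, pd_gen_of_ne h, map_zero]

/-- Since ∂_i(x_j) is 0 or 1, a vector field is determined by its values on the variables. Together
with `evenWitt_ext` this identifies the values of derivations. -/
lemma eq_sum_vf {p : ℕ} {t : Y0 m → ℕ} {D : Module.End F (O F m n)}
    (hD : D ∈ evenWittSpan F n p t) : D = ∑ i, vf F i (D (gen F i)) := by
  induction hD using Submodule.span_induction with
  | mem x hx =>
    obtain ⟨α, u, i, _, _, rfl⟩ := hx
    rw [Finset.sum_eq_single i]
    · rw [vf_gen_self]
    · intro j _ hj
      rw [vf_gen_of_ne hj.symm, map_zero]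
    · simp
  | zero => simp
  | add x y _ _ hx hy =>
    conv_lhs => rw [hx, hy]
    simp [Finset.sum_add_distrib]
  | smul c x _ hx =>
    conv_lhs => rw [hx]
    simp [Finset.smul_sum]

lemma evenWitt_ext {p : ℕ} {t : Y0 m → ℕ} {D E : Module.End F (O F m n)}
    (hD : D ∈ evenWittSpan F n p t) (hE : E ∈ evenWittSpan F n p t)
    (h0 : ∀ i : Y0 m, D (gen F (Sum.inl i)) = E (gen F (Sum.inl i)))
    (h1 : ∀ a : Fin n, D (gen F (Sum.inr a)) = E (gen F (Sum.inr a))) : D = E := by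
  rw [eq_sum_vf hD, eq_sum_vf hE]
  refine Finset.sum_congr rfl fun i _ => ?_
  rcases i with i | a
  · rw [h0]
  · rw [h1]

lemma apply_gen_mem {p : ℕ} {t : Y0 m → ℕ} {D : Module.End F (O F m n)}
    (hD : D ∈ evenWittSpan F n p t) (j : Y m n) : D (gen F j) ∈ truncPar F n p t (mu j) := by
  induction hD using Submodule.span_induction with
  | mem x hx =>
    obtain ⟨α, u, i, hα, hu, rfl⟩ := hx
    by_cases hij : i = j
    · subst hij
      rw [vf_gen_self, ← add_eq_zero_zmod2.1 hu]
      exact mono_mem_truncPar hα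
    · rw [vf_gen_of_ne hij]
      exact zero_mem _
  | zero => simp
  | add x y _ _ hx hy => exact add_mem hx hy
  | smul c x _ hx => exact Submodule.smul_mem _ c hx

lemma coef_ext {f g : O F m n} (h : ∀ α u, coef F α u f = coef F α u g) : f = g :=
  (monoBasis F m n).ext_elem fun a => h a.1 a.2

lemma coef_pd (i : Y0 m) (α : Y0 m → ℕ) (u : Finset (Fin n)) (f : O F m n) :
    coef F α u (pd F (Sum.inl i) f) = coef F (α + Pi.single i 1) u f := by
  have : (coef F α u).comp (pd F (Sum.inl i)) = coef F (α + Pi.single i 1) u := by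
    refine mono_ext fun β v => ?_
    rw [LinearMap.comp_apply, pd_inl_mono]
    by_cases h : β i = 0
    · rw [if_pos h, map_zero, coef_mono, if_neg]
      intro he
      have := congrFun (congrArg Prod.fst he) i
      simp [h] at this
    · rw [if_neg h, coef_mono, coef_mono]
      congr 1
      simp only [Prod.mk.injEq]
      have : β - Pi.single i 1 = α ↔ β = α + Pi.single i 1 := by
        constructor
        · rintro rfl
          rw [sub_single_add (by omega)]
        · rintro rfl
          simp
      rw [this]
  exact congrArg (fun g => g f) this

lemma coef_eq_zero_of_pd {f : O F m n} (h : ∀ i : Y0 m, pd F (Sum.inl i) f = 0)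
    {α : Y0 m → ℕ} (hα : α ≠ 0) (u : Finset (Fin n)) : coef F α u f = 0 := by
  obtain ⟨i, hi⟩ := Function.ne_iff.1 hα
  have h1 : 1 ≤ α i := Nat.one_le_iff_ne_zero.2 hi
  rw [← sub_single_add h1, ← coef_pd, h, map_zero]

lemma coef_mul_odd {b : Fin n} {v : Finset (Fin n)} (hb : b ∉ v) (α : Y0 m → ℕ) (g : O F m n) :
    coef F α (insert b v) (mul F (mono F 0 {b}) g) = (-1) ^ below v b * coef F α v g := by
  have : (coef F α (insert b v)).comp (mul F (mono F 0 {b})) = (-1 : F) ^ below v b • coef F α v := by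
    refine mono_ext fun β w => ?_
    rw [LinearMap.comp_apply, mul_odd_mono, LinearMap.smul_apply, coef_mono, smul_eq_mul]
    by_cases hw : b ∈ w
    · rw [if_pos hw, map_zero, if_neg, mul_zero]
      intro he
      exact hb ((Prod.mk.inj he).2 ▸ hw)
    · rw [if_neg hw, map_smul, coef_mono, smul_eq_mul]
      have : (β, insert b w) = (α, insert b v) ↔ (β, w) = (α, v) := by
        simp only [Prod.mk.injEq, and_congr_right_iff]
        intro _
        constructor
        · intro h
          rw [← Finset.erase_insert hw, h, Finset.erase_insert hb]
        · rintro rfl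
          rfl
      by_cases he : (β, w) = (α, v)
      · rw [if_pos he, if_pos (this.2 he), (Prod.mk.inj he).2]
      · rw [if_neg he, if_neg (fun h => he (this.1 h)), mul_zero, mul_zero]
  exact congrArg (fun f => f g) this

lemma coef_mul_odd_of_notMem {b : Fin n} {v : Finset (Fin n)} (hb : b ∉ v) (α : Y0 m → ℕ)
    (g : O F m n) : coef F α v (mul F (mono F 0 {b}) g) = 0 := by
  have : (coef F α v).comp (mul F (mono F 0 {b})) = 0 := by
    refine mono_ext fun β w => ?_
    rw [LinearMap.comp_apply, mul_odd_mono]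
    split_ifs
    · simp
    · rw [map_smul, coef_mono, if_neg, smul_zero, LinearMap.zero_apply]
      intro he
      exact hb ((Prod.mk.inj he).2 ▸ Finset.mem_insert_self b w)
  exact congrArg (fun f => f g) this

lemma coef_pd_inr {a : Fin n} {v : Finset (Fin n)} (ha : a ∉ v) (α : Y0 m → ℕ) (g : O F m n) :
    coef F α v (pd F (Sum.inr a) g) = (-1) ^ below v a * coef F α (insert a v) g := by
  have : (coef F α v).comp (pd F (Sum.inr a)) = (-1 : F) ^ below v a • coef F α (insert a v) := by
    refine mono_ext fun β w => ?_
    rw [LinearMap.comp_apply, pd_inr_mono, LinearMap.smul_apply, coef_mono, smul_eq_mul]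
    by_cases hw : a ∈ w
    · rw [if_pos hw, map_smul, coef_mono, smul_eq_mul]
      have : (β, w.erase a) = (α, v) ↔ (β, w) = (α, insert a v) := by
        simp only [Prod.mk.injEq, and_congr_right_iff]
        intro _
        constructor
        · intro h
          rw [← h, Finset.insert_erase hw]
        · rintro rfl
          rw [Finset.erase_insert ha]
      by_cases he : (β, w) = (α, insert a v)
      · rw [if_pos he, if_pos (this.2 he), ← (Prod.mk.inj (this.2 he)).2,
          below_erase_self]
      · rw [if_neg he, if_neg (fun h => he (this.1 h)), mul_zero, mul_zero]
    · rw [if_neg hw, map_zero, if_neg, mul_zero]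
      intro he
      exact hw ((Prod.mk.inj he).2 ▸ Finset.mem_insert_self a v)
  exact congrArg (fun f => f g) this

/-- The rotations `D_H(x_k x_l)` move `x_k` to `x_l`. -/
lemma coef_ham_pairMono {k l : Fin n} (hkl : k ≠ l) {v : Finset (Fin n)} (hk : k ∉ v) (hl : l ∉ v)
    (α : Y0 m → ℕ) (g : O F m n) :
    coef F α (insert l v) (ham F (pairMono F 0 k l) g)
      = (-1) ^ (below v l + below v k) * coef F α (insert k v) g := by
  rw [ham_pairMono_zero hkl, map_sub, coef_mul_odd hl, coef_pd_inr hk,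
    coef_mul_odd_of_notMem (b := k) (by simp [hkl, hk]), sub_zero, ← mul_assoc, pow_add]

/-- The rotation replaces x_k by x_l in such a monomial, and no other monomial contributes to the
result. So in a rotation-invariant element, a monomial that contains x_k also contains x_l. -/
lemma coef_eq_zero_of_ham_pairMono {k l : Fin n} (hkl : k ≠ l) {g : O F m n}
    (h : ham F (pairMono F 0 k l) g = 0) {v : Finset (Fin n)} (hv : k ∈ v) (hl : l ∉ v)
    (α : Y0 m → ℕ) : coef F α v g = 0 := by
  have h1 := coef_ham_pairMono hkl (v := v.erase k) (by simp) (by simp [hl]) α g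
  rw [h, map_zero, Finset.insert_erase hv] at h1
  exact (mul_eq_zero.1 h1.symm).resolve_left (pow_ne_zero _ (by simp))

lemma pairMono_swap {k l : Fin n} (hkl : k ≠ l) (α : Y0 m → ℕ) :
    pairMono F α l k = - pairMono F α k l := by
  rw [pairMono_eq hkl, pairMono_eq hkl.symm, Finset.pair_comm l k]
  rcases lt_or_gt_of_ne hkl with h | h
  · simp [h, not_lt.2 h.le]
  · simp [h, not_lt.2 h.le]

lemma card_of_coef_ne_zero {p : ℕ} {t : Y0 m → ℕ} {ε : ZMod 2} {f : O F m n}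
    (hf : f ∈ truncPar F n p t ε) {α : Y0 m → ℕ} {u : Finset (Fin n)} (h : coef F α u f ≠ 0) :
    (u.card : ZMod 2) = ε := by
  by_contra hne
  apply h
  refine truncPar_induction (q := fun f => coef F α u f = 0) ?_ ?_ ?_ ?_ hf
  · simp
  · intro a b ha hb
    simp [ha, hb]
  · intro c a ha
    simp [ha]
  · intro β v _ hv
    rw [coef_mono, if_neg]
    intro he
    exact hne ((Prod.mk.inj he).2 ▸ hv)

end

/-! ### Identities for the Poisson bracket and for powers of derivations. -/

section
variable {F : Type*} [Field F] {m n p : ℕ} {t : Y0 m → ℕ} {f g : O F m n}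

lemma mono_mem_nPot {β : Y0 m → ℕ} {u : Finset (Fin n)} (h : Adm p t β u) :
    mono F β u ∈ nPot F n p t := by
  refine Submodule.subset_span ⟨β, u, h.1, h.2.1, ?_, ?_, rfl⟩
  · intro he
    exact (h.2.2 (Prod.mk.inj he).1).1 (Prod.mk.inj he).2
  · intro he
    exact (h.2.2 (Prod.mk.inj he).1).2 (Prod.mk.inj he).2

lemma ham_antisymm (hf : f ∈ truncPar F n p t 0) (hg : g ∈ truncPar F n p t 0) :
    ham F f g = - ham F g f := by
  rw [ham_apply hf, ham_apply hg, ← Finset.sum_neg_distrib]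
  refine Fintype.sum_equiv (Function.Involutive.toPerm dual dual_involutive) _ _ fun i => ?_
  simp only [Function.Involutive.coe_toPerm, dual_dual]
  have e1 := pd_mem_of_even i hf
  have e2 := pd_mem_of_even (dual i) hg
  rw [mu_dual] at e2
  rw [mul_comm' e1 e2, tau_dual, smul_smul, neg_mul, neg_smul, neg_neg, mul_comm]

/-- No even variable occurs in x^ω, and ∂_r(x^ω) lacks only x_r, so a monomial x^(α) x^u contributes
only if u = {r}; evenness of f excludes that. This centrality of x^ω is what makes Φ and Θ
derivations. -/
lemma ham_xOmega (hf : f ∈ truncPar F n p t 0) : ham F f (xOmega F m n) = 0 := by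
  refine truncPar_induction (q := fun f => ham F f (xOmega F m n) = 0) ?_ ?_ ?_ ?_ hf
  · simp
  · intro a b ha hb
    simp [ha, hb]
  · intro c a ha
    simp [ha]
  · intro α u _ hu
    have hu' : Even u.card := ZMod.natCast_eq_zero_iff_even.1 hu
    rw [ham_mono_apply α hu', Finset.sum_eq_zero, Finset.sum_eq_zero, add_zero]
    · intro r _
      rw [xOmega, pd_inr_mono, pd_inr_mono, if_pos (Finset.mem_univ r)]
      split_ifs with h
      · rw [map_smul, map_smul, LinearMap.smul_apply, mul_mono, wedgeCoeff, if_neg]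
        · simp
        · intro hd
          have h1 : u = {r} := by
            refine Finset.eq_singleton_iff_unique_mem.2 ⟨h, fun x hx => ?_⟩
            by_contra hne
            exact Finset.disjoint_left.1 hd (Finset.mem_erase.2 ⟨hne, hx⟩) (by simp [hne])
          rw [h1] at hu'
          simp at hu'
      · simp
    · intro i _
      rw [xOmega, pd_inl_of_zero (i := i.swap) (by simp)]
      simp

lemma ham_gen (i : Y0 m) :
    ham F (mono F (Pi.single i 1) (∅ : Finset (Fin n))) = tau F (Sum.inl i : Y m n) • pd F (Sum.inl i.swap) :=
  LinearMap.ext fun g => ham_single_one i g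

lemma ham_mul {h : O F m n} (hf : f ∈ truncPar F n p t 0)
    (hg : g ∈ truncPar F n p t 0) :
    ham F f (mul F g h) = mul F (ham F f g) h + mul F g (ham F f h) := by
  rw [ham_apply hf, ham_apply hf, ham_apply hf]
  simp only [map_sum, LinearMap.sum_apply]
  rw [← Finset.sum_add_distrib]
  refine Finset.sum_congr rfl fun i _ => ?_
  rw [pd_mul, sgn_of_mem _ hg, ksign_zero_right, one_smul, map_add, smul_add]
  simp only [map_smul, LinearMap.smul_apply]
  rw [← mul_assoc', ← mul_assoc', ← mul_assoc', mul_comm' (pd_mem_of_even i hf) hg, ksign_zero_right,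
    one_smul]

lemma lie_ham_mul_comp (hf : f ∈ truncPar F n p t 0) (hg : g ∈ truncPar F n p t 0)
    (D : Module.End F (O F m n)) :
    ⁅ham F f, mul F g ∘ₗ D⁆ = mul F (ham F f g) ∘ₗ D + mul F g ∘ₗ ⁅ham F f, D⁆ := by
  refine LinearMap.ext fun h => ?_
  simp only [Ring.lie_def, LinearMap.sub_apply, Module.End.mul_apply, LinearMap.comp_apply,
    LinearMap.add_apply, ham_mul hf hg, map_sub]
  abel

lemma single_one_mem_truncPar [Fact p.Prime] (ht : ∀ i, 1 ≤ t i) (i : Y0 m) :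
    mono F (Pi.single i 1) (∅ : Finset (Fin n)) ∈ truncPar F n p t 0 := by
  have h := mono_mem_truncPar (F := F) (p := p) (t := t) (α := Pi.single i 1)
    (u := (∅ : Finset (Fin n))) (fun l => ?_)
  · simpa using h
  · by_cases hl : l = i
    · subst hl
      simpa using one_le_piMax (p := p) (ht l)
    · simp [hl]

instance : Nontrivial (O F m n) :=
  ⟨mono F 0 ∅, 0, fun h => by simpa [coef_mono] using congrArg (coef F 0 ∅) h⟩

/-- ad A is the difference of the commuting left and right multiplications by A, and p^s-th powers
are additive on commuting elements. -/
lemma ad_pow_char [Fact p.Prime] [CharP F p] (A B : Module.End F (O F m n)) (s : ℕ) :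
    (LieAlgebra.ad F (Module.End F (O F m n)) A ^ p ^ s) B = A ^ p ^ s * B - B * A ^ p ^ s := by
  have h : LieAlgebra.ad F (Module.End F (O F m n)) A
      = LinearMap.mulLeft F A - LinearMap.mulRight F A := by
    refine LinearMap.ext fun C => ?_
    simp [Ring.lie_def]
  have : CharP (Module.End F (Module.End F (O F m n))) p :=
    charP_of_injective_algebraMap (algebraMap F _).injective p
  rw [h, sub_pow_char_pow_of_commute _ _ (LinearMap.commute_mulLeft_right A A),
    LinearMap.pow_mulLeft, LinearMap.pow_mulRight]
  simp

end

/-! ### Derivations as maps on potentials; the exceptional derivations. -/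

section
variable {F : Type*} [Field F] {m n : ℕ} {p : ℕ} [Fact p.Prime] [CharP F p] {t : Y0 m → ℕ}

/-- A linear map from `𝔑` into `𝒲` that is a derivation. -/
def IsDer (δ : nAlg F n p t →ₗ[F] evenWitt F n p t) : Prop :=
  ∀ x y, δ ⁅x, y⁆ = ⁅x, δ y⁆ - ⁅y, δ x⁆

lemma IsDer.sub {δ ε : nAlg F n p t →ₗ[F] evenWitt F n p t} (h : IsDer δ) (h' : IsDer ε) :
    IsDer (δ - ε) := by
  intro x y
  simp only [LinearMap.sub_apply, h x y, h' x y, lie_sub]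
  abel

lemma IsDer.add {δ ε : nAlg F n p t →ₗ[F] evenWitt F n p t} (h : IsDer δ) (h' : IsDer ε) :
    IsDer (δ + ε) := by
  intro x y
  simp only [LinearMap.add_apply, h x y, h' x y, lie_add]
  abel

lemma IsDer.smul {δ : nAlg F n p t →ₗ[F] evenWitt F n p t} (c : F) (h : IsDer δ) :
    IsDer (c • δ) := by
  intro x y
  simp only [LinearMap.smul_apply, h x y, lie_smul, smul_sub]

/-- `δ(D_H(f)) = w`. -/
def Val (δ : nAlg F n p t →ₗ[F] evenWitt F n p t) (f : O F m n) (w : Module.End F (O F m n)) :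
    Prop := ∃ hf : f ∈ nPot F n p t, (δ (hamN F n p t ⟨f, hf⟩) : Module.End F (O F m n)) = w

variable {δ ε : nAlg F n p t →ₗ[F] evenWitt F n p t} {f g : O F m n}
  {w w' : Module.End F (O F m n)}

lemma Val.of_mem (δ : nAlg F n p t →ₗ[F] evenWitt F n p t) (hf : f ∈ nPot F n p t) :
    ∃ w, Val δ f w := ⟨_, hf, rfl⟩

lemma Val.mem_nPot (h : Val δ f w) : f ∈ nPot F n p t := h.1

lemma Val.mem_evenWittSpan (h : Val δ f w) : w ∈ evenWittSpan F n p t := by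
  obtain ⟨hf, rfl⟩ := h
  exact (δ (hamN F n p t ⟨f, hf⟩)).2

lemma Val.unique (h : Val δ f w) (h' : Val δ f w') : w = w' := by
  obtain ⟨_, rfl⟩ := h
  obtain ⟨_, rfl⟩ := h'
  rfl

lemma Val.smul (c : F) (h : Val δ f w) : Val δ (c • f) (c • w) := by
  obtain ⟨hf, rfl⟩ := h
  refine ⟨Submodule.smul_mem _ c hf, ?_⟩
  have : (⟨c • f, Submodule.smul_mem _ c hf⟩ : nPot F n p t) = c • ⟨f, hf⟩ := rfl
  rw [this, map_smul, map_smul]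
  rfl

lemma Val.sub (h : Val δ f w) (h' : Val ε f w') : Val (δ - ε) f (w - w') := by
  obtain ⟨hf, rfl⟩ := h
  obtain ⟨_, rfl⟩ := h'
  exact ⟨hf, rfl⟩

lemma Val.add (h : Val δ f w) (h' : Val ε f w') : Val (δ + ε) f (w + w') := by
  obtain ⟨hf, rfl⟩ := h
  obtain ⟨_, rfl⟩ := h'
  exact ⟨hf, rfl⟩

lemma Val.smul_left (c : F) (h : Val δ f w) : Val (c • δ) f (c • w) := by
  obtain ⟨hf, rfl⟩ := h
  exact ⟨hf, rfl⟩

lemma hamN_lie (hf : f ∈ nPot F n p t) (hg : g ∈ nPot F n p t) :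
    ⁅hamN F n p t ⟨f, hf⟩, hamN F n p t ⟨g, hg⟩⁆
      = hamN F n p t ⟨ham F f g, ham_apply_mem_nPot (nPot_le hf) (nPot_le hg)⟩ := by
  ext1
  ext1
  exact ham_lie (nPot_le hf) (nPot_le hg)

lemma Val.lie (hδ : IsDer δ) (h : Val δ f w) (h' : Val δ g w') :
    Val δ (ham F f g) (⁅ham F f, w'⁆ - ⁅ham F g, w⁆) := by
  obtain ⟨hf, rfl⟩ := h
  obtain ⟨hg, rfl⟩ := h'
  refine ⟨ham_apply_mem_nPot (nPot_le hf) (nPot_le hg), ?_⟩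
  rw [← hamN_lie hf hg, hδ]
  rfl

lemma isDer_of_val (V : O F m n → Module.End F (O F m n))
    (hV : ∀ f ∈ nPot F n p t, Val δ f (V f))
    (h : ∀ f ∈ nPot F n p t, ∀ g ∈ nPot F n p t,
      V (ham F f g) = ⁅ham F f, V g⁆ - ⁅ham F g, V f⁆) : IsDer δ := by
  intro x y
  obtain ⟨⟨f, hf⟩, rfl⟩ := hamN_surjective p t x
  obtain ⟨⟨g, hg⟩, rfl⟩ := hamN_surjective p t y
  rw [hamN_lie hf hg]
  ext1
  obtain ⟨_, h1⟩ := hV f hf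
  obtain ⟨_, h2⟩ := hV g hg
  obtain ⟨_, h3⟩ := hV _ (ham_apply_mem_nPot (nPot_le hf) (nPot_le hg))
  refine h3.trans ((h f hf g hg).trans ?_)
  rw [← h1, ← h2]
  rfl

/-- The `f` with `δ(D_H(f)) = 0`. -/
noncomputable def killed (δ : nAlg F n p t →ₗ[F] evenWitt F n p t) : Submodule F (O F m n) :=
  (LinearMap.ker (δ ∘ₗ hamN F n p t)).map (nPot F n p t).subtype

lemma mem_killed : f ∈ killed δ ↔ Val δ f 0 := by
  constructor
  · rintro ⟨⟨f, hf⟩, h, rfl⟩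
    refine ⟨hf, ?_⟩
    have h' : δ (hamN F n p t ⟨f, hf⟩) = 0 := h
    simp [h']
  · rintro ⟨hf, h⟩
    refine ⟨⟨f, hf⟩, ?_, rfl⟩
    have h' : δ (hamN F n p t ⟨f, hf⟩) = 0 := by
      ext1
      exact h
    exact h'

/-- The Leibniz rule. It turns the vanishing of δ into a question of generation under the Poisson
bracket. -/
lemma killed_bracket (hδ : IsDer δ) : ∀ f ∈ killed δ, ∀ g ∈ killed δ, ham F f g ∈ killed δ := by
  intro f hf g hg
  rw [mem_killed] at *
  simpa using Val.lie hδ hf hg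

lemma Val.lie_left (hδ : IsDer δ) (h : f ∈ killed δ) (h' : Val δ g w) :
    Val δ (ham F f g) ⁅ham F f, w⁆ := by
  simpa using Val.lie hδ (mem_killed.1 h) h'

lemma Val.lie_eq_zero (hδ : IsDer δ) (h : f ∈ killed δ) (h' : Val δ g w)
    (hfg : ham F f g ∈ killed δ) : ⁅ham F f, w⁆ = 0 :=
  (Val.lie_left hδ h h').unique (mem_killed.1 hfg)

lemma Val.lie_eq_smul (hδ : IsDer δ) (h : f ∈ killed δ) (h' : Val δ g w) {c : F}
    (hfg : ham F f g = c • g) : ⁅ham F f, w⁆ = c • w :=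
  (hfg ▸ Val.lie_left hδ h h').unique (h'.smul c)

lemma eq_zero_of_killed (h : ∀ β u, Adm p t β u → mono F β u ∈ killed δ) : δ = 0 := by
  have hle : nPot F n p t ≤ killed δ := by
    refine Submodule.span_le.2 ?_
    rintro _ ⟨α, u, h1, h2, h3, h4, rfl⟩
    refine h α u ⟨h1, h2, fun he => ⟨?_, ?_⟩⟩
    · rintro rfl
      exact h3 (by rw [he])
    · rintro rfl
      exact h4 (by rw [he])
  refine LinearMap.ext fun x => ?_
  obtain ⟨⟨f, hf⟩, rfl⟩ := hamN_surjective p t x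
  obtain ⟨_, h'⟩ := mem_killed.1 (hle hf)
  ext1
  exact h'

/-- ∂_i is a nonzero multiple of D_H(x_{i'}), so this is a case of `ham_lie`. -/
lemma lie_pd_ham (ht : ∀ i, 1 ≤ t i) (i : Y0 m) (hf : f ∈ truncPar F n p t 0) :
    ⁅pd F (Sum.inl i : Y m n), ham F f⁆ = ham F (pd F (Sum.inl i) f) := by
  have h := ham_lie (single_one_mem_truncPar (n := n) ht i.swap) hf
  rw [ham_single_one, ham_gen, Sum.swap_swap, smul_lie, map_smul] at h
  exact smul_right_injective _ (tau_ne_zero (n := n) i.swap) h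

lemma ad_pd_pow_ham (ht : ∀ i, 1 ≤ t i) (i : Y0 m) (hf : f ∈ truncPar F n p t 0) (k : ℕ) :
    (LieAlgebra.ad F (Module.End F (O F m n)) (pd F (Sum.inl i)) ^ k) (ham F f)
      = ham F ((pd F (Sum.inl i) ^ k) f) := by
  induction k with
  | zero => simp
  | succ k ih =>
    rw [pow_succ', Module.End.mul_apply, ih, LieAlgebra.ad_apply,
      lie_pd_ham ht i (pd_pow_mem i k hf), pow_succ', Module.End.mul_apply]

lemma lie_pd_pow_ham (ht : ∀ i, 1 ≤ t i) (i : Y0 m) (hf : f ∈ truncPar F n p t 0) (s : ℕ) :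
    ⁅pd F (Sum.inl i : Y m n) ^ p ^ s, ham F f⁆ = ham F ((pd F (Sum.inl i) ^ p ^ s) f) := by
  rw [← ad_pd_pow_ham ht i hf, ad_pow_char (p := p), Ring.lie_def]

lemma coe_ad_pow (D x : evenWitt F n p t) (k : ℕ) :
    (((LieAlgebra.ad F (evenWitt F n p t) D ^ k) x : evenWitt F n p t) : Module.End F (O F m n))
      = (LieAlgebra.ad F (Module.End F (O F m n)) D.1 ^ k) x.1 := by
  induction k with
  | zero => rfl
  | succ k ih =>
    rw [pow_succ', Module.End.mul_apply, pow_succ', Module.End.mul_apply, ← ih]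
    rfl

lemma val_adPowN (ht : ∀ i, 1 ≤ t i) (i : Y0 m) (k : ℕ) (hf : f ∈ nPot F n p t) :
    Val (adPowN (dW F n p t i) k) f (ham F ((pd F (Sum.inl i) ^ k) f)) := by
  refine ⟨hf, ?_⟩
  rw [← ad_pd_pow_ham ht i (nPot_le hf)]
  exact coe_ad_pow _ _ _

lemma val_Theta (ht : ∀ i, 1 ≤ t i) (hn : Even n) (i : Y0 m) (s : ℕ) (hf : f ∈ nPot F n p t) :
    Val (Theta F p t hn i s) f
      (mul F (xOmega F m n) ∘ₗ ham F ((pd F (Sum.inl i) ^ p ^ s) f)) := by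
  obtain ⟨_, h⟩ := val_adPowN ht i (p ^ s) hf
  refine ⟨hf, ?_⟩
  rw [← h]
  rfl

lemma val_Phi (hn : Even n) (i : Y0 m) (s : ℕ) (hf : f ∈ nPot F n p t) :
    Val (Phi F p t hn i s) f
      (mul F ((pd F (Sum.inl i) ^ p ^ s) f) ∘ₗ ham F (xOmega F m n)) :=
  ⟨hf, Phi_hamN p t hn i s ⟨f, hf⟩⟩

/-- In characteristic p the power ∂_i^(p^s) is again a derivation of the Poisson bracket; evaluate
[∂_i^(p^s), D_H(f)] at g. -/
lemma pd_pow_ham_apply (ht : ∀ i, 1 ≤ t i) (i : Y0 m) (s : ℕ) (hf : f ∈ truncPar F n p t 0)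
    (hg : g ∈ truncPar F n p t 0) :
    (pd F (Sum.inl i) ^ p ^ s) (ham F f g)
      = ham F f ((pd F (Sum.inl i) ^ p ^ s) g) - ham F g ((pd F (Sum.inl i) ^ p ^ s) f) := by
  have h := congrArg (fun D => D g) (lie_pd_pow_ham ht i hf s)
  simp only [Ring.lie_def, LinearMap.sub_apply, Module.End.mul_apply] at h
  rw [ham_antisymm (pd_pow_mem i _ hf) hg] at h
  rw [sub_eq_iff_eq_add] at h
  rw [h]
  abel

lemma isDer_adPowN (ht : ∀ i, 1 ≤ t i) (i : Y0 m) (s : ℕ) :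
    IsDer (adPowN (dW F n p t i) (p ^ s)) := by
  refine isDer_of_val (fun f => ham F ((pd F (Sum.inl i) ^ p ^ s) f))
    (fun f hf => val_adPowN ht i _ hf) fun f hf g hg => ?_
  rw [pd_pow_ham_apply ht i s (nPot_le hf) (nPot_le hg), map_sub,
    ham_lie (nPot_le hf) (pd_pow_mem i _ (nPot_le hg)),
    ham_lie (nPot_le hg) (pd_pow_mem i _ (nPot_le hf))]

/-- Every D_H(f) annihilates x^ω, hence commutes with multiplication by x^ω, and composing the
derivation (ad ∂_i)^(p^s) with that multiplication preserves the Leibniz rule. -/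
lemma isDer_Theta (ht : ∀ i, 1 ≤ t i) (hn : Even n) (i : Y0 m) (s : ℕ) :
    IsDer (Theta F p t hn i s) := by
  refine isDer_of_val (fun f => mul F (xOmega F m n) ∘ₗ ham F ((pd F (Sum.inl i) ^ p ^ s) f))
    (fun f hf => val_Theta ht hn i s hf) fun f hf g hg => ?_
  have hω := xOmega_mem (F := F) (p := p) t hn
  rw [pd_pow_ham_apply ht i s (nPot_le hf) (nPot_le hg), map_sub,
    lie_ham_mul_comp (nPot_le hf) hω, lie_ham_mul_comp (nPot_le hg) hω,
    ham_xOmega (nPot_le hf), ham_xOmega (nPot_le hg),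
    ham_lie (nPot_le hf) (pd_pow_mem i _ (nPot_le hg)),
    ham_lie (nPot_le hg) (pd_pow_mem i _ (nPot_le hf)), LinearMap.comp_sub]
  simp

/-- D_H(x^ω) commutes with every D_H(f), so D_H(f) acts only on the coefficient ∂_i^(p^s)(g), where
`pd_pow_ham_apply` is the Leibniz rule. -/
lemma isDer_Phi (ht : ∀ i, 1 ≤ t i) (hn : Even n) (i : Y0 m) (s : ℕ) :
    IsDer (Phi F p t hn i s) := by
  refine isDer_of_val
    (fun f => mul F ((pd F (Sum.inl i) ^ p ^ s) f) ∘ₗ ham F (xOmega F m n))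
    (fun f hf => val_Phi hn i s hf) fun f hf g hg => ?_
  have hω := xOmega_mem (F := F) (p := p) t hn
  rw [pd_pow_ham_apply ht i s (nPot_le hf) (nPot_le hg), map_sub,
    lie_ham_mul_comp (nPot_le hf) (pd_pow_mem i _ (nPot_le hg)),
    lie_ham_mul_comp (nPot_le hg) (pd_pow_mem i _ (nPot_le hf)),
    ham_lie (nPot_le hf) hω, ham_lie (nPot_le hg) hω, ham_xOmega (nPot_le hf),
    ham_xOmega (nPot_le hg), LinearMap.sub_comp]
  simp

lemma val_adN (D : evenWitt F n p t) (hf : f ∈ nPot F n p t) :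
    Val (adN D) f ⁅D.1, ham F f⁆ := by
  refine ⟨hf, ?_⟩
  simp only [adN, adPowN, pow_one]
  rfl

lemma isDer_adN (D : evenWitt F n p t) : IsDer (adN D : nAlg F n p t →ₗ[F] evenWitt F n p t) := by
  intro x y
  have h : ∀ z : nAlg F n p t, adN D z = ⁅D, (z : evenWitt F n p t)⁆ := by
    intro z
    simp only [adN, adPowN, pow_one]
    rfl
  rw [h, h, h]
  have h1 : ((⁅x, y⁆ : nAlg F n p t) : evenWitt F n p t)
      = ⁅(x : evenWitt F n p t), (y : evenWitt F n p t)⁆ := rfl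
  have h2 : ∀ (x : nAlg F n p t) (z : evenWitt F n p t), ⁅x, z⁆ = ⁅(x : evenWitt F n p t), z⁆ :=
    fun _ _ => rfl
  rw [h1, h2, h2, leibniz_lie]
  rw [← lie_skew (y : evenWitt F n p t) ⁅D, (x : evenWitt F n p t)⁆]
  abel

end

/-! ### Constraints on a value from translations, the torus and rotations. -/

section
variable {F : Type*} [Field F] {m n p : ℕ} {t : Y0 m → ℕ}

lemma evenWitt_apply_one {D : Module.End F (O F m n)} (hD : D ∈ evenWittSpan F n p t) :
    D (mono F 0 ∅) = 0 := by
  rw [eq_sum_vf hD, LinearMap.sum_apply]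
  refine Finset.sum_eq_zero fun i _ => ?_
  rw [vf_apply]
  rcases i with i | a
  · rw [pd_inl_of_zero rfl, map_zero]
  · rw [pd_inr_of_notMem (by simp), map_zero]

lemma ham_mono_empty_of_const {g : O F m n} (hg : ∀ l : Y0 m, pd F (Sum.inl l) g = 0)
    (α : Y0 m → ℕ) : ham F (mono F α ∅) g = 0 := by
  rw [ham_mono_empty]
  refine Finset.sum_eq_zero fun i _ => ?_
  rw [hg, map_zero, smul_zero]

lemma mul_single_pd (i : Y0 m) (β : Y0 m → ℕ) (u : Finset (Fin n)) :
    mul F (mono F (Pi.single i 1) ∅) (pd F (Sum.inl i) (mono F β u)) = (β i : F) • mono F β u := by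
  rw [pd_inl_mono]
  by_cases h : β i = 0
  · simp [h]
  · have h1 : 1 ≤ β i := by omega
    rw [if_neg h, mul_single_mono, sub_single_add h1, Pi.sub_apply, Pi.single_eq_same,
      Nat.sub_add_cancel h1, Nat.choose_one_right]

/-- The weights of the torus elements `D_H(x_i x_{i'})`. -/
lemma ham_torus (i : Y0 m) (β : Y0 m → ℕ) (u : Finset (Fin n)) :
    ham F (mono F (Pi.single i 1 + Pi.single i.swap 1) ∅) (mono F β u)
      = (tau F (Sum.inl i : Y m n) * ((β i.swap : F) - β i)) • mono F β u := by
  have h := ham_single_add_single (F := F) (n := n) (ne_swap i) 0 (mono F β u)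
  rw [zero_add, Sum.swap_swap, mul_single_pd, mul_single_pd, Pi.single_zero, map_smul,
    one_mul', tau_swap, smul_smul, smul_smul, ← add_smul] at h
  rw [h]
  congr 1
  ring

lemma ham_pairMono_gen_inl {k l : Fin n} (hkl : k ≠ l) (i : Y0 m) :
    ham F (pairMono F 0 k l) (gen F (Sum.inl i)) = 0 := by
  rw [ham_pairMono_zero hkl, pd_gen_of_ne (by simp), pd_gen_of_ne (by simp)]
  simp

lemma ham_pairMono_gen_left {k l : Fin n} (hkl : k ≠ l) :
    ham F (pairMono F 0 k l : O F m n) (gen F (Sum.inr k)) = gen F (Sum.inr l) := by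
  rw [ham_pairMono_zero hkl, pd_gen_self, pd_gen_of_ne (by simpa using hkl.symm), map_zero,
    sub_zero, mul_one']
  rfl

lemma ham_pairMono_gen_right {k l : Fin n} (hkl : k ≠ l) :
    ham F (pairMono F 0 k l : O F m n) (gen F (Sum.inr l)) = - gen F (Sum.inr k) := by
  rw [ham_pairMono_zero hkl, pd_gen_self, pd_gen_of_ne (by simpa using hkl), map_zero,
    zero_sub, mul_one']
  rfl

lemma ham_pairMono_gen_of_ne {k l c : Fin n} (hkl : k ≠ l) (hk : c ≠ k) (hl : c ≠ l) :
    ham F (pairMono F 0 k l : O F m n) (gen F (Sum.inr c)) = 0 := by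
  rw [ham_pairMono_zero hkl, pd_gen_of_ne (by simpa using hk.symm),
    pd_gen_of_ne (by simpa using hl.symm)]
  simp

lemma ham_pairMono_mono_empty {k l : Fin n} (hkl : k ≠ l) (β : Y0 m → ℕ) :
    ham F (pairMono F 0 k l : O F m n) (mono F β ∅) = 0 := by
  rw [ham_pairMono_zero hkl, pd_inr_of_notMem (by simp), pd_inr_of_notMem (by simp)]
  simp

lemma coef_pd_inr_of_mem {a : Fin n} {v : Finset (Fin n)} (ha : a ∈ v) (α : Y0 m → ℕ)
    (g : O F m n) : coef F α v (pd F (Sum.inr a) g) = 0 := by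
  have : (coef F α v).comp (pd F (Sum.inr a)) = 0 := by
    refine mono_ext fun β w => ?_
    rw [LinearMap.comp_apply, pd_inr_mono]
    split_ifs
    · rw [map_smul, coef_mono, if_neg, smul_zero, LinearMap.zero_apply]
      intro he
      exact Finset.notMem_erase a w ((Prod.mk.inj he).2 ▸ ha)
    · simp
  exact congrArg (fun f => f g) this

lemma coef_univ_mul_pd {a b : Fin n} (hab : a ≠ b) (α : Y0 m → ℕ) (g : O F m n) :
    coef F α Finset.univ (mul F (mono F 0 {b}) (pd F (Sum.inr a) g)) = 0 := by
  rw [← Finset.insert_erase (Finset.mem_univ b), coef_mul_odd (by simp),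
    coef_pd_inr_of_mem (by simp [hab]), mul_zero]

lemma coef_univ_ham_pairMono {k l : Fin n} (hkl : k ≠ l) (α : Y0 m → ℕ) (g : O F m n) :
    coef F α Finset.univ (ham F (pairMono F 0 k l) g) = 0 := by
  rw [ham_pairMono_zero hkl, map_sub, coef_univ_mul_pd hkl, coef_univ_mul_pd hkl.symm, sub_zero]

variable [Fact p.Prime] [CharP F p] {δ : nAlg F n p t →ₗ[F] evenWitt F n p t} {f : O F m n}
  {w : Module.End F (O F m n)}

/-- ∂_l comes from the killed potential x_{l'}, so [∂_l, w] is a multiple of the value at ∂_l f,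
which is zero; and w annihilates the constant ∂_l(x_j). The components of w thus contain no even
variables. -/
lemma Val.pd_apply_gen (hδ : IsDer δ) (h1 : ∀ i, mono F (Pi.single i 1) ∅ ∈ killed δ)
    (hw : Val δ f w) (hf : ∀ l : Y0 m, pd F (Sum.inl l) f ∈ killed δ) (l : Y0 m) (j : Y m n) :
    pd F (Sum.inl l) (w (gen F j)) = 0 := by
  have h := Val.lie_eq_zero hδ (h1 l.swap) hw (by
    rw [ham_single_one, Sum.swap_swap]
    exact Submodule.smul_mem _ _ (hf l))
  rw [ham_gen, Sum.swap_swap, smul_lie] at h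
  have h2 := (smul_eq_zero.1 h).resolve_left (tau_ne_zero l.swap)
  have h3 := congrArg (fun D => D (gen F j)) h2
  simp only [Ring.lie_def, LinearMap.sub_apply, Module.End.mul_apply, LinearMap.zero_apply] at h3
  rw [sub_eq_zero.1 h3]
  by_cases hj : Sum.inl l = j
  · subst hj
    rw [pd_gen_self, evenWitt_apply_one hw.mem_evenWittSpan]
  · rw [pd_gen_of_ne hj, map_zero]

/-- The field w has the same weight under D_H(x_i x_{i'}) as the potential. Its component w(x_l) has
weight zero, being free of even variables, so this weight must cancel that of x_l wherever w(x_l) is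
nonzero. -/
lemma Val.weight_inl (hδ : IsDer δ)
    (h11 : ∀ i : Y0 m, mono F (Pi.single i 1 + Pi.single i.swap 1) ∅ ∈ killed δ)
    {β : Y0 m → ℕ} {u : Finset (Fin n)} (hw : Val δ (mono F β u) w)
    (hc : ∀ (l : Y0 m) (j : Y m n), pd F (Sum.inl l) (w (gen F j)) = 0) (i l : Y0 m) :
    ((β i.swap : F) - β i + (if i.swap = l then 1 else 0) - (if i = l then 1 else 0)) •
      w (gen F (Sum.inl l)) = 0 := by
  have h := congrArg (fun D => D (gen F (Sum.inl l)))
    (Val.lie_eq_smul hδ (h11 i) hw (ham_torus i β u))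
  simp only [Ring.lie_def, LinearMap.sub_apply, Module.End.mul_apply, LinearMap.smul_apply] at h
  rw [ham_mono_empty_of_const (fun l' => hc l' _), gen, ham_torus, map_smul, zero_sub,
    ← sub_eq_zero, ← neg_smul, ← sub_smul] at h
  have ht := tau_ne_zero (F := F) (n := n) i
  rw [← smul_eq_zero_iff_right ht, smul_smul]
  refine Eq.trans ?_ ((congrArg (fun x => -x) h).trans neg_zero)
  rw [← neg_smul]
  congr 1
  simp only [Pi.single_apply]
  by_cases e1 : i = l <;> by_cases e2 : i.swap = l <;> simp [e1, e2] <;> ring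

/-- As for even variables, except that x_a has weight zero. -/
lemma Val.weight_inr (hδ : IsDer δ)
    (h11 : ∀ i : Y0 m, mono F (Pi.single i 1 + Pi.single i.swap 1) ∅ ∈ killed δ)
    {β : Y0 m → ℕ} {u : Finset (Fin n)} (hw : Val δ (mono F β u) w)
    (hc : ∀ (l : Y0 m) (j : Y m n), pd F (Sum.inl l) (w (gen F j)) = 0) (i : Y0 m) (a : Fin n) :
    ((β i.swap : F) - β i) • w (gen F (Sum.inr a)) = 0 := by
  have h := congrArg (fun D => D (gen F (Sum.inr a)))
    (Val.lie_eq_smul hδ (h11 i) hw (ham_torus i β u))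
  simp only [Ring.lie_def, LinearMap.sub_apply, Module.End.mul_apply, LinearMap.smul_apply] at h
  rw [ham_mono_empty_of_const (fun l' => hc l' _), gen, ham_torus] at h
  simp only [Pi.zero_apply, Nat.cast_zero, sub_zero, mul_zero, zero_smul, map_zero] at h
  rw [mul_smul] at h
  exact (smul_eq_zero.1 h.symm).resolve_left (tau_ne_zero i)

/-- A rotation whose bracket with the potential is killed commutes with w; w is then equivariant on
the variables. -/
lemma Val.ham_pairMono_apply_gen (hδ : IsDer δ) {k l : Fin n}
    (ho : pairMono F 0 k l ∈ killed δ) (hw : Val δ f w)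
    (hf : ham F (pairMono F 0 k l) f ∈ killed δ) (j : Y m n) :
    ham F (pairMono F 0 k l) (w (gen F j)) = w (ham F (pairMono F 0 k l) (gen F j)) := by
  have h := congrArg (fun D => D (gen F j)) (Val.lie_eq_zero hδ ho hw hf)
  simp only [Ring.lie_def, LinearMap.sub_apply, Module.End.mul_apply, LinearMap.zero_apply] at h
  exact sub_eq_zero.1 h

end

/-! ### Elements of low degree: the cubes and the orbit of x_i x_a x_b. -/

section
variable {F : Type*} [Field F] {m n p : ℕ} {t : Y0 m → ℕ}

/-- The subspace contains all monomials of degree at most `2` with an even number of odd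
variables. -/
structure ContainsLow (S : Submodule F (O F m n)) : Prop where
  one : mono F 0 ∅ ∈ S
  lin : ∀ i, mono F (Pi.single i 1) ∅ ∈ S
  sq : ∀ i, mono F (Pi.single i 2) ∅ ∈ S
  mixed : ∀ i j, i ≠ j → mono F (Pi.single i 1 + Pi.single j 1) ∅ ∈ S
  odd : ∀ a b : Fin n, a ≠ b → mono F 0 {a, b} ∈ S

lemma single_le_piMax {i : Y0 m} {k : ℕ} (h : k ≤ piMax p t i) : Pi.single i k ≤ piMax p t := by
  intro l
  by_cases hl : l = i
  · subst hl
    simpa using h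
  · simp [hl]

lemma lt_piMax [Fact p.Prime] (hp : 3 < p) (ht : ∀ i, 1 ≤ t i) (i : Y0 m) : 3 < piMax p t i := by
  have h1 := piMax_add_one (Fact.out : p.Prime).pos t i
  have h2 : p ^ 1 ≤ p ^ t i := Nat.pow_le_pow_right (Fact.out : p.Prime).pos (ht i)
  have h3 : p ≠ 4 := by
    intro h
    have := (Fact.out : p.Prime)
    rw [h] at this
    revert this
    decide
  rw [pow_one] at h2
  omega

lemma cast_ne_zero_of_lt_five [Fact p.Prime] [CharP F p] (hp : 3 < p) {a : ℕ} (h0 : a ≠ 0)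
    (h : a < 5) : (a : F) ≠ 0 := by
  have h3 : p ≠ 4 := by
    intro h
    have := (Fact.out : p.Prime)
    rw [h] at this
    revert this
    decide
  exact cast_ne_zero_of_lt (p := p) h0 (by omega)

lemma mem_of_ham_pairMono_zero_exchange {S : Submodule F (O F m n)}
    (hS : ∀ f ∈ S, ∀ g ∈ S, ham F f g ∈ S)
    {β : Y0 m → ℕ} {u : Finset (Fin n)} {a b : Fin n} (ha : a ∉ u) (hb : b ∈ u)
    (h1 : mono F 0 {a, b} ∈ S) (h2 : mono F β (insert a (u.erase b)) ∈ S) : mono F β u ∈ S := by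
  have hab : a ≠ b := fun h => ha (h ▸ hb)
  rw [← pairMono_mem hab] at h1
  have h := hS _ h1 _ h2
  have e : (insert a (u.erase b)).erase a = u.erase b := by
    rw [Finset.erase_insert]
    simp [ha]
  rw [ham_pairMono_zero hab, pd_inr_of_notMem (r := b) (by simp [hab.symm]), pd_inr_mono,
    if_pos (by simp), e, map_smul, mul_odd_mono, if_neg (by simp), Finset.insert_erase hb,
    map_zero, sub_zero, smul_smul, Submodule.smul_mem_iff] at h
  · exact h
  · simp

/-- Any two pairs are linked by replacing one element at a time. -/
lemma forall_pair_of_exchange {P : Finset (Fin n) → Prop}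
    (hP : ∀ x y z, x ≠ y → x ≠ z → y ≠ z → P {x, y} → P {x, z}) {a₀ b₀ : Fin n} (h0 : a₀ ≠ b₀)
    (h : P {a₀, b₀}) (a b : Fin n) (hab : a ≠ b) : P {a, b} := by
  by_cases ha : a = a₀
  · subst ha
    by_cases hb : b = b₀
    · rwa [hb]
    · exact hP a b₀ b h0 hab (Ne.symm hb) h
  by_cases ha' : a = b₀
  · subst ha'
    rw [Finset.pair_comm] at h
    by_cases hb : b = a₀
    · rwa [hb]
    · exact hP a a₀ b h0.symm hab (Ne.symm hb) h
  rw [Finset.pair_comm] at h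
  have h' := hP b₀ a₀ a h0.symm (Ne.symm ha') (Ne.symm ha) h
  rw [Finset.pair_comm] at h'
  by_cases hb : b = b₀
  · rwa [hb]
  · exact hP a b₀ b ha' hab (Ne.symm hb) h'

/-- The elements `x_i x_a x_b` form a single orbit. -/
lemma single_pair_mem_of_one {S : Submodule F (O F m n)}
    (hS : ∀ f ∈ S, ∀ g ∈ S, ham F f g ∈ S) (hL : ContainsLow S) {i₀ : Y0 m} {a₀ b₀ : Fin n}
    (h0 : a₀ ≠ b₀) (h : mono F (Pi.single i₀ 1) {a₀, b₀} ∈ S) (i : Y0 m) (a b : Fin n)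
    (hab : a ≠ b) : mono F (Pi.single i 1) {a, b} ∈ S := by
  have hi : mono F (Pi.single i 1) {a₀, b₀} ∈ S := by
    by_cases h1 : i = i₀
    · rwa [h1]
    by_cases h2 : i = i₀.swap
    · refine mem_of_ham_single hS (i := i) (k := 1) (by simp) (hL.sq i) ?_ (by simp)
      have e : i.swap = i₀ := swap_eq_iff.2 h2
      rw [e, tsub_self, zero_add]
      exact h
    · refine mem_of_ham_single_add_single hS (i := i) (j := i₀.swap) h2
        (fun h' => h1 (Sum.swap_leftInverse.injective h').symm) (k := 0) (by simp)
        (hL.mixed _ _ h2) ?_ (by simp) ?_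
      · rw [zero_add, tsub_self, zero_add, Sum.swap_swap]
        exact h
      · intro h'
        simp [swap_ne] at h'
  refine forall_pair_of_exchange (P := fun u => mono F (Pi.single i 1) u ∈ S) ?_ h0 hi a b hab
  intro x y z hxy hxz hyz hx
  refine mem_of_ham_pairMono_zero_exchange hS (a := y) (b := z) (by simp [hxy.symm, hyz]) (by simp)
    (hL.odd y z hyz) ?_
  have e : insert y (({x, z} : Finset (Fin n)).erase z) = {x, y} := by
    ext c
    simp only [Finset.mem_insert, Finset.mem_erase, Finset.mem_singleton]
    constructor
    · rintro (rfl | ⟨h1, rfl | rfl⟩)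
      · simp
      · simp
      · exact absurd rfl h1
    · rintro (rfl | rfl)
      · simp [hxz]
      · simp
  rw [e]
  exact hx

variable [Fact p.Prime] [CharP F p] {δ : nAlg F n p t →ₗ[F] evenWitt F n p t} {f : O F m n}
  {w : Module.End F (O F m n)}

/-- Under the torus element of the pair {i, i'} the relevant weights are -4 at x_i, -2 at x_{i'} and
-3 at all other variables, odd ones included. None is zero modulo a prime p > 3. -/
lemma cube_mem_killed (hp : 3 < p) (ht : ∀ i, 1 ≤ t i) (hδ : IsDer δ)
    (hL : ContainsLow (killed δ)) (i : Y0 m) : mono F (Pi.single i 3) ∅ ∈ killed δ := by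
  have hi := lt_piMax hp ht i
  have hadm : Adm p t (Pi.single i 3) (∅ : Finset (Fin n)) :=
    Adm.of_lt (single_le_piMax hi.le) (by simp) i (by simpa using hi)
  obtain ⟨w, hw⟩ := Val.of_mem δ (mono_mem_nPot (F := F) hadm)
  have hc := hw.pd_apply_gen hδ hL.lin (fun l => by
    by_cases hl : l = i
    · subst hl
      have := pd_inl_add_single (F := F) l (Pi.single l 2) (∅ : Finset (Fin n))
      rw [← Pi.single_add] at this
      rw [this]
      exact hL.sq l
    · rw [pd_inl_of_zero (by simp [hl])]
      exact zero_mem _)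
  have h11 : ∀ i : Y0 m, mono F (Pi.single i 1 + Pi.single i.swap 1) ∅ ∈ killed δ :=
    fun i => hL.mixed _ _ (ne_swap i)
  have c2 := cast_ne_zero_of_lt_five (F := F) (p := p) hp (a := 2) (by norm_num) (by norm_num)
  have c3 := cast_ne_zero_of_lt_five (F := F) (p := p) hp (a := 3) (by norm_num) (by norm_num)
  have c4 := cast_ne_zero_of_lt_five (F := F) (p := p) hp (a := 4) (by norm_num) (by norm_num)
  push_cast at c2 c3 c4
  have hz : w = 0 := by
    refine evenWitt_ext hw.mem_evenWittSpan (zero_mem _) (fun l => ?_) (fun a => ?_)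
    · refine (smul_eq_zero.1 (hw.weight_inl hδ h11 hc i l)).resolve_left ?_
      rw [Pi.single_eq_same, Pi.single_eq_of_ne (swap_ne i)]
      by_cases e1 : i = l
      · have e2 : i.swap ≠ l := fun h => swap_ne i (h.trans e1.symm)
        rw [if_neg e2, if_pos e1]
        intro h
        push_cast at h
        exact c4 (by linear_combination -h)
      · by_cases e2 : i.swap = l
        · rw [if_pos e2, if_neg e1]
          intro h
          push_cast at h
          exact c2 (by linear_combination -h)
        · rw [if_neg e2, if_neg e1]
          intro h
          push_cast at h
          exact c3 (by linear_combination -h)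
    · refine (smul_eq_zero.1 (hw.weight_inr hδ h11 hc i a)).resolve_left ?_
      rw [Pi.single_eq_same, Pi.single_eq_of_ne (swap_ne i)]
      intro h
      push_cast at h
      exact c3 (by linear_combination -h)
  rw [mem_killed, ← hz]
  exact hw

/-- The potential has weight -1 for the pair {i, i'}, up to τ(i); only the component at x_{i'}
balances it. -/
lemma Val.eq_vf (hδ : IsDer δ) (hp : 3 < p)
    (h11 : ∀ i : Y0 m, mono F (Pi.single i 1 + Pi.single i.swap 1) ∅ ∈ killed δ)
    {β : Y0 m → ℕ} {u : Finset (Fin n)} (hw : Val δ (mono F β u) w)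
    (hc : ∀ (l : Y0 m) (j : Y m n), pd F (Sum.inl l) (w (gen F j)) = 0) {i : Y0 m}
    (hi : β i = 1) (hi' : β i.swap = 0) :
    w = vf F (Sum.inl i.swap) (w (gen F (Sum.inl i.swap))) := by
  have c2 := cast_ne_zero_of_lt_five (F := F) (p := p) hp (a := 2) (by norm_num) (by norm_num)
  push_cast at c2
  have hinl : ∀ l : Y0 m, l ≠ i.swap → w (gen F (Sum.inl l)) = 0 := by
    intro l hl
    refine (smul_eq_zero.1 (hw.weight_inl hδ h11 hc i l)).resolve_left ?_
    rw [hi, hi', if_neg hl.symm]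
    split_ifs
    · intro h
      push_cast at h
      exact c2 (by linear_combination -h)
    · simp
  have hinr : ∀ a : Fin n, w (gen F (Sum.inr a)) = 0 := by
    intro a
    refine (smul_eq_zero.1 (hw.weight_inr hδ h11 hc i a)).resolve_left ?_
    rw [hi, hi']
    simp
  conv_lhs => rw [eq_sum_vf hw.mem_evenWittSpan]
  rw [Finset.sum_eq_single (Sum.inl i.swap)]
  · rintro (l | a) _ hne
    · rw [hinl l (fun h => hne (by rw [h])), map_zero]
    · rw [hinr, map_zero]
  · simp

end

/-! ### The value at x_i x_a x_b. -/

section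
variable {F : Type*} [Field F] {m n p : ℕ} {t : Y0 m → ℕ}

lemma ham_single_pairMono_one {a b : Fin n} (hab : a ≠ b) (i : Y0 m) (g : O F m n) :
    ham F (pairMono F (Pi.single i 1) a b) g
      = tau F (Sum.inl i : Y m n) • mul F (pairMono F 0 a b) (pd F (Sum.inl i.swap) g)
        + mul F (mono F (Pi.single i 1) ∅) (ham F (pairMono F 0 a b) g) := by
  have h := ham_single_pairMono hab i 0 g
  rwa [zero_add, Pi.single_zero, one_mul'] at h

lemma ham_single_pairMono_gen_left {a b : Fin n} (hab : a ≠ b) (i : Y0 m) :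
    ham F (pairMono F (Pi.single i 1) a b) (gen F (Sum.inr a)) = mono F (Pi.single i 1) {b} := by
  rw [ham_single_pairMono_one hab, pd_gen_of_ne (by simp), map_zero, smul_zero, zero_add,
    ham_pairMono_gen_left hab, gen, ← mono_eq_mul]

lemma ham_single_pairMono_gen_right {a b : Fin n} (hab : a ≠ b) (i : Y0 m) :
    ham F (pairMono F (Pi.single i 1) a b) (gen F (Sum.inr b))
      = - mono F (Pi.single i 1) {a} := by
  rw [ham_single_pairMono_one hab, pd_gen_of_ne (by simp), map_zero, smul_zero, zero_add,
    ham_pairMono_gen_right hab, map_neg, gen, ← mono_eq_mul]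

lemma ham_single_pairMono_gen_of_ne {a b c : Fin n} (hab : a ≠ b) (ha : c ≠ a) (hb : c ≠ b)
    (i : Y0 m) : ham F (pairMono F (Pi.single i 1) a b) (gen F (Sum.inr c)) = 0 := by
  rw [ham_single_pairMono_one hab, pd_gen_of_ne (by simp), map_zero, smul_zero, zero_add,
    ham_pairMono_gen_of_ne hab ha hb, map_zero]

lemma ham_single_pairMono_gen_inl {a b : Fin n} (hab : a ≠ b) (i l : Y0 m) :
    ham F (pairMono F (Pi.single i 1) a b) (gen F (Sum.inl l))
      = if l = i.swap then tau F (Sum.inl i : Y m n) • pairMono F 0 a b else 0 := by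
  rw [ham_single_pairMono_one hab, ham_pairMono_gen_inl hab, map_zero, add_zero]
  split_ifs with h
  · rw [h, pd_gen_self, mul_one']
  · rw [pd_gen_of_ne (by simpa using Ne.symm h), map_zero, smul_zero]

lemma ham_sq_mul_mono (i : Y0 m) (u : Finset (Fin n)) :
    ham F (mono F (Pi.single i.swap 2) ∅) (mono F (Pi.single i 1) u)
      = tau F (Sum.inl i.swap : Y m n) • mono F (Pi.single i.swap 1) u := by
  have h := ham_single (F := F) i.swap 1 (mono F (Pi.single i 1) u)
  have h2 := pd_inl_add_single (F := F) i 0 u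
  rw [zero_add] at h2
  rw [Sum.swap_swap, h2, ← mono_eq_mul] at h
  exact h

lemma ham_single_pairMono_swap {a b : Fin n} (hab : a ≠ b) (i : Y0 m) :
    ham F (pairMono F (Pi.single i 1) a b) (pairMono F (Pi.single i.swap 1) a b) = 0 := by
  have h2 := pd_inl_pairMono_add (F := F) hab i.swap (0 : Y0 m → ℕ)
  rw [zero_add] at h2
  rw [ham_single_pairMono_one hab, h2, ham_pairMono_zero hab, pd_inr_pairMono_left hab,
    pd_inr_pairMono_right hab, map_neg, mul_odd_mono, mul_odd_mono, if_pos (by simp),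
    if_pos (by simp)]
  have : mul F (pairMono F 0 a b) (pairMono F 0 a b) = (0 : O F m n) := by
    conv_lhs => rw [pairMono_eq hab 0]
    have hd : wedgeCoeff ({a, b} : Finset (Fin n)) {a, b} = 0 := by
      rw [wedgeCoeff, if_neg]
      simp
    simp only [map_smul, LinearMap.smul_apply, mul_mono, hd, Int.cast_zero, mul_zero, zero_smul,
      smul_zero]
  simp [this]

/-- The infinitesimal rotation in the plane of `x_k` and `x_a`, applied twice. -/
lemma ham_pairMono_sq {a b k : Fin n} (hab : a ≠ b) (hka : k ≠ a) (hkb : k ≠ b) (i : Y0 m) :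
    ham F (pairMono F 0 k a) (ham F (pairMono F 0 k a) (pairMono F (Pi.single i 1) a b))
      = - pairMono F (Pi.single i 1) a b := by
  have key : ∀ c d : Fin n, mul F (mono F 0 {c}) (mono F (Pi.single i 1) {d})
      = pairMono F (Pi.single i 1) c d := by
    intro c d
    rw [pairMono, mul_mono, mul_mono, dpCoeff_comm, add_comm]
  have h1 : ham F (pairMono F 0 k a) (pairMono F (Pi.single i 1) a b)
      = - pairMono F (Pi.single i 1) k b := by
    rw [ham_pairMono_zero hka, pd_inr_pairMono_left hab, pd_inr_pairMono_of_ne hab hka hkb,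
      key k b, map_zero, zero_sub]
  rw [h1, map_neg, ham_pairMono_zero hka, pd_inr_pairMono_left hkb,
    pd_inr_pairMono_of_ne hkb hka.symm hab, key a b, map_zero, sub_zero]

variable [Fact p.Prime] [CharP F p] {δ : nAlg F n p t →ₗ[F] evenWitt F n p t} {f : O F m n}
  {w : Module.End F (O F m n)}

/-- Bracketing with x_{i'}^(2) turns x_i x_a x_b into a multiple of x_{i'} x_a x_b and determines
the value there. The two elements commute because odd variables square to zero, so the Leibniz rule
gives a relation between the two values; at x_a it says that 2 g x_b = 0 up to sign. -/
lemma mul_eq_zero_of_val_pairMono (hp : 3 < p) (hδ : IsDer δ) (hL : ContainsLow (killed δ))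
    {a b : Fin n} (hab : a ≠ b) {i : Y0 m} {g : O F m n}
    (hw : Val δ (pairMono F (Pi.single i 1) a b) (vf F (Sum.inl i.swap) g)) :
    mul F g (mono F 0 {b}) = 0 := by
  have c2 := cast_ne_zero_of_lt_five (F := F) (p := p) hp (a := 2) (by norm_num) (by norm_num)
  push_cast at c2
  have hv := Val.lie_left hδ (hL.sq i.swap) hw
  have e : ham F (mono F (Pi.single i.swap 2) ∅) (pairMono F (Pi.single i 1) a b)
      = tau F (Sum.inl i.swap : Y m n) • pairMono F (Pi.single i.swap 1) a b := by
    rw [pairMono_eq hab, pairMono_eq hab, map_smul, ham_sq_mul_mono, smul_comm]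
  rw [e] at hv
  have h0 := Val.lie hδ hw hv
  rw [map_smul, ham_single_pairMono_swap hab, smul_zero] at h0
  have hz := h0.unique (mem_killed.1 (zero_mem (killed δ)))
  have h1 := congrArg (fun D => D (gen F (Sum.inr a))) hz
  have hpd : pd F (Sum.inl i.swap) (mono F (Pi.single i 1) ({b} : Finset (Fin n))) = 0 :=
    pd_inl_of_zero (by simp [swap_ne]) _
  have hpd2 : pd F (Sum.inl i.swap) (mono F (Pi.single i.swap 1) ({b} : Finset (Fin n)))
      = mono F 0 {b} := by
    have := pd_inl_add_single (F := F) i.swap 0 ({b} : Finset (Fin n))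
    rwa [zero_add] at this
  have hs : ham F (mono F (Pi.single i.swap 2) ∅) (gen F (Sum.inr a) : O F m n) = 0 := by
    rw [ham_mono_empty_of_const]
    intro l
    rw [pd_gen_of_ne (by simp)]
  simp only [Ring.lie_def, LinearMap.sub_apply, Module.End.mul_apply, LinearMap.zero_apply,
    map_smul, LinearMap.smul_apply, ham_single_pairMono_gen_left hab, vf_apply,
    pd_gen_of_ne (show (Sum.inl i.swap : Y m n) ≠ Sum.inr a by simp), map_zero, sub_zero,
    ham_sq_mul_mono, hpd, hpd2, hs, zero_sub, sub_neg_eq_add, zero_add] at h1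
  rw [← two_smul F, smul_smul] at h1
  exact (smul_eq_zero.1 h1).resolve_left (mul_ne_zero c2 (tau_ne_zero _))

/-- Weights reduce the value to g ∂_{i'} with g free of even variables. From g x_a = g x_b = 0 every
monomial of g contains x_a x_b, and the rotations of the other odd variables leave only x_a x_b and
x^ω. -/
lemma val_single_pairMono (hp : 3 < p) (ht : ∀ i, 1 ≤ t i) (hδ : IsDer δ)
    (hL : ContainsLow (killed δ)) (hn : 3 < n) {a b : Fin n} (hab : a ≠ b) (i : Y0 m) :
    ∃ c : F, Val δ (pairMono F (Pi.single i 1) a b)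
      (c • vf F (Sum.inl i.swap) (pairMono F 0 a b)) := by
  have hcard : ({a, b} : Finset (Fin n)).card = 2 := Finset.card_pair hab
  have hi := lt_piMax hp ht i
  have hadm : Adm p t (Pi.single i 1) ({a, b} : Finset (Fin n)) :=
    Adm.of_lt (single_le_piMax (by omega)) (by simp [hcard]) i (by simp; omega)
  obtain ⟨w₀, hw₀⟩ := Val.of_mem δ (mono_mem_nPot (F := F) hadm)
  have hc₀ := hw₀.pd_apply_gen hδ hL.lin (fun l => by
    by_cases hl : l = i
    · subst hl
      have := pd_inl_add_single (F := F) l 0 ({a, b} : Finset (Fin n))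
      rw [zero_add] at this
      rw [this]
      exact hL.odd a b hab
    · rw [pd_inl_of_zero (by simp [hl])]
      exact zero_mem _)
  have hvf₀ := hw₀.eq_vf hδ hp (fun i => hL.mixed _ _ (ne_swap i)) hc₀ (i := i) (by simp)
    (by simp [swap_ne])
  obtain ⟨g, hg, hwg, hconst⟩ : ∃ g ∈ truncPar F n p t 0,
      Val δ (pairMono F (Pi.single i 1) a b) (vf F (Sum.inl i.swap) g) ∧
      ∀ l : Y0 m, pd F (Sum.inl l) g = 0 := by
    have hm := apply_gen_mem hw₀.mem_evenWittSpan (Sum.inl i.swap : Y m n)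
    refine ⟨(if a < b then (1 : F) else -1) • w₀ (gen F (Sum.inl i.swap)),
      Submodule.smul_mem _ _ hm, ?_, fun l => ?_⟩
    · rw [map_smul, ← hvf₀, pairMono_eq hab]
      exact hw₀.smul _
    · rw [map_smul, hc₀, smul_zero]
  have hodd : ∀ k l : Fin n, k ≠ l → pairMono F 0 k l ∈ killed δ :=
    fun k l hkl => (pairMono_mem hkl).2 (hL.odd k l hkl)
  have hcomm : ∀ c : Fin n, mul F g (mono F 0 {c}) = 0 → mul F (mono F 0 {c}) g = 0 := by
    intro c h
    have hc := mono_mem_truncPar (F := F) (p := p) (t := t) (α := 0) (u := ({c} : Finset (Fin n)))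
      (fun i => Nat.zero_le _)
    rw [mul_comm' hc hg, ksign_zero_right, h, smul_zero]
  have hb : ∀ v, b ∉ v → ∀ α, coef F α v g = 0 := by
    intro v hv α
    have h := coef_mul_odd hv α g
    rw [hcomm b (mul_eq_zero_of_val_pairMono hp hδ hL hab hwg), map_zero] at h
    exact (mul_eq_zero.1 h.symm).resolve_left (pow_ne_zero _ (by simp))
  have ha : ∀ v, a ∉ v → ∀ α, coef F α v g = 0 := by
    intro v hv α
    have hwg' : Val δ (pairMono F (Pi.single i 1) b a) (vf F (Sum.inl i.swap) (-g)) := by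
      have := hwg.smul (-1)
      rwa [neg_one_smul, neg_one_smul, ← pairMono_swap hab, ← map_neg] at this
    have h1 := mul_eq_zero_of_val_pairMono hp hδ hL hab.symm hwg'
    rw [map_neg, LinearMap.neg_apply, neg_eq_zero] at h1
    have h := coef_mul_odd hv α g
    rw [hcomm a h1, map_zero] at h
    exact (mul_eq_zero.1 h.symm).resolve_left (pow_ne_zero _ (by simp))
  have happ : vf F (Sum.inl i.swap) g (gen F (Sum.inl i.swap)) = g := vf_gen_self _ _
  have hso : ∀ k l : Fin n, k ≠ l → k ≠ a → k ≠ b → l ≠ a → l ≠ b →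
      ham F (pairMono F 0 k l) g = 0 := by
    intro k l hkl hka hkb hla hlb
    have h := hwg.ham_pairMono_apply_gen hδ (hodd k l hkl) (by
      rw [ham_pairMono_zero hkl, pd_inr_pairMono_of_ne hab hka hkb,
        pd_inr_pairMono_of_ne hab hla hlb]
      simp) (Sum.inl i.swap)
    rwa [happ, ham_pairMono_gen_inl hkl, map_zero] at h
  -- The rotation in the plane of x_k and x_a squares to -1 on x_i x_a x_b, hence on g, whereas no
  -- rotation ever produces a term containing x^ω.
  have huniv : ∀ α, coef F α Finset.univ g = 0 := by
    intro α
    obtain ⟨k, hk⟩ : ∃ k, k ∉ ({a, b} : Finset (Fin n)) := by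
      by_contra hcon
      push Not at hcon
      have := Finset.eq_univ_iff_forall.2 hcon
      rw [this, Finset.card_fin] at hcard
      omega
    simp only [Finset.mem_insert, Finset.mem_singleton, not_or] at hk
    have h1 := Val.lie_left hδ (hodd k a hk.1) (Val.lie_left hδ (hodd k a hk.1) hwg)
    rw [ham_pairMono_sq hab hk.1 hk.2] at h1
    have h2 := hwg.smul (-1)
    rw [neg_one_smul] at h2
    have h3 := congrArg (fun D => D (gen F (Sum.inl i.swap))) (h1.unique h2)
    simp only [Ring.lie_def, LinearMap.sub_apply, Module.End.mul_apply, LinearMap.smul_apply,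
      ham_pairMono_gen_inl hk.1, map_zero, sub_zero, happ] at h3
    have h4 := congrArg (coef F α Finset.univ) h3
    rw [coef_univ_ham_pairMono hk.1, map_smul] at h4
    simpa using h4.symm
  -- By `ha` and `hb` a monomial of g contains x_a and x_b; by `hso` a further x_k forces all odd
  -- variables, and `huniv` excludes x^ω.
  have hgc : g = coef F 0 {a, b} g • mono F 0 {a, b} := by
    refine coef_ext fun α v => ?_
    rw [map_smul, coef_mono, smul_eq_mul]
    by_cases he : (0, {a, b}) = (α, v)
    · rw [if_pos he, mul_one, (Prod.mk.inj he).1, (Prod.mk.inj he).2]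
    rw [if_neg he, mul_zero]
    by_cases hα : α = 0
    · subst hα
      by_cases hav : a ∈ v
      · by_cases hbv : b ∈ v
        · have hne : v ≠ {a, b} := fun h => he (by rw [h])
          by_cases hvu : v = Finset.univ
          · rw [hvu]
            exact huniv 0
          obtain ⟨l, hl⟩ : ∃ l, l ∉ v := by
            by_contra hcon
            push Not at hcon
            exact hvu (Finset.eq_univ_iff_forall.2 hcon)
          obtain ⟨k, hk, hk'⟩ : ∃ k ∈ v, k ∉ ({a, b} : Finset (Fin n)) := by
            by_contra hcon
            push Not at hcon
            refine hne (Finset.Subset.antisymm hcon ?_)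
            intro x hx
            simp only [Finset.mem_insert, Finset.mem_singleton] at hx
            rcases hx with rfl | rfl
            · exact hav
            · exact hbv
          simp only [Finset.mem_insert, Finset.mem_singleton, not_or] at hk'
          have hkl : k ≠ l := fun h => hl (h ▸ hk)
          exact coef_eq_zero_of_ham_pairMono hkl (hso k l hkl hk'.1 hk'.2
            (fun h => hl (h ▸ hav)) (fun h => hl (h ▸ hbv))) hk hl 0
        · exact hb v hbv 0
      · exact ha v hav 0
    · exact coef_eq_zero_of_pd hconst hα v
  refine ⟨coef F 0 {a, b} g * (if a < b then (1 : F) else -1), ?_⟩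
  have e : (coef F 0 {a, b} g * (if a < b then (1 : F) else -1)) •
      vf F (Sum.inl i.swap) (pairMono F 0 a b) = vf F (Sum.inl i.swap) g := by
    rw [pairMono_eq hab 0, map_smul, smul_smul, ← map_smul]
    congr 1
    conv_rhs => rw [hgc]
    congr 1
    split_ifs <;> simp
  rw [e]
  exact hwg

end

/-! ### The derivation ad Γ' and vanishing in height one. -/

section
variable {F : Type*} [Field F] {m n p : ℕ} {t : Y0 m → ℕ}

lemma pairMono_mem_truncPar {α : Y0 m → ℕ} (hα : α ≤ piMax p t) {a b : Fin n} (hab : a ≠ b) :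
    pairMono F α a b ∈ truncPar F n p t 0 := by
  rw [pairMono_eq hab]
  refine Submodule.smul_mem _ _ ?_
  have h := mono_mem_truncPar (F := F) (u := ({a, b} : Finset (Fin n))) hα
  rw [Finset.card_pair hab] at h
  exact h

end

section
variable {F : Type*} [Field F] {m n p : ℕ} [Fact p.Prime] [CharP F p] {t : Y0 m → ℕ}

lemma gammaPrime_mono (β : Y0 m → ℕ) (u : Finset (Fin n)) :
    (gammaPrime F n p t).1 (mono F β u) = (u.card : F) • mono F β u := by
  have h : ∀ r : Fin n, vf F (Sum.inr r) (mono F 0 {r}) (mono F β u)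
      = if r ∈ u then mono F β u else 0 := by
    intro r
    rw [vf_apply, pd_inr_mono]
    split_ifs with hr
    · rw [map_smul, mul_odd_mono, if_neg (by simp), Finset.insert_erase hr, below_erase_self,
        smul_smul, ← pow_add, ← two_mul, pow_mul]
      simp
    · simp
  simp only [gammaPrime, LinearMap.sum_apply, h]
  rw [Finset.sum_ite_mem, Finset.univ_inter, Finset.sum_const, Nat.cast_smul_eq_nsmul]

lemma gammaPrime_gen_inl (i : Y0 m) : (gammaPrime F n p t).1 (gen F (Sum.inl i)) = 0 := by
  rw [gen, gammaPrime_mono]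
  simp

lemma gammaPrime_gen_inr (a : Fin n) :
    (gammaPrime F n p t).1 (gen F (Sum.inr a)) = gen F (Sum.inr a) := by
  rw [gen, gammaPrime_mono]
  simp

/-- Γ' multiplies a monomial by its number of odd variables, and D_H(x^(α)) preserves that number.
-/
lemma lie_gammaPrime_ham_mono_empty (α : Y0 m → ℕ) :
    ⁅(gammaPrime F n p t).1, ham F (mono F α (∅ : Finset (Fin n)))⁆ = 0 := by
  refine mono_ext fun β u => ?_
  simp only [Ring.lie_def, LinearMap.sub_apply, Module.End.mul_apply, LinearMap.zero_apply]
  rw [gammaPrime_mono, map_smul, ham_mono_empty, map_sum, Finset.smul_sum, sub_eq_zero]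
  refine Finset.sum_congr rfl fun i _ => ?_
  rw [pd_inl_mono, pd_inl_mono]
  split_ifs
  · simp
  · simp
  · simp
  · rw [mul_mono, map_smul, map_smul, gammaPrime_mono, Finset.empty_union]
    simp only [smul_smul]
    congr 1
    ring

lemma gammaPrime_mul_pd (a b : Fin n) (β : Y0 m → ℕ) (u : Finset (Fin n)) :
    (gammaPrime F n p t).1 (mul F (mono F 0 {b}) (pd F (Sum.inr a) (mono F β u)))
      = (u.card : F) • mul F (mono F 0 {b}) (pd F (Sum.inr a) (mono F β u)) := by
  rw [pd_inr_mono]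
  split_ifs with ha
  · rw [map_smul, mul_odd_mono]
    split_ifs with hb
    · simp
    · rw [map_smul, map_smul, gammaPrime_mono, Finset.card_insert_of_notMem hb,
        Finset.card_erase_add_one ha]
      simp only [smul_smul]
      congr 1
      ring
  · simp

lemma lie_gammaPrime_ham_pairMono_zero {a b : Fin n} (hab : a ≠ b) :
    ⁅(gammaPrime F n p t).1, ham F (pairMono F (0 : Y0 m → ℕ) a b)⁆ = 0 := by
  refine mono_ext fun β u => ?_
  simp only [Ring.lie_def, LinearMap.sub_apply, Module.End.mul_apply, LinearMap.zero_apply]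
  rw [gammaPrime_mono, map_smul, ham_pairMono_zero hab, map_sub, gammaPrime_mul_pd,
    gammaPrime_mul_pd, smul_sub, sub_self]

/-- In D_H(x_i x_a x_b) only the component along ∂_{i'} changes the number of odd variables, and it
raises it by two. So ad Γ' takes, at this element, exactly the form found in `val_single_pairMono`.
-/
lemma lie_gammaPrime_ham_single_pairMono (ht : ∀ i, 1 ≤ t i) {a b : Fin n} (hab : a ≠ b)
    (i : Y0 m) :
    ⁅(gammaPrime F n p t).1, ham F (pairMono F (Pi.single i 1) a b)⁆
      = (2 * tau F (Sum.inl i : Y m n)) • vf F (Sum.inl i.swap) (pairMono F 0 a b) := by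
  have h0 : pairMono F 0 a b ∈ truncPar F n p t 0 :=
    pairMono_mem_truncPar (fun l => Nat.zero_le _) hab
  refine evenWitt_ext (p := p) (t := t) (evenWitt_lie_mem (gammaPrime F n p t).2
    (ham_mem (pairMono_mem_truncPar (single_le_piMax (one_le_piMax (ht i))) hab)))
    (Submodule.smul_mem _ _ (vf_mem h0)) (fun l => ?_) (fun c => ?_)
  · simp only [Ring.lie_def, LinearMap.sub_apply, Module.End.mul_apply, LinearMap.smul_apply,
      gammaPrime_gen_inl, map_zero, sub_zero]
    rw [ham_single_pairMono_gen_inl hab]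
    split_ifs with hl
    · rw [hl, vf_gen_self, map_smul, pairMono_eq hab, map_smul, gammaPrime_mono,
        Finset.card_pair hab]
      simp only [smul_smul]
      congr 1
      push_cast
      ring
    · rw [vf_gen_of_ne (by simpa using Ne.symm hl)]
      simp
  · simp only [Ring.lie_def, LinearMap.sub_apply, Module.End.mul_apply, LinearMap.smul_apply,
      gammaPrime_gen_inr]
    rw [vf_gen_of_ne (by simp), smul_zero]
    by_cases hca : c = a
    · rw [hca, ham_single_pairMono_gen_left hab, gammaPrime_mono]
      simp
    · by_cases hcb : c = b
      · rw [hcb, ham_single_pairMono_gen_right hab, map_neg, gammaPrime_mono]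
        simp
      · rw [ham_single_pairMono_gen_of_ne hab hca hcb]
        simp

variable {δ ε : nAlg F n p t →ₗ[F] evenWitt F n p t} {f : O F m n}

lemma killed_sub (h : f ∈ killed δ) (h' : f ∈ killed ε) : f ∈ killed (δ - ε) := by
  rw [mem_killed] at *
  simpa using h.sub h'

lemma killed_add (h : f ∈ killed δ) (h' : f ∈ killed ε) : f ∈ killed (δ + ε) := by
  rw [mem_killed] at *
  simpa using h.add h'

lemma killed_smul (c : F) (h : f ∈ killed δ) : f ∈ killed (c • δ) := by
  rw [mem_killed] at *
  simpa using h.smul_left c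

lemma mono_empty_mem_killed_gammaPrime {α : Y0 m → ℕ} (h : mono F α ∅ ∈ killed δ) :
    mono F α ∅ ∈ killed (adN (gammaPrime F n p t)) := by
  rw [mem_killed, ← lie_gammaPrime_ham_mono_empty (p := p) (t := t) α]
  exact val_adN _ (mem_killed.1 h).mem_nPot

lemma ContainsLow.sub_gammaPrime (hL : ContainsLow (killed δ)) (c : F) :
    ContainsLow (killed (δ - c • adN (gammaPrime F n p t))) where
  one := killed_sub hL.one (killed_smul c (mono_empty_mem_killed_gammaPrime hL.one))
  lin i := killed_sub (hL.lin i) (killed_smul c (mono_empty_mem_killed_gammaPrime (hL.lin i)))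
  sq i := killed_sub (hL.sq i) (killed_smul c (mono_empty_mem_killed_gammaPrime (hL.sq i)))
  mixed i j hij := killed_sub (hL.mixed i j hij)
    (killed_smul c (mono_empty_mem_killed_gammaPrime (hL.mixed i j hij)))
  odd a b hab := by
    refine killed_sub (hL.odd a b hab) (killed_smul c ?_)
    rw [← pairMono_mem hab, mem_killed, ← lie_gammaPrime_ham_pairMono_zero (p := p) (t := t) hab]
    exact val_adN _ (mem_killed.1 ((pairMono_mem hab).2 (hL.odd a b hab))).mem_nPot

/-- Up to a multiple of `ad Γ'`, a derivation that vanishes in degrees at most `0` vanishes on all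
monomials of height `1`. -/
theorem exists_sub_gammaPrime (hp : 3 < p) (ht : ∀ i, 1 ≤ t i) (hm : 1 < m) (hn : 3 < n)
    (hδ : IsDer δ) (hL : ContainsLow (killed δ)) :
    ∃ c : F, ∀ β u, Adm p 1 β u → mono F β u ∈ killed (δ - c • adN (gammaPrime F n p t)) := by
  let i : Y0 m := Sum.inl ⟨0, by omega⟩
  let a : Fin n := ⟨0, by omega⟩
  let b : Fin n := ⟨1, by omega⟩
  have hab : a ≠ b := by simp [a, b]
  obtain ⟨c, hc⟩ := val_single_pairMono hp ht hδ hL hn hab i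
  have c2 := cast_ne_zero_of_lt_five (F := F) (p := p) hp (a := 2) (by norm_num) (by norm_num)
  push_cast at c2
  have hτ := tau_ne_zero (F := F) (n := n) i
  -- The scalar that cancels the value at this one triple i, a, b; the others follow because they
  -- form a single orbit under degree zero.
  refine ⟨c / (2 * tau F (Sum.inl i : Y m n)), ?_⟩
  set d := c / (2 * tau F (Sum.inl i : Y m n)) with hd
  have hδ' : IsDer (δ - d • adN (gammaPrime F n p t)) := hδ.sub ((isDer_adN _).smul d)
  have hL' := hL.sub_gammaPrime d
  have hf : pairMono F (Pi.single i 1) a b ∈ killed (δ - d • adN (gammaPrime F n p t)) := by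
    have h := hc.sub ((val_adN (gammaPrime F n p t) hc.mem_nPot).smul_left d)
    rw [lie_gammaPrime_ham_single_pairMono ht hab, smul_smul, hd,
      div_mul_cancel₀ _ (mul_ne_zero c2 hτ), sub_self] at h
    exact mem_killed.2 h
  have hS := killed_bracket hδ'
  exact mono_mem_of_low_degree hp (by omega) hS hL'.one hL'.lin hL'.sq hL'.mixed hL'.odd
    (cube_mem_killed hp ht hδ' hL')
    (single_pair_mem_of_one hS hL' hab ((pairMono_mem hab).1 hf))

end

/-! ### Rotation invariants in the odd variables. -/

section
variable {F : Type*} [Field F] {m n p : ℕ} {t : Y0 m → ℕ}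

lemma pd_pow_mono (i : Y0 m) (k : ℕ) (β : Y0 m → ℕ) (u : Finset (Fin n)) :
    (pd F (Sum.inl i) ^ k) (mono F β u)
      = if k ≤ β i then mono F (β - Pi.single i k) u else 0 := by
  induction k with
  | zero => simp
  | succ k ih =>
    rw [pow_succ', Module.End.mul_apply, ih]
    by_cases h : k + 1 ≤ β i
    · rw [if_pos (by omega), if_pos h, pd_inl_mono, if_neg (by simp; omega), tsub_tsub,
        ← Pi.single_add]
    · rw [if_neg h]
      split_ifs with h'
      · rw [pd_inl_of_zero]
        simp
        omega
      · simp

/-- The rotation-invariant odd fields in the odd variables. -/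
lemma exists_coeff_of_rotation (hn : 3 < n) {y : Fin n → O F m n}
    (hy : ∀ c, y c ∈ truncPar F n p t 1) (hconst : ∀ c (l : Y0 m), pd F (Sum.inl l) (y c) = 0)
    (h0 : ∀ k l c, k ≠ l → c ≠ k → c ≠ l → ham F (pairMono F 0 k l) (y c) = 0)
    (h1 : ∀ k l, k ≠ l → ham F (pairMono F 0 k l) (y k) = y l) :
    ∃ A B : F, (Odd n → B = 0) ∧
      ∀ c, y c = A • gen F (Sum.inr c) + B • pd F (Sum.inr c) (xOmega F m n) := by
  -- A monomial of y_c with some x_k, k ≠ c, contains every x_l with l ≠ c, by the rotations fixing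
  -- x_c. It is not x^ω, as y_c is itself the rotation of y_k; and the constant monomial has the
  -- wrong parity.
  have hvan : ∀ c v, v ≠ {c} → v ≠ Finset.univ.erase c → coef F 0 v (y c) = 0 := by
    intro c v hv1 hv2
    by_contra hne
    have hpar := card_of_coef_ne_zero (hy c) hne
    by_cases hk : ∃ k ∈ v, k ≠ c
    · obtain ⟨k, hkv, hkc⟩ := hk
      by_cases hl : ∃ l ∉ v, l ≠ c
      · obtain ⟨l, hlv, hlc⟩ := hl
        have hkl : k ≠ l := fun h => hlv (h ▸ hkv)
        exact hne (coef_eq_zero_of_ham_pairMono hkl (h0 k l c hkl hkc.symm hlc.symm) hkv hlv 0)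
      · push Not at hl
        by_cases hcv : c ∈ v
        · have huniv : v = Finset.univ := by
            refine Finset.eq_univ_iff_forall.2 fun x => ?_
            by_contra hx
            exact hx (hl x hx ▸ hcv)
          have h2 := coef_univ_ham_pairMono hkc (0 : Y0 m → ℕ) (y k)
          rw [h1 k c hkc, ← huniv] at h2
          exact hne h2
        · refine hv2 ?_
          ext x
          simp only [Finset.mem_erase, Finset.mem_univ, and_true]
          constructor
          · rintro hx rfl
            exact hcv hx
          · intro hx
            by_contra hxv
            exact hx (hl x hxv)
    · push Not at hk
      by_cases hcv : c ∈ v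
      · exact hv1 (Finset.eq_singleton_iff_unique_mem.2 ⟨hcv, hk⟩)
      · have : v = ∅ := by
          refine Finset.eq_empty_iff_forall_notMem.2 fun x hx => ?_
          exact hcv (hk x hx ▸ hx)
        rw [this] at hpar
        simp at hpar
  have hA : ∀ k l, k ≠ l → coef F 0 {k} (y k) = coef F 0 {l} (y l) := by
    intro k l hkl
    have h := coef_ham_pairMono hkl (v := ∅) (by simp) (by simp) (0 : Y0 m → ℕ) (y k)
    rw [h1 k l hkl] at h
    simpa [below] using h.symm
  have hB : ∀ k l, k ≠ l →
      (-1 : F) ^ below Finset.univ k * coef F 0 (Finset.univ.erase k) (y k)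
        = (-1) ^ below Finset.univ l * coef F 0 (Finset.univ.erase l) (y l) := by
    intro k l hkl
    set v := (Finset.univ.erase k).erase l with hv
    have hk : k ∉ v := by simp [hv]
    have hl : l ∉ v := by simp [hv]
    have e1 : insert l v = Finset.univ.erase k := Finset.insert_erase (by simp [hkl.symm])
    have e2 : insert k v = Finset.univ.erase l := by
      rw [hv, Finset.erase_right_comm]
      exact Finset.insert_erase (by simp [hkl])
    have e3 : (Finset.univ : Finset (Fin n)) = {k, l} ∪ v := by
      ext x
      by_cases hx : x = k <;> by_cases hx' : x = l <;> simp [hv, hx, hx']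
    have hd : Disjoint ({k, l} : Finset (Fin n)) v := by
      simp [Finset.disjoint_left, hk, hl]
    have h := coef_ham_pairMono hkl.symm hl hk (0 : Y0 m → ℕ) (y k)
    rw [pairMono_swap hkl, map_neg, LinearMap.neg_apply, h1 k l hkl, map_neg, e1, e2] at h
    -- Compared with counting inside v, exactly one of k and l has the other below it, hence the
    -- minus sign.
    have hs : (-1 : F) ^ below Finset.univ k * (-1) ^ below Finset.univ l
        = - (-1) ^ (below v k + below v l) := by
      rw [e3, below_union hd, below_union hd, (below_pair hkl).1, (below_pair hkl).2, pow_add,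
        pow_add, pow_add]
      split_ifs <;> ring
    have hsq : ∀ j : ℕ, (-1 : F) ^ j * (-1) ^ j = 1 := by
      intro j
      rw [← pow_add, ← two_mul, pow_mul]
      simp
    have q1 := hsq (below Finset.univ l)
    linear_combination ((-1) ^ below Finset.univ l) * h
      - (-1 : F) ^ below Finset.univ k * coef F 0 (Finset.univ.erase k) (y k) * q1
      + (-1 : F) ^ below Finset.univ l * coef F 0 (Finset.univ.erase k) (y k) * hs
  have hn0 : 0 < n := by omega
  let c₀ : Fin n := ⟨0, hn0⟩
  refine ⟨coef F 0 {c₀} (y c₀),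
    (-1 : F) ^ below Finset.univ c₀ * coef F 0 (Finset.univ.erase c₀) (y c₀), ?_, ?_⟩
  · intro hodd
    by_contra hne
    have hpar := card_of_coef_ne_zero (hy c₀) (right_ne_zero_of_mul hne)
    rw [ZMod.natCast_eq_one_iff_odd, Finset.card_erase_of_mem (Finset.mem_univ _),
      Finset.card_fin] at hpar
    rw [Nat.odd_iff] at hodd hpar
    omega
  · intro c
    have eA : coef F 0 {c₀} (y c₀) = coef F 0 {c} (y c) := by
      by_cases h : c₀ = c
      · rw [h]
      · exact hA _ _ h
    have eB : (-1 : F) ^ below Finset.univ c₀ * coef F 0 (Finset.univ.erase c₀) (y c₀)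
        = (-1) ^ below Finset.univ c * coef F 0 (Finset.univ.erase c) (y c) := by
      by_cases h : c₀ = c
      · rw [h]
      · exact hB _ _ h
    have hne : ({c} : Finset (Fin n)) ≠ Finset.univ.erase c := by
      intro h
      have := Finset.mem_singleton_self c
      rw [h] at this
      simp at this
    rw [eA, eB, gen, xOmega, pd_inr_mono, if_pos (Finset.mem_univ c), smul_smul]
    have hsq : (-1 : F) ^ below Finset.univ c * coef F 0 (Finset.univ.erase c) (y c)
        * (-1) ^ below Finset.univ c = coef F 0 (Finset.univ.erase c) (y c) := by
      rw [mul_right_comm, ← pow_add, ← two_mul, pow_mul]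
      simp
    rw [hsq]
    refine coef_ext fun α v => ?_
    rw [map_add, map_smul, map_smul, coef_mono, coef_mono, smul_eq_mul, smul_eq_mul]
    by_cases hα : α = 0
    · subst hα
      by_cases h1 : v = {c}
      · subst h1
        rw [if_pos rfl, if_neg (by simpa using hne.symm)]
        simp
      · by_cases h2 : v = Finset.univ.erase c
        · subst h2
          rw [if_neg (by simpa using hne), if_pos rfl]
          simp
        · rw [hvan c v h1 h2, if_neg (by simpa using Ne.symm h1),
            if_neg (by simpa using Ne.symm h2)]
          simp
    · rw [coef_eq_zero_of_pd (hconst c) hα, if_neg (by simp [Ne.symm hα]),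
        if_neg (by simp [Ne.symm hα])]
      simp

/-- The rotation-invariant even elements without even variables. -/
lemma exists_coeff_of_rotation_even {g : O F m n} (hg : g ∈ truncPar F n p t 0)
    (hn : 0 < n)
    (hconst : ∀ l : Y0 m, pd F (Sum.inl l) g = 0)
    (h0 : ∀ k l, k ≠ l → ham F (pairMono F 0 k l) g = 0) :
    ∃ A B : F, (Odd n → B = 0) ∧ g = A • mono F 0 ∅ + B • xOmega F m n := by
  have hne : (∅ : Finset (Fin n)) ≠ Finset.univ := by
    intro h
    have := congrArg Finset.card h
    simp at this
    omega
  refine ⟨coef F 0 ∅ g, coef F 0 Finset.univ g, ?_, ?_⟩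
  · intro hodd
    by_contra hc
    have hpar := card_of_coef_ne_zero hg hc
    rw [ZMod.natCast_eq_zero_iff_even, Finset.card_fin] at hpar
    rw [Nat.odd_iff] at hodd
    rw [Nat.even_iff] at hpar
    omega
  · refine coef_ext fun α v => ?_
    rw [xOmega, map_add, map_smul, map_smul, coef_mono, coef_mono, smul_eq_mul, smul_eq_mul]
    by_cases hα : α = 0
    · subst hα
      by_cases h1 : v = ∅
      · subst h1
        rw [if_pos rfl, if_neg (by simpa using hne.symm)]
        simp
      · by_cases h2 : v = Finset.univ
        · subst h2
          rw [if_neg (by simpa using hne), if_pos rfl]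
          simp
        · obtain ⟨k, hk⟩ := Finset.nonempty_iff_ne_empty.2 h1
          obtain ⟨l, hl⟩ : ∃ l, l ∉ v := by
            by_contra hcon
            push Not at hcon
            exact h2 (Finset.eq_univ_iff_forall.2 hcon)
          have hkl : k ≠ l := fun h => hl (h ▸ hk)
          rw [coef_eq_zero_of_ham_pairMono hkl (h0 k l hkl) hk hl,
            if_neg (by simpa using Ne.symm h1), if_neg (by simpa using Ne.symm h2)]
          simp
    · rw [coef_eq_zero_of_pd hconst hα, if_neg (by simp [Ne.symm hα]),
        if_neg (by simp [Ne.symm hα])]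
      simp

end

/-! ### Products and brackets with x^ω. -/

section
variable {F : Type*} [Field F] {m n : ℕ}

lemma mono_ne_zero (α : Y0 m → ℕ) (u : Finset (Fin n)) : mono F α u ≠ 0 :=
  (monoBasis F m n).ne_zero _

lemma pd_xOmega_mul_gen {a b : Fin n} (hab : a ≠ b) :
    mul F (pd F (Sum.inr a) (xOmega F m n)) (mono F 0 {b}) = 0 := by
  rw [xOmega, pd_inr_mono, if_pos (Finset.mem_univ a), map_smul, LinearMap.smul_apply, mul_mono,
    wedgeCoeff, if_neg (by simp [hab.symm])]
  simp

lemma gen_mul_gen {a b : Fin n} (hab : a ≠ b) :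
    mul F (gen F (Sum.inr a)) (mono F 0 {b}) = pairMono F (0 : Y0 m → ℕ) a b := by
  rw [gen, mul_odd_mono, if_neg (by simpa using hab), pairMono_eq hab]
  by_cases h : b < a
  · rw [if_neg h.asymm]
    simp [below, Finset.filter_singleton, h]
  · rw [if_pos (lt_of_le_of_ne (not_lt.1 h) hab)]
    simp [below, Finset.filter_singleton, h]

lemma ham_xOmega_gen_inl {i : Y0 m} (hn : Even n) :
    ham F (xOmega F m n) (gen F (Sum.inl i)) = 0 := by
  rw [ham_apply (xOmega_mem (p := 2) (fun _ => 1) hn)]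
  refine Finset.sum_eq_zero ?_
  rintro (l | c) _
  · rw [xOmega, pd_inl_of_zero rfl]
    simp
  · rw [dual, pd_gen_of_ne (by simp)]
    simp

lemma ham_xOmega_gen_inr {a : Fin n} (hn : Even n) :
    ham F (xOmega F m n) (gen F (Sum.inr a)) = pd F (Sum.inr a) (xOmega F m n) := by
  rw [ham_apply (xOmega_mem (p := 2) (fun _ => 1) hn), Finset.sum_eq_single (Sum.inr a)]
  · rw [dual, pd_gen_self, mul_one', tau, one_smul]
  · rintro (l | c) _ hne
    · rw [xOmega, pd_inl_of_zero rfl]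
      simp
    · rw [dual, pd_gen_of_ne hne]
      simp
  · simp

end

/-! ### The values at x_r^(q) and at x_r^(q) x_j. -/

section
variable {F : Type*} [Field F] {m n p : ℕ} [Fact p.Prime] {t' : Y0 m → ℕ}

lemma containsLow_of_adm (hp : 3 < p) (hm : 0 < m) (ht' : ∀ i, 1 ≤ t' i)
    {S : Submodule F (O F m n)} (hN : ∀ β u, Adm p t' β u → mono F β u ∈ S) : ContainsLow S := by
  have hπ := lt_piMax hp ht'
  have key : ∀ (β : Y0 m → ℕ) (u : Finset (Fin n)), (∀ i, β i ≤ 3) → Even u.card →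
      mono F β u ∈ S := fun β u hβ hu => hN _ _ (Adm.of_lt (fun i => (hβ i).trans (hπ i).le) hu
        (Sum.inl ⟨0, hm⟩) ((hβ _).trans_lt (hπ _)))
  have h1 : ∀ (i l : Y0 m) (k : ℕ), (Pi.single i k : Y0 m → ℕ) l ≤ k := by
    intro i l k
    rw [Pi.single_apply]
    split_ifs <;> omega
  refine ⟨key _ _ (by simp) (by simp), fun i => key _ _ ?_ (by simp), fun i => key _ _ ?_ (by simp),
    fun i j _ => key _ _ ?_ (by simp), fun a b hab => key _ _ (by simp) (by simp [hab])⟩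
  · intro l
    have := h1 i l 1
    omega
  · intro l
    have := h1 i l 2
    omega
  · intro l
    have := h1 i l 1
    have := h1 j l 1
    rw [Pi.add_apply]
    omega

end

section
variable {F : Type*} [Field F] {m n p : ℕ} [Fact p.Prime] [CharP F p] {t t' : Y0 m → ℕ}
  {δ : nAlg F n p t →ₗ[F] evenWitt F n p t}

lemma pow_le_piMax {r : Y0 m} (h : t' r < t r) : p ^ t' r ≤ piMax p t r := by
  have h1 := piMax_add_one (Fact.out : p.Prime).pos t r
  have h2 := Nat.pow_lt_pow_right (Fact.out : p.Prime).one_lt h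
  omega

/-- The value at `x_r^(q)`, `q = p^(t'_r)`, of a derivation that vanishes on all monomials of
heights `t'`. -/
lemma val_single_pow (hp : 3 < p) (ht : ∀ i, 1 ≤ t i) (hm : 0 < m) (hn : 3 < n) (hδ : IsDer δ)
    (ht' : ∀ i, 1 ≤ t' i) {r : Y0 m} (hr : t' r < t r)
    (hN : ∀ β u, Adm p t' β u → mono F β u ∈ killed δ) :
    ∃ B : F, (Odd n → B = 0) ∧
      Val δ (mono F (Pi.single r (p ^ t' r)) ∅) (B • ham F (xOmega F m n)) := by
  have hL := containsLow_of_adm hp hm ht' hN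
  have hadm : Adm p t (Pi.single r (p ^ t' r)) (∅ : Finset (Fin n)) := by
    refine Adm.of_lt (single_le_piMax (pow_le_piMax hr)) (by simp) r.swap ?_
    have := lt_piMax hp ht r.swap
    rw [Pi.single_eq_of_ne (swap_ne r)]
    omega
  obtain ⟨w, hw⟩ := Val.of_mem δ (mono_mem_nPot (F := F) hadm)
  have hpd : pd F (Sum.inl r) (mono F (Pi.single r (p ^ t' r)) (∅ : Finset (Fin n)))
      = mono F (Pi.single r (piMax p t' r)) ∅ := by
    have := pd_inl_add_single (F := F) r (Pi.single r (piMax p t' r)) (∅ : Finset (Fin n))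
    rwa [← Pi.single_add, piMax_add_one (Fact.out : p.Prime).pos] at this
  have hpi : ∀ u : Finset (Fin n), Even u.card →
      mono F (Pi.single r (piMax p t' r)) u ∈ killed δ := by
    intro u hu
    refine hN _ _ (Adm.of_lt (single_le_piMax le_rfl) hu r.swap ?_)
    have := lt_piMax hp ht' r.swap
    rw [Pi.single_eq_of_ne (swap_ne r)]
    omega
  have hc := hw.pd_apply_gen hδ hL.lin (fun l => by
    by_cases hl : l = r
    · rw [hl, hpd]
      exact hpi ∅ (by simp)
    · rw [pd_inl_of_zero (by simp [hl])]
      exact zero_mem _)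
  have h11 : ∀ i : Y0 m, mono F (Pi.single i 1 + Pi.single i.swap 1) ∅ ∈ killed δ :=
    fun i => hL.mixed _ _ (ne_swap i)
  -- Since p divides q, the potential x_r^(q) has weight zero for the whole torus, whereas x_l has
  -- nonzero weight for its own pair; so w has no components at even variables.
  have hcast : ∀ l, (((Pi.single r (p ^ t' r) : Y0 m → ℕ) l : ℕ) : F) = 0 := by
    intro l
    rw [Pi.single_apply]
    split_ifs
    · rw [CharP.cast_eq_zero_iff F p]
      exact dvd_pow_self p (by have := ht' r; omega)
    · simp
  have hinl : ∀ l : Y0 m, w (gen F (Sum.inl l)) = 0 := by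
    intro l
    refine (smul_eq_zero.1 (hw.weight_inl hδ h11 hc l l)).resolve_left ?_
    rw [hcast, hcast, if_neg (swap_ne l), if_pos rfl]
    simp
  have hodd : ∀ {k l : Fin n}, k ≠ l → pairMono F 0 k l ∈ killed δ :=
    fun h => (pairMono_mem h).2 (hL.odd _ _ h)
  have hrot : ∀ {k l : Fin n} (_ : k ≠ l) (j : Y m n),
      ham F (pairMono F 0 k l) (w (gen F j)) = w (ham F (pairMono F 0 k l) (gen F j)) :=
    fun h j => hw.ham_pairMono_apply_gen hδ (hodd h) (by
      rw [ham_pairMono_mono_empty h]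
      exact zero_mem _) j
  obtain ⟨A, B, hB, hy⟩ := exists_coeff_of_rotation (p := p) (t := t) hn
    (y := fun c => w (gen F (Sum.inr c))) (fun c => apply_gen_mem hw.mem_evenWittSpan (Sum.inr c))
    (fun c l => hc l _)
    (fun k l c hkl hk hl => by rw [hrot hkl, ham_pairMono_gen_of_ne hkl hk hl, map_zero])
    (fun k l hkl => by rw [hrot hkl, ham_pairMono_gen_left hkl])
  -- The bracket of x_{r'} x_a x_b with x_r^(q) is a multiple of x_r^(q-1) x_a x_b, of heights t'
  -- and hence killed, so D_H(x_{r'} x_a x_b) commutes with w. At x_r this gives w(x_a x_b) = 2A x_a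
  -- x_b = 0; the B-part drops out because ∂_a(x^ω) already contains x_b.
  have hA : A = 0 := by
    let a : Fin n := ⟨0, by omega⟩
    let b : Fin n := ⟨1, by omega⟩
    have hab : a ≠ b := by simp [a, b]
    have hz : pairMono F (Pi.single r.swap 1) a b ∈ killed δ := by
      rw [pairMono_mem hab]
      have hlt := lt_piMax hp ht'
      refine hN _ _ (Adm.of_lt (single_le_piMax ?_) (by simp [hab]) r ?_)
      · have := hlt r.swap
        omega
      · have := hlt r
        rw [Pi.single_eq_of_ne (ne_swap r)]
        omega
    have h := Val.lie_eq_zero hδ hz hw (by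
      rw [ham_single_pairMono_one hab, ham_pairMono_mono_empty hab, map_zero, add_zero,
        Sum.swap_swap, hpd, pairMono_eq hab, map_smul, LinearMap.smul_apply, mul_mono]
      refine Submodule.smul_mem _ _ (Submodule.smul_mem _ _ (Submodule.smul_mem _ _ ?_))
      rw [zero_add, Finset.union_empty]
      exact hpi _ (by simp [hab]))
    have h1 := congrArg (fun D => D (gen F (Sum.inl r))) h
    simp only [Ring.lie_def, LinearMap.sub_apply, Module.End.mul_apply, LinearMap.zero_apply] at h1
    rw [hinl, map_zero, zero_sub, neg_eq_zero, ham_single_pairMono_gen_inl hab,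
      if_pos (Sum.swap_swap r).symm, map_smul] at h1
    have h2 := (smul_eq_zero.1 h1).resolve_left (tau_ne_zero _)
    rw [eq_sum_vf hw.mem_evenWittSpan, LinearMap.sum_apply, Fintype.sum_sum_type,
      Finset.sum_eq_zero (fun l _ => by rw [hinl, map_zero, LinearMap.zero_apply]), zero_add,
      Finset.sum_eq_add a b hab] at h2
    · simp only [vf_apply] at h2
      rw [pd_inr_pairMono_left hab, pd_inr_pairMono_right hab, hy, hy, map_neg] at h2
      simp only [map_add, map_smul, LinearMap.add_apply, LinearMap.smul_apply] at h2
      rw [gen_mul_gen hab, gen_mul_gen hab.symm, pd_xOmega_mul_gen hab,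
        pd_xOmega_mul_gen hab.symm, pairMono_swap hab, smul_zero, add_zero, add_zero, smul_neg,
        neg_neg, ← two_smul F, smul_smul, pairMono_eq hab, smul_smul] at h2
      have h3 := (smul_eq_zero.1 h2).resolve_right (mono_ne_zero _ _)
      have c2 := cast_ne_zero_of_lt_five (F := F) (p := p) hp (a := 2) (by norm_num) (by norm_num)
      push_cast at c2
      have h4 := (mul_eq_zero.1 h3).resolve_right (by split_ifs <;> simp)
      exact (mul_eq_zero.1 h4).resolve_left c2
    · intro c _ hne
      rw [vf_apply, pd_inr_pairMono_of_ne hab hne.1 hne.2, map_zero]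
    · simp
    · simp
  refine ⟨B, hB, ?_⟩
  have hwB : w = B • ham F (xOmega F m n) := by
    rcases Nat.even_or_odd n with he | ho
    · refine evenWitt_ext hw.mem_evenWittSpan
        (Submodule.smul_mem _ _ (ham_mem (xOmega_mem t he))) (fun l => ?_) (fun a => ?_)
      · rw [hinl, LinearMap.smul_apply, ham_xOmega_gen_inl he, smul_zero]
      · rw [hy, hA, LinearMap.smul_apply, ham_xOmega_gen_inr he, zero_smul, zero_add]
    · rw [hB ho, zero_smul]
      refine evenWitt_ext hw.mem_evenWittSpan (zero_mem _) hinl (fun a => ?_)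
      rw [hy, hA, hB ho, zero_smul, zero_smul, zero_add, LinearMap.zero_apply]
  rw [← hwB]
  exact hw

/-- The value at `x_r^(q) x_j`, `q = p^(t'_r)`, of a derivation that vanishes on `x_r^(q)` and on all
monomials of heights `t'`. -/
lemma val_single_pow_add_single (hp : 3 < p) (ht : ∀ i, 1 ≤ t i) (hn : 3 < n)
    (hδ : IsDer δ) (ht' : ∀ i, 1 ≤ t' i) {r j : Y0 m} (hr : t' r < t r)
    (hL : ContainsLow (killed δ))
    (hN : ∀ β u, Adm p t' β u → mono F β u ∈ killed δ)
    (hq : mono F (Pi.single r (p ^ t' r)) ∅ ∈ killed δ) (hj : j ≠ r) (hj' : j ≠ r.swap) :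
    ∃ A B : F, (Odd n → B = 0) ∧
      Val δ (mono F (Pi.single r (p ^ t' r) + Pi.single j 1) ∅)
        (vf F (Sum.inl j.swap) (A • mono F 0 ∅ + B • xOmega F m n)) := by
  have hrj : r.swap ≠ j := Ne.symm hj'
  have hjr : j.swap ≠ r := fun h => hj' (swap_eq_iff.1 h)
  have hadm : Adm p t (Pi.single r (p ^ t' r) + Pi.single j 1) (∅ : Finset (Fin n)) := by
    have h1 := lt_piMax hp ht
    refine Adm.of_lt (add_single_le (single_le_piMax (pow_le_piMax hr)) ?_) (by simp) r.swap ?_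
    · have := h1 j
      rw [Pi.single_eq_of_ne hj]
      omega
    · have := h1 r.swap
      rw [Pi.add_apply, Pi.single_eq_of_ne (swap_ne r), Pi.single_eq_of_ne hrj]
      omega
  obtain ⟨w, hw⟩ := Val.of_mem δ (mono_mem_nPot (F := F) hadm)
  -- ∂_r leads to x_r^(q-1) x_j, which has heights t', and ∂_j leads to x_r^(q); both are killed.
  have hc := hw.pd_apply_gen hδ hL.lin (fun l => by
    by_cases hl : l = r
    · have := pd_inl_add_single (F := F) r (Pi.single r (piMax p t' r) + Pi.single j 1)
        (∅ : Finset (Fin n))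
      rw [add_right_comm, ← Pi.single_add, piMax_add_one (Fact.out : p.Prime).pos] at this
      rw [hl, this]
      have h1 := lt_piMax hp ht'
      refine hN _ _ (Adm.of_lt (add_single_le (single_le_piMax le_rfl) ?_) (by simp) r.swap ?_)
      · have := h1 j
        rw [Pi.single_eq_of_ne hj]
        omega
      · have := h1 r.swap
        rw [Pi.add_apply, Pi.single_eq_of_ne (swap_ne r), Pi.single_eq_of_ne hrj]
        omega
    · by_cases hl' : l = j
      · rw [hl', pd_inl_add_single]
        exact hq
      · rw [pd_inl_of_zero (by simp [hl, hl'])]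
        exact zero_mem _)
  have h11 : ∀ i : Y0 m, mono F (Pi.single i 1 + Pi.single i.swap 1) ∅ ∈ killed δ :=
    fun i => hL.mixed _ _ (ne_swap i)
  have hvf := hw.eq_vf hδ hp h11 hc (i := j) (by simp [hj]) (by simp [hjr, swap_ne])
  obtain ⟨A, B, hB, hg⟩ := exists_coeff_of_rotation_even (p := p) (t := t)
    (g := w (gen F (Sum.inl j.swap))) (apply_gen_mem hw.mem_evenWittSpan (Sum.inl j.swap))
    (by omega) (fun l => hc l _) (fun k l hkl => by
      rw [hw.ham_pairMono_apply_gen hδ ((pairMono_mem hkl).2 (hL.odd _ _ hkl)) (by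
        rw [ham_pairMono_mono_empty hkl]
        exact zero_mem _), ham_pairMono_gen_inl hkl, map_zero])
  refine ⟨A, B, hB, ?_⟩
  rw [← hg, ← hvf]
  exact hw

end

/-! ### Removing the exceptional derivations at one height, uniformly in the parity of n. -/

section
variable (F : Type*) [Field F] {m : ℕ} (n p : ℕ) [Fact p.Prime] [CharP F p] (t : Y0 m → ℕ)

open Classical in
/-- The map `Φ_i^(s)` for even `n`, and `0` for odd `n`. -/
noncomputable def phiMap (i : Y0 m) (s : ℕ) : nAlg F n p t →ₗ[F] evenWitt F n p t :=
  if h : Even n then Phi F p t h i s else 0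

open Classical in
/-- The map `Θ_i^(s)` for even `n`, and `0` for odd `n`. -/
noncomputable def thetaMap (i : Y0 m) (s : ℕ) : nAlg F n p t →ₗ[F] evenWitt F n p t :=
  if h : Even n then Theta F p t h i s else 0

end

section
variable {F : Type*} [Field F] {m n p : ℕ} [Fact p.Prime] [CharP F p] {t t' : Y0 m → ℕ}
  {δ : nAlg F n p t →ₗ[F] evenWitt F n p t} {f : O F m n}

lemma phiMap_of_even (h : Even n) (i : Y0 m) (s : ℕ) : phiMap F n p t i s = Phi F p t h i s :=
  dif_pos h

lemma thetaMap_of_even (h : Even n) (i : Y0 m) (s : ℕ) :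
    thetaMap F n p t i s = Theta F p t h i s :=
  dif_pos h

lemma phiMap_of_odd (h : Odd n) (i : Y0 m) (s : ℕ) : phiMap F n p t i s = 0 :=
  dif_neg (Nat.not_even_iff_odd.2 h)

lemma thetaMap_of_odd (h : Odd n) (i : Y0 m) (s : ℕ) : thetaMap F n p t i s = 0 :=
  dif_neg (Nat.not_even_iff_odd.2 h)

lemma val_zero (hf : f ∈ nPot F n p t) :
    Val (0 : nAlg F n p t →ₗ[F] evenWitt F n p t) f 0 :=
  ⟨hf, rfl⟩

lemma isDer_zero : IsDer (0 : nAlg F n p t →ₗ[F] evenWitt F n p t) := by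
  intro x y
  simp

lemma isDer_phiMap (ht : ∀ i, 1 ≤ t i) (i : Y0 m) (s : ℕ) : IsDer (phiMap F n p t i s) := by
  rcases Nat.even_or_odd n with h | h
  · rw [phiMap_of_even h]
    exact isDer_Phi ht h i s
  · rw [phiMap_of_odd h]
    exact isDer_zero

lemma isDer_thetaMap (ht : ∀ i, 1 ≤ t i) (i : Y0 m) (s : ℕ) : IsDer (thetaMap F n p t i s) := by
  rcases Nat.even_or_odd n with h | h
  · rw [thetaMap_of_even h]
    exact isDer_Theta ht h i s
  · rw [thetaMap_of_odd h]
    exact isDer_zero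

lemma val_smul_phiMap {B : F} (hB : Odd n → B = 0) (i : Y0 m) (s : ℕ) (hf : f ∈ nPot F n p t) :
    Val (B • phiMap F n p t i s) f
      (B • mul F ((pd F (Sum.inl i) ^ p ^ s) f) ∘ₗ ham F (xOmega F m n)) := by
  rcases Nat.even_or_odd n with h | h
  · rw [phiMap_of_even h]
    exact (val_Phi h i s hf).smul_left B
  · rw [hB h, zero_smul, zero_smul]
    exact val_zero hf

lemma val_smul_thetaMap (ht : ∀ i, 1 ≤ t i) {B : F} (hB : Odd n → B = 0) (i : Y0 m) (s : ℕ)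
    (hf : f ∈ nPot F n p t) :
    Val (B • thetaMap F n p t i s) f
      (B • mul F (xOmega F m n) ∘ₗ ham F ((pd F (Sum.inl i) ^ p ^ s) f)) := by
  rcases Nat.even_or_odd n with h | h
  · rw [thetaMap_of_even h]
    exact (val_Theta ht h i s hf).smul_left B
  · rw [hB h, zero_smul, zero_smul]
    exact val_zero hf

lemma mem_killed_phiMap {i : Y0 m} {s : ℕ} (hf : f ∈ nPot F n p t)
    (h : (pd F (Sum.inl i) ^ p ^ s) f = 0) : f ∈ killed (phiMap F n p t i s) := by
  rw [mem_killed]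
  rcases Nat.even_or_odd n with he | ho
  · rw [phiMap_of_even he]
    have := val_Phi he i s hf
    rwa [h, map_zero, LinearMap.zero_comp] at this
  · rw [phiMap_of_odd ho]
    exact val_zero hf

lemma mem_killed_thetaMap (ht : ∀ i, 1 ≤ t i) {i : Y0 m} {s : ℕ} (hf : f ∈ nPot F n p t)
    (h : ham F ((pd F (Sum.inl i) ^ p ^ s) f) = 0) : f ∈ killed (thetaMap F n p t i s) := by
  rw [mem_killed]
  rcases Nat.even_or_odd n with he | ho
  · rw [thetaMap_of_even he]
    have := val_Theta ht he i s hf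
    rwa [h, LinearMap.comp_zero] at this
  · rw [thetaMap_of_odd ho]
    exact val_zero hf

lemma mem_killed_adPowN (ht : ∀ i, 1 ≤ t i) {i : Y0 m} {k : ℕ} (hf : f ∈ nPot F n p t)
    (h : ham F ((pd F (Sum.inl i) ^ k) f) = 0) : f ∈ killed (adPowN (dW F n p t i) k) := by
  rw [mem_killed, ← h]
  exact val_adPowN ht i k hf

/-- The quadratic elements x_l^(2) and x_l x_{j'} carry x_j to x_l and leave x_r^(q) fixed, since l
lies outside the pair {r, r'}. One value of j therefore suffices for the hypothesis of
`mono_mem_add_single`. -/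
lemma mono_single_add_mem_of_one {S : Submodule F (O F m n)}
    (hS : ∀ f ∈ S, ∀ g ∈ S, ham F f g ∈ S) (hL : ContainsLow S) {r j : Y0 m} {q : ℕ}
    (h : mono F (Pi.single r q + Pi.single j 1) ∅ ∈ S)
    (l : Y0 m) (hl : l ≠ r) (hl' : l ≠ r.swap) :
    mono F (Pi.single r q + Pi.single l 1) ∅ ∈ S := by
  by_cases h1 : l = j
  · rwa [h1]
  by_cases h2 : l = j.swap
  · refine mem_of_ham_single hS (i := l) (k := 1) (by simp) (hL.sq l) ?_ (by simp [hl])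
    rw [add_tsub_cancel_right, h2, Sum.swap_swap]
    exact h
  · have h3 : l.swap ≠ r := fun h' => hl' (swap_eq_iff.1 h')
    refine mem_of_ham_single_add_single hS (i := l) (j := j.swap) h2
      (fun h' => h1 (Sum.swap_leftInverse.injective h').symm) (k := 0) (by simp)
      (hL.mixed _ _ h2) ?_ (by simp [hl]) ?_
    · rw [zero_add, add_tsub_cancel_right, Sum.swap_swap]
      exact h
    · intro h'
      simp [swap_ne, h3] at h'

/-- Up to the exceptional derivations, the range of vanishing extends by one height. -/
theorem exists_sub_add_single (hp : 3 < p) (ht : ∀ i, 1 ≤ t i) (hm : 1 < m) (hn : 3 < n)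
    (hδ : IsDer δ) (ht' : ∀ i, 1 ≤ t' i) {r : Y0 m} (hr : t' r < t r)
    (hN : ∀ β u, Adm p t' β u → mono F β u ∈ killed δ) :
    ∃ lam mu eta : F, IsDer (δ - (lam • phiMap F n p t r (t' r) + mu • thetaMap F n p t r (t' r)
      + eta • adPowN (dW F n p t r) (p ^ t' r))) ∧
      ∀ β u, Adm p (t' + Pi.single r 1) β u → mono F β u ∈
        killed (δ - (lam • phiMap F n p t r (t' r) + mu • thetaMap F n p t r (t' r)
          + eta • adPowN (dW F n p t r) (p ^ t' r))) := by
  have hpos : 0 < p := (Fact.out : p.Prime).pos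
  -- Heights t' bound the exponent of x_r by q - 1, so the maps to be subtracted vanish on
  -- everything that is already killed.
  have hpow : ∀ β (u : Finset (Fin n)), Adm p t' β u →
      (pd F (Sum.inl r) ^ p ^ t' r) (mono F β u) = 0 := by
    intro β u h
    rw [pd_pow_mono, if_neg]
    have h1 : β r ≤ piMax p t' r := h.1 r
    have h2 := piMax_add_one hpos t' r
    omega
  obtain ⟨lam, hlam, hval⟩ := val_single_pow hp ht (by omega) hn hδ ht' hr hN
  set δ₁ := δ - lam • phiMap F n p t r (t' r) with hδ₁
  have hder₁ : IsDer δ₁ := hδ.sub ((isDer_phiMap ht r _).smul lam)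
  have hN₁ : ∀ β u, Adm p t' β u → mono F β u ∈ killed δ₁ := fun β u h =>
    killed_sub (hN β u h) (killed_smul _ (mem_killed_phiMap (mem_killed.1 (hN β u h)).mem_nPot
      (hpow β u h)))
  have hf₁ : mono F (Pi.single r (p ^ t' r)) ∅ ∈ killed δ₁ := by
    have h := hval.sub (val_smul_phiMap hlam r (t' r) hval.mem_nPot)
    rw [pd_pow_mono, if_pos (by simp), tsub_self] at h
    have e : mul F (mono F 0 ∅) ∘ₗ ham F (xOmega F m n) = ham F (xOmega F m n) :=
      LinearMap.ext fun g => one_mul' _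
    rw [e, sub_self] at h
    exact mem_killed.2 h
  have hL₁ := containsLow_of_adm hp (by omega) ht' hN₁
  obtain ⟨j, hj, hj'⟩ := exists_off_pair hm r
  obtain ⟨A, B, hB, hval₁⟩ := val_single_pow_add_single hp ht hn hder₁ ht' hr hL₁ hN₁ hf₁ hj hj'
  have hτ := tau_ne_zero (F := F) (n := n) j
  -- At x_r^(q) x_j the maps Θ_r and (ad ∂_r)^q take the values τ(j) x^ω ∂_{j'} and τ(j) ∂_{j'}.
  set mu := B / tau F (Sum.inl j : Y m n) with hmu
  set eta := A / tau F (Sum.inl j : Y m n) with heta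
  have hmu0 : Odd n → mu = 0 := fun h => by rw [hmu, hB h, zero_div]
  have e : δ - (lam • phiMap F n p t r (t' r) + mu • thetaMap F n p t r (t' r)
      + eta • adPowN (dW F n p t r) (p ^ t' r))
      = δ₁ - (mu • thetaMap F n p t r (t' r) + eta • adPowN (dW F n p t r) (p ^ t' r)) := by
    rw [hδ₁]
    abel
  have hder₂ : IsDer (δ₁ - (mu • thetaMap F n p t r (t' r)
      + eta • adPowN (dW F n p t r) (p ^ t' r))) :=
    hder₁.sub (((isDer_thetaMap ht r _).smul mu).add ((isDer_adPowN ht r _).smul eta))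
  refine ⟨lam, mu, eta, ?_⟩
  rw [e]
  refine ⟨hder₂, ?_⟩
  have hN₂ : ∀ β u, Adm p t' β u → mono F β u ∈ killed (δ₁ - (mu • thetaMap F n p t r (t' r)
      + eta • adPowN (dW F n p t r) (p ^ t' r))) := by
    intro β u h
    have hf := (mem_killed.1 (hN β u h)).mem_nPot
    have h0 : ham F ((pd F (Sum.inl r) ^ p ^ t' r) (mono F β u)) = 0 := by
      rw [hpow β u h, map_zero]
    exact killed_sub (hN₁ β u h) (killed_add (killed_smul _ (mem_killed_thetaMap ht hf h0))
      (killed_smul _ (mem_killed_adPowN ht hf h0)))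
  have hf₂ : mono F (Pi.single r (p ^ t' r) + Pi.single j 1) ∅ ∈
      killed (δ₁ - (mu • thetaMap F n p t r (t' r) + eta • adPowN (dW F n p t r) (p ^ t' r))) := by
    have h := hval₁.sub ((val_smul_thetaMap ht hmu0 r (t' r) hval₁.mem_nPot).add
      ((val_adPowN ht r (p ^ t' r) hval₁.mem_nPot).smul_left eta))
    rw [pd_pow_mono, if_pos (by simp), add_tsub_cancel_left, ham_gen] at h
    have e₂ : vf F (Sum.inl j.swap) (A • mono F 0 ∅ + B • xOmega F m n)
        - (mu • mul F (xOmega F m n) ∘ₗ (tau F (Sum.inl j : Y m n) • pd F (Sum.inl j.swap))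
          + eta • tau F (Sum.inl j : Y m n) • pd F (Sum.inl j.swap)) = 0 := by
      refine LinearMap.ext fun g => ?_
      simp only [LinearMap.sub_apply, LinearMap.add_apply, LinearMap.smul_apply,
        LinearMap.comp_apply, LinearMap.zero_apply, vf_apply, map_add, map_smul, one_mul', smul_smul]
      rw [hmu, heta, div_mul_cancel₀ _ hτ, div_mul_cancel₀ _ hτ]
      abel
    rw [e₂] at h
    exact mem_killed.2 h
  refine mono_mem_add_single hm (killed_bracket hder₂) ht' r hN₂ ?_
  exact mono_single_add_mem_of_one (killed_bracket hder₂) (containsLow_of_adm hp (by omega) ht' hN₂)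
    hf₂

end

/-! ### Degrees, and tools for reading off coefficients. -/

section
variable {F : Type*} [Field F] {m n p : ℕ} {t : Y0 m → ℕ}

lemma ham_mono_mem_wittGrade {α : Y0 m → ℕ} {u : Finset (Fin n)} (hα : α ≤ piMax p t)
    (hu : Even u.card) {k : ℤ} (hk : ((∑ j, α j + u.card : ℕ) : ℤ) = k + 2) :
    ham F (mono F α u) ∈ wittGrade F n p t k := by
  have h0 : mono F α u ∈ truncPar F n p t 0 := by
    have := mono_mem_truncPar (F := F) (u := u) hα
    rwa [ZMod.natCast_eq_zero_iff_even.2 hu] at this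
  rw [ham_eq h0]
  refine sum_mem fun i _ => Submodule.smul_mem _ _ ?_
  rcases i with i | a
  · rw [pd_inl_mono]
    split_ifs with h
    · simp
    · refine Submodule.subset_span ⟨_, _, _, ?_, ?_, rfl⟩
      · exact tsub_le_self.trans hα
      · have h1 := sum_sub_single (β := α) (i := i) (k := 1) (by omega)
        rw [← h1, Nat.cast_add, Nat.cast_add] at hk
        rw [Nat.cast_add]
        push_cast at hk ⊢
        linarith
  · rw [pd_inr_mono]
    split_ifs with h
    · rw [map_smul]
      refine Submodule.smul_mem _ _ (Submodule.subset_span ⟨_, _, _, hα, ?_, rfl⟩)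
      have h1 := Finset.card_erase_add_one h
      push_cast at hk ⊢
      omega
    · simp

/-- A field of degree k sends variables to combinations of monomials of degree k + 1, so two nonzero
coefficients in one component must have equal degrees. -/
lemma degree_of_coef_ne_zero {D : Module.End F (O F m n)} {k : ℤ} (hD : D ∈ wittGrade F n p t k)
    {i : Y m n} {α : Y0 m → ℕ} {v : Finset (Fin n)} (h : coef F α v (D (gen F i)) ≠ 0) :
    ((∑ j, α j + v.card : ℕ) : ℤ) = k + 1 := by
  by_contra hne
  refine h ?_
  clear h
  induction hD using Submodule.span_induction with
  | mem x hx =>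
    obtain ⟨β, u, j, _, hk, rfl⟩ := hx
    by_cases hj : j = i
    · rw [hj, vf_gen_self, coef_mono, if_neg]
      intro he
      rw [Prod.mk.injEq] at he
      rw [he.1, he.2] at hk
      exact hne hk
    · rw [vf_gen_of_ne hj, map_zero]
  | zero => simp
  | add x y _ _ hx hy => rw [LinearMap.add_apply, map_add, hx, hy, add_zero]
  | smul c x _ hx => rw [LinearMap.smul_apply, map_smul, hx, smul_zero]

lemma ham_mono_empty_gen (γ : Y0 m → ℕ) (j : Y0 m) :
    ham F (mono F γ (∅ : Finset (Fin n))) (gen F (Sum.inl j.swap))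
      = tau F (Sum.inl j : Y m n) • pd F (Sum.inl j) (mono F γ ∅) := by
  rw [ham_mono_empty, Finset.sum_eq_single j]
  · rw [pd_gen_self, mul_one']
  · intro l _ hl
    rw [pd_gen_of_ne, map_zero, smul_zero]
    simpa using fun h : l.swap = j.swap => hl (Sum.swap_leftInverse.injective h)
  · simp

/-- Separates the summands of different (r, s) by their value at a single test element. The bound 1
< q' rules out that r' = j removes the linear factor x_j. -/
lemma coef_pd_pd_pow {r j r' : Y0 m} {q q' : ℕ} (hj : j ≠ r) (hq' : 1 < q')
    (v : Finset (Fin n)) :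
    coef F 0 v (pd F (Sum.inl j)
        ((pd F (Sum.inl r') ^ q') (mono F (Pi.single r q + Pi.single j 1) ∅)))
      = if r' = r ∧ q' = q ∧ v = ∅ then 1 else 0 := by
  rw [pd_pow_mono]
  by_cases hr : r' = r
  · subst hr
    by_cases hle : q' ≤ q
    · rw [if_pos (by simp; omega)]
      have e : (Pi.single r' q + Pi.single j 1 : Y0 m → ℕ) - Pi.single r' q'
          = Pi.single r' (q - q') + Pi.single j 1 := by
        ext l
        by_cases hl : l = r'
        · subst hl
          simp [hj.symm]
        · simp [hl]
      rw [e, pd_inl_add_single, coef_mono]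
      refine if_congr ?_ rfl rfl
      rw [Prod.mk.injEq, Pi.single_eq_zero_iff]
      constructor
      · rintro ⟨h1, h2⟩
        exact ⟨rfl, by omega, h2.symm⟩
      · rintro ⟨-, h1, h2⟩
        exact ⟨by omega, h2.symm⟩
    · rw [if_neg (by simp [hj.symm]; omega), map_zero, map_zero, if_neg]
      rintro ⟨-, h, -⟩
      omega
  · rw [if_neg, map_zero, map_zero, if_neg]
    · exact fun h => hr h.1
    · rw [Pi.add_apply, Pi.single_eq_of_ne hr, zero_add, Pi.single_apply]
      split_ifs <;> omega

lemma coef_empty_xOmega_mul (hn : 0 < n) (g : O F m n) :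
    coef F 0 ∅ (mul F (xOmega F m n) g) = 0 := by
  have : (coef F 0 ∅).comp (mul F (xOmega F m n)) = 0 := by
    refine mono_ext fun β u => ?_
    rw [LinearMap.comp_apply, xOmega, mul_mono, map_smul, coef_mono, if_neg, smul_zero,
      LinearMap.zero_apply]
    intro h
    exact Finset.notMem_empty (⟨0, hn⟩ : Fin n) ((Prod.mk.inj h).2 ▸ by simp)
  exact congrArg (fun f => f g) this

lemma coef_univ_xOmega_mul (g : O F m n) :
    coef F 0 Finset.univ (mul F (xOmega F m n) g) = coef F 0 ∅ g := by
  have : (coef F 0 Finset.univ).comp (mul F (xOmega F m n)) = coef F 0 ∅ := by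
    refine mono_ext fun β u => ?_
    rw [LinearMap.comp_apply, xOmega, mul_mono, map_smul, coef_mono, coef_mono, dpCoeff_zero,
      wedgeCoeff, zero_add, Finset.union_eq_left.2 (Finset.subset_univ u)]
    by_cases hu : u = ∅
    · subst hu
      simp [inversions]
    · rw [if_neg (fun h => hu (by simpa [Finset.disjoint_iff_inter_eq_empty] using h)),
        Int.cast_zero, mul_zero, zero_smul, if_neg (by simp [hu])]
  exact congrArg (fun f => f g) this

/-- Absorbs the terms subtracted at one height into the coefficients of the double sum. -/
lemma exists_sum_add_eq {M : Type*} [AddCommGroup M] [Module F M] (X Y Z : Y0 m → ℕ → M)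
    {r : Y0 m} {s : ℕ} (hs : s ∈ Finset.Ico 1 (t r)) (lam mu eta : Y0 m → ℕ → F) (a b c : F) :
    ∃ lam' mu' eta' : Y0 m → ℕ → F,
      ∑ i, ∑ k ∈ Finset.Ico 1 (t i), (lam i k • X i k + mu i k • Y i k + eta i k • Z i k)
          + (a • X r s + b • Y r s + c • Z r s)
        = ∑ i, ∑ k ∈ Finset.Ico 1 (t i),
          (lam' i k • X i k + mu' i k • Y i k + eta' i k • Z i k) := by
  have hite : ∀ (x : F) (X : Y0 m → ℕ → M),
      ∑ i, ∑ k ∈ Finset.Ico 1 (t i), (if i = r ∧ k = s then x else 0) • X i k = x • X r s := by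
    intro x X
    rw [Finset.sum_eq_single r, Finset.sum_eq_single s]
    · simp
    · intro k _ hk
      simp [hk]
    · exact fun h => absurd hs h
    · intro i _ hi
      simp [hi]
    · simp
  refine ⟨fun i k => lam i k + if i = r ∧ k = s then a else 0,
    fun i k => mu i k + if i = r ∧ k = s then b else 0,
    fun i k => eta i k + if i = r ∧ k = s then c else 0, ?_⟩
  simp only [add_smul, Finset.sum_add_distrib]
  rw [hite a X, hite b Y, hite c Z]
  abel

end

/-! ### Assembling the sum over all heights. -/

section
variable {F : Type*} [Field F] {m n p : ℕ} [Fact p.Prime] [CharP F p] {t t' : Y0 m → ℕ}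
  {δ : nAlg F n p t →ₗ[F] evenWitt F n p t}

/-- A derivation that vanishes on the monomials of heights `t'` is a combination of the exceptional
derivations. -/
theorem exists_eq_sum_of_killed (hp : 3 < p) (ht : ∀ i, 1 ≤ t i) (hm : 1 < m) (hn : 3 < n)
    (hδ : IsDer δ) (ht' : ∀ i, 1 ≤ t' i) (htt : t' ≤ t)
    (hN : ∀ β u, Adm p t' β u → mono F β u ∈ killed δ) :
    ∃ lam mu eta : Y0 m → ℕ → F, δ = ∑ r, ∑ s ∈ Finset.Ico 1 (t r),
      (lam r s • phiMap F n p t r s + mu r s • thetaMap F n p t r s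
        + eta r s • adPowN (dW F n p t r) (p ^ s)) := by
  induction hk : ∑ i, (t i - t' i) generalizing t' δ with
  | zero =>
    have e : t' = t := by
      funext i
      have h1 := (Finset.sum_eq_zero_iff.1 hk) i (Finset.mem_univ i)
      have h2 : t' i ≤ t i := htt i
      omega
    subst e
    refine ⟨0, 0, 0, ?_⟩
    rw [eq_zero_of_killed hN]
    simp
  | succ k ih =>
    obtain ⟨r, hr⟩ : ∃ r, t' r < t r := by
      by_contra hcon
      push Not at hcon
      rw [Finset.sum_eq_zero (fun i _ => Nat.sub_eq_zero_of_le (hcon i))] at hk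
      omega
    obtain ⟨a, b, c, hder, hkill⟩ := exists_sub_add_single hp ht hm hn hδ ht' hr hN
    have hsum : ∑ i, (t i - (t' + Pi.single r 1 : Y0 m → ℕ) i) = k := by
      have h1 : ∑ i, (t i - t' i) = ∑ i, ((t i - (t' + Pi.single r 1 : Y0 m → ℕ) i)
          + (Pi.single r 1 : Y0 m → ℕ) i) := by
        refine Finset.sum_congr rfl fun i _ => ?_
        by_cases hi : i = r
        · subst hi
          simp
          omega
        · simp [hi]
      have h2 : ∑ i, (Pi.single r 1 : Y0 m → ℕ) i = 1 := by simp
      rw [hk, Finset.sum_add_distrib, h2] at h1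
      omega
    obtain ⟨lam, mu, eta, h⟩ := ih (t' := t' + Pi.single r 1) hder
      (fun i => (ht' i).trans (Nat.le_add_right _ _)) (add_single_le htt hr) hkill hsum
    rw [sub_eq_iff_eq_add] at h
    rw [h]
    exact exists_sum_add_eq (phiMap F n p t) (thetaMap F n p t)
      (fun i s => adPowN (dW F n p t i) (p ^ s)) (Finset.mem_Ico.2 ⟨ht' r, hr⟩) lam mu eta a b c

/-- The coefficients of `Θ_r^(s)` and `(ad ∂_r)^(p^s)` read off from the value at `x_r^(p^s) x_j`. -/
lemma coef_of_val (ht : ∀ i, 1 ≤ t i) (hn : 0 < n) (hev : Even n) {c : F}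
    {lam mu eta : Y0 m → ℕ → F}
    (hδ : δ = c • adN (gammaPrime F n p t) + ∑ r, ∑ s ∈ Finset.Ico 1 (t r),
      (lam r s • Phi F p t hev r s + mu r s • Theta F p t hev r s
        + eta r s • adPowN (dW F n p t r) (p ^ s)))
    {r j : Y0 m} (hj : j ≠ r) {s : ℕ} (hs : s ∈ Finset.Ico 1 (t r)) {w : Module.End F (O F m n)}
    (hw : Val δ (mono F (Pi.single r (p ^ s) + Pi.single j 1) ∅) w) :
    coef F 0 ∅ (w (gen F (Sum.inl j.swap))) = eta r s * tau F (Sum.inl j : Y m n) ∧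
      coef F 0 Finset.univ (w (gen F (Sum.inl j.swap))) = mu r s * tau F (Sum.inl j : Y m n) := by
  obtain ⟨hf, rfl⟩ := hw
  set f : O F m n := mono F (Pi.single r (p ^ s) + Pi.single j 1) ∅ with hfdef
  -- Evaluation at D_H(f), followed by taking the component at x_{j'}. It is linear in the map, and
  -- it annihilates ad Γ' and every Φ.
  let E : (nAlg F n p t →ₗ[F] evenWitt F n p t) →ₗ[F] O F m n :=
    LinearMap.applyₗ (gen F (Sum.inl j.swap)) ∘ₗ (evenWitt F n p t).toSubmodule.subtype ∘ₗ
      LinearMap.applyₗ (hamN F n p t ⟨f, hf⟩)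
  have hE : ∀ {X : nAlg F n p t →ₗ[F] evenWitt F n p t} {w : Module.End F (O F m n)},
      Val X f w → E X = w (gen F (Sum.inl j.swap)) := by
    rintro X _ ⟨_, rfl⟩
    rfl
  have hpow : ∀ r' s', ham F ((pd F (Sum.inl r') ^ p ^ s') f) (gen F (Sum.inl j.swap))
      = tau F (Sum.inl j : Y m n) • pd F (Sum.inl j) ((pd F (Sum.inl r') ^ p ^ s') f) := by
    intro r' s'
    rw [hfdef, pd_pow_mono]
    split_ifs
    · exact ham_mono_empty_gen _ j
    · simp
  have hΓ : E (adN (gammaPrime F n p t)) = 0 := by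
    rw [hE (val_adN _ hf), hfdef, lie_gammaPrime_ham_mono_empty, LinearMap.zero_apply]
  have hΦ : ∀ r' s', E (Phi F p t hev r' s') = 0 := by
    intro r' s'
    rw [hE (val_Phi hev r' s' hf), LinearMap.comp_apply, ham_xOmega_gen_inl hev, map_zero]
  have hΘ : ∀ r' s', E (Theta F p t hev r' s') = tau F (Sum.inl j : Y m n) •
      mul F (xOmega F m n) (pd F (Sum.inl j) ((pd F (Sum.inl r') ^ p ^ s') f)) := by
    intro r' s'
    rw [hE (val_Theta ht hev r' s' hf), LinearMap.comp_apply, hpow, map_smul]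
  have hA : ∀ r' s', E (adPowN (dW F n p t r') (p ^ s')) = tau F (Sum.inl j : Y m n) •
      pd F (Sum.inl j) ((pd F (Sum.inl r') ^ p ^ s') f) := by
    intro r' s'
    rw [hE (val_adPowN ht r' _ hf), hpow]
  have hval : (δ (hamN F n p t ⟨f, hf⟩)).1 (gen F (Sum.inl j.swap)) = E δ := rfl
  have hne : (Finset.univ : Finset (Fin n)) ≠ ∅ := by
    intro h
    have := congrArg Finset.card h
    simp at this
    omega
  have hco : ∀ r', ∀ s' ∈ Finset.Ico 1 (t r'), ∀ v : Finset (Fin n),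
      coef F 0 v (pd F (Sum.inl j) ((pd F (Sum.inl r') ^ p ^ s') f))
        = if r' = r ∧ s' = s ∧ v = ∅ then 1 else 0 := by
    intro r' s' hs' v
    have h1 : 1 < p ^ s' := Nat.one_lt_pow (by have := (Finset.mem_Ico.1 hs').1; omega)
      (Fact.out : p.Prime).one_lt
    rw [hfdef, coef_pd_pd_pow hj h1]
    refine if_congr ?_ rfl rfl
    rw [Nat.pow_right_inj (Fact.out : p.Prime).one_lt]
  have hsum : ∀ X : Y0 m → ℕ → F, ∑ r', ∑ s' ∈ Finset.Ico 1 (t r'),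
      (if r' = r ∧ s' = s then X r' s' else 0) = X r s := by
    intro X
    rw [Finset.sum_eq_single r, Finset.sum_eq_single s]
    · simp
    · intro s' _ hs'
      simp [hs']
    · exact fun h => absurd hs h
    · intro i _ hi
      simp [hi]
    · simp
  rw [hval, hδ]
  simp only [map_add, map_sum, map_smul, hΓ, hΦ, hΘ, hA, smul_zero, zero_add,
    coef_empty_xOmega_mul hn, coef_univ_xOmega_mul, smul_eq_mul, mul_zero]
  constructor
  · rw [← hsum (fun r' s' => eta r' s' * tau F (Sum.inl j : Y m n))]
    refine Finset.sum_congr rfl fun r' _ => Finset.sum_congr rfl fun s' hs' => ?_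
    rw [hco r' s' hs']
    by_cases h : r' = r ∧ s' = s
    · rw [if_pos ⟨h.1, h.2, rfl⟩, if_pos h, mul_one]
    · rw [if_neg (fun h' => h ⟨h'.1, h'.2.1⟩), if_neg h, mul_zero, mul_zero]
  · rw [← hsum (fun r' s' => mu r' s' * tau F (Sum.inl j : Y m n))]
    refine Finset.sum_congr rfl fun r' _ => Finset.sum_congr rfl fun s' hs' => ?_
    have hne' : ¬ (r' = r ∧ s' = s ∧ (Finset.univ : Finset (Fin n)) = ∅) := fun h => hne h.2.2
    rw [hco r' s' hs', hco r' s' hs', if_neg hne', mul_zero, mul_zero, add_zero]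
    by_cases h : r' = r ∧ s' = s
    · rw [if_pos ⟨h.1, h.2, rfl⟩, if_pos h, mul_one]
    · rw [if_neg (fun h' => h ⟨h'.1, h'.2.1⟩), if_neg h, mul_zero, mul_zero]

lemma hamN_mem_nGrade {α : Y0 m → ℕ} {u : Finset (Fin n)} (h : mono F α u ∈ nPot F n p t)
    (hα : α ≤ piMax p t) (hu : Even u.card) {k : ℤ}
    (hk : ((∑ j, α j + u.card : ℕ) : ℤ) = k + 2) :
    hamN F n p t ⟨mono F α u, h⟩ ∈ nGrade F n p t k :=
  ham_mono_mem_wittGrade hα hu hk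

lemma containsLow_killed (hp : 3 < p) (hm : 0 < m) (ht : ∀ i, 1 ≤ t i)
    (hvan : ∀ x ∈ nGrade F n p t (-1) ⊔ nGrade F n p t 0, δ x = 0) : ContainsLow (killed δ) := by
  have hπ := lt_piMax hp ht
  have key : ∀ (β : Y0 m → ℕ) (u : Finset (Fin n)), (∀ i, β i ≤ 3) → Even u.card →
      (∑ j, β j + u.card = 1 ∨ ∑ j, β j + u.card = 2) → mono F β u ∈ killed δ := by
    intro β u hβ hu hd
    have hle : β ≤ piMax p t := fun i => (hβ i).trans (hπ i).le
    have hf := mono_mem_nPot (F := F) (Adm.of_lt hle hu (Sum.inl ⟨0, hm⟩) ((hβ _).trans_lt (hπ _)))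
    rw [mem_killed]
    refine ⟨hf, ?_⟩
    rw [hvan]
    · rfl
    · rcases hd with hd | hd
      · exact Submodule.mem_sup_left (hamN_mem_nGrade hf hle hu (by rw [hd]; norm_num))
      · exact Submodule.mem_sup_right (hamN_mem_nGrade hf hle hu (by rw [hd]; norm_num))
  have h1 : ∀ (i l : Y0 m) (k : ℕ), (Pi.single i k : Y0 m → ℕ) l ≤ k := by
    intro i l k
    rw [Pi.single_apply]
    split_ifs <;> omega
  have h2 : ∀ (i : Y0 m) (k : ℕ), ∑ l, (Pi.single i k : Y0 m → ℕ) l = k := by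
    intro i k
    simp
  refine ⟨?_, fun i => key _ _ ?_ (by simp) ?_, fun i => key _ _ ?_ (by simp) ?_,
    fun i j _ => key _ _ ?_ (by simp) ?_, fun a b hab => key _ _ (by simp) (by simp [hab]) ?_⟩
  -- The constant potential is not covered by `key`; it is killed because D_H(1) = 0.
  · have hf := mono_mem_nPot (F := F) (n := n) (u := ∅) (Adm.of_lt (p := p) (t := t) (β := 0)
      (fun i => Nat.zero_le _) (by simp) (Sum.inl ⟨0, hm⟩) ((Nat.zero_le 3).trans_lt (hπ _)))
    have h0 : hamN F n p t ⟨mono F 0 ∅, hf⟩ = 0 := by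
      ext1
      ext1
      refine LinearMap.ext fun g => ?_
      change ham F (mono F 0 ∅) g = 0
      rw [ham_mono_empty]
      refine Finset.sum_eq_zero fun i _ => ?_
      rw [pd_inl_of_zero rfl]
      simp
    rw [mem_killed]
    refine ⟨hf, ?_⟩
    rw [h0, map_zero]
    rfl
  · intro l
    have := h1 i l 1
    omega
  · left
    simp [h2]
  · intro l
    have := h1 i l 2
    omega
  · right
    simp [h2]
  · intro l
    have := h1 i l 1
    have := h1 j l 1
    rw [Pi.add_apply]
    omega
  · right
    simp [Finset.sum_add_distrib, h2]
  · right
    simp [hab]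

end

end HamSuper

/-! ### The classification of homogeneous derivations vanishing in degrees -1 and 0. -/

theorem theorem4p7 (F : Type*) [Field F] (p : ℕ) [Fact p.Prime] [CharP F p] (hp : 3 < p)
    (m n : ℕ) (hm : 1 < m) (hn : 3 < n) (t : HamSuper.Y0 m → ℕ) (ht : ∀ i, 1 ≤ t i)
    (φ : LieDerivation F (HamSuper.nAlg F n p t) (HamSuper.evenWitt F n p t))
    (hφ : HamSuper.IsZHomogeneous φ)
    (hvan : ∀ x ∈ HamSuper.nGrade F n p t (-1) ⊔ HamSuper.nGrade F n p t 0, φ x = 0) :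
    (∀ hev : Even n, ∃ (c : F) (lam mu eta : HamSuper.Y0 m → ℕ → F),
      (∀ r, ∀ s ∈ Finset.Ico 1 (t r), mu r s * eta r s = 0) ∧
      (φ : HamSuper.nAlg F n p t →ₗ[F] HamSuper.evenWitt F n p t)
        = c • HamSuper.adN (HamSuper.gammaPrime F n p t)
          + ∑ r, ∑ s ∈ Finset.Ico 1 (t r),
            (lam r s • HamSuper.Phi F p t hev r s
              + mu r s • HamSuper.Theta F p t hev r s
              + eta r s • HamSuper.adPowN (HamSuper.dW F n p t r) (p ^ s))) ∧
    (Odd n → ∃ (c : F) (eta : HamSuper.Y0 m → ℕ → F),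
      (φ : HamSuper.nAlg F n p t →ₗ[F] HamSuper.evenWitt F n p t)
        = c • HamSuper.adN (HamSuper.gammaPrime F n p t)
          + ∑ r, ∑ s ∈ Finset.Ico 1 (t r),
            eta r s • HamSuper.adPowN (HamSuper.dW F n p t r) (p ^ s)) := by
  have hder : HamSuper.IsDer (φ : HamSuper.nAlg F n p t →ₗ[F] HamSuper.evenWitt F n p t) :=
    fun x y => φ.leibniz' x y
  obtain ⟨c, hc⟩ := HamSuper.exists_sub_gammaPrime hp ht hm hn hder
    (HamSuper.containsLow_killed hp (by omega) ht hvan)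
  obtain ⟨lam, mu, eta, h⟩ := HamSuper.exists_eq_sum_of_killed hp ht hm hn
    (hder.sub ((HamSuper.isDer_adN _).smul c)) (t' := 1) (fun _ => le_rfl) ht hc
  rw [sub_eq_iff_eq_add'] at h
  refine ⟨fun hev => ?_, fun hodd => ⟨c, eta, ?_⟩⟩
  · simp only [HamSuper.phiMap_of_even hev, HamSuper.thetaMap_of_even hev] at h
    refine ⟨c, lam, mu, eta, fun r s hs => ?_, h⟩
    -- If both coefficients were nonzero, the component at x_{j'} of the value at x_r^(p^s) x_j
    -- would have nonzero coefficients both at 1 and at x^ω. Homogeneity makes their degrees 0 and n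
    -- equal, which is absurd.
    by_contra hne
    obtain ⟨j, hj, hj'⟩ := HamSuper.exists_off_pair hm r
    have hst := (Finset.mem_Ico.1 hs).2
    have hπ := HamSuper.lt_piMax hp ht
    have hle : Pi.single r (p ^ s) + Pi.single j 1 ≤ HamSuper.piMax p t := by
      refine HamSuper.add_single_le (HamSuper.single_le_piMax ?_) ?_
      · exact HamSuper.pow_le_piMax (t' := fun _ => s) hst
      · have := hπ j
        rw [Pi.single_eq_of_ne hj]
        omega
    have hf := HamSuper.mono_mem_nPot (F := F) (n := n) (u := ∅)
      (HamSuper.Adm.of_lt hle (by simp) r.swap (by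
        have := hπ r.swap
        rw [Pi.add_apply, Pi.single_eq_of_ne (HamSuper.swap_ne r), Pi.single_eq_of_ne hj'.symm]
        omega))
    obtain ⟨he, hm'⟩ := HamSuper.coef_of_val ht (by omega) hev h hj hs ⟨hf, rfl⟩
    obtain ⟨d, hd⟩ := hφ
    -- Unification chooses the degree of the argument as the degree of its potential minus two.
    have hgr := hd _ _ (HamSuper.hamN_mem_nGrade hf hle (by simp) (eq_add_of_sub_eq rfl))
    have hτ := HamSuper.tau_ne_zero (F := F) (n := n) j
    have h1 := HamSuper.degree_of_coef_ne_zero hgr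
      (he.trans_ne (mul_ne_zero (right_ne_zero_of_mul hne) hτ))
    have h2 := HamSuper.degree_of_coef_ne_zero hgr
      (hm'.trans_ne (mul_ne_zero (left_ne_zero_of_mul hne) hτ))
    rw [← h1] at h2
    simp at h2
    omega
  · simp only [HamSuper.phiMap_of_odd hodd, HamSuper.thetaMap_of_odd hodd, smul_zero, zero_add] at h
    exact h
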